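/- Theorem 3.1 (Modulational instability index). Let $g,d,T>0$ with $T/(gd^2)\neq 1/3$, and put $$m(z)=\sqrt{gd\Big(1+\frac{T}{gd^2}z^2\Big)\frac{\tanh z}{z}}\quad(z\neq0),\qquad m(0)=\sqrt{gd},$$ so that $m(\kappa d)=\sqrt{(g+T\kappa^2)\tanh(\kappa d)/\kappa}$ is the symbol, at wave number $\kappa$, of the Fourier multiplier $\mathcal M$ in the capillarity-modified Whitham equation $u_t+\mathcal M u_x+(u^2)_x=0$. Let $\Sigma=(0,\infty)$ if $T/(gd^2)\ge 1/3$, and $\Sigma=\{k>0: m(kd)\neq m(Nkd)\text{ for every integer }N\ge2\}$ if $T/(gd^2)<1/3$. Let $k\in\Sigma$. A $2\pi/k$-periodic traveling wave $u(x,t)=w(k(x-ct))$ is given by a speed $c\in\mathbb R$ and a smooth, real, $2\pi$-periodic function $w$ satisfying $$\mathcal M_k w-cw+w^2=B\ \text{ for some } B\in\mathbb R,\qquad \mathcal M_k e^{inz}=m(nkd)e^{inz}\quad(n\in\mathbb Z).$$ For $\xi\in\mathbb R$ let $\mathcal L_\xi=e^{-i\xi z}\,\partial_z(-\mathcal M_k+c-2w)\,e^{i\xi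 z}$, regarded as an unbounded operator on the space $L^2_{2\pi}$ of $2\pi$-periodic, locally square-integrable complex functions, with domain $\{\phi\in L^2_{2\pi}:\mathcal L_\xi\phi\in L^2_{2\pi}\}$, where $\mathcal M_k$ acts on $e^{i(n+\xi)z}$ as multiplication by $m((n+\xi)kd)$. The wave is called modulationally unstable if for every $\delta>0$ there are $\xi$ with $|\xi|<\delta$ and $\lambda$ in the spectrum of $\mathcal L_\xi$ with $|\lambda|<\delta$ and $\operatorname{Re}\lambda\neq0$; otherwise it is called modulationally stable. Define $$\Delta_{BF}(z)=2\big(m(z)-m(2z)\big)+\big((zm(z))'-m(0)\big),\qquad \Delta_{MI}(z)=\frac{(zm(z))''\,\big((zm(z))'-m(0)\big)}{m(z)-m(2z)}\,\Delta_{BF}(z).$$ Then there is $\varepsilon>0$, depending only on $g,d,T,k$, such that every non-constant $2\pi/k$-periodic traveling wave $(w,c)$ with $\sup|w|<\varepsilon$ and $|c-m(kd)|<\varepsilon$ is modulationally unstable if $\Delta_{MI}(kd)<0$ and modulationally stable if $\Delta_{MI}(kd)>0$. -/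

import Mathlib

open MeasureTheory AddCircle
open scoped ENNReal Real ContDiff

namespace Whitham

noncomputable section

instance factTwoPiPos : Fact (0 < 2 * π) := ⟨Real.two_pi_pos⟩

/-! ### The dispersion symbol, admissible wave numbers and the index -/

/-- The nondimensional capillary-gravity phase speed
`m(z) = √(g d (1 + T/(g d²) z²) tanh z / z)`, with its continuous value `m(0) = √(g d)`.
The symbol of the equation at the (dimensional) wave number `κ` is
`m(κ d) = √((g + T κ²) tanh(κ d) / κ)`. -/
def phaseSpeed (g d T z : ℝ) : ℝ :=
  if z = 0 then √(g * d)
  else √(g * d * (1 + T / (g * d ^ 2) * z ^ 2) * (Real.tanh z / z))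

/-- The set `Σ` of admissible wave numbers: all of `(0,∞)` if `T/(g d²) ≥ 1/3`, and otherwise
`(0,∞)` with every `k` removed at which the fundamental mode resonates with some
harmonic `N ≥ 2`, that is `m(kd) = m(Nkd)`. -/
def admissible (g d T : ℝ) : Set ℝ :=
  {k | 0 < k ∧ (T / (g * d ^ 2) < 1 / 3 →
    ∀ N : ℕ, 2 ≤ N → phaseSpeed g d T (k * d) ≠ phaseSpeed g d T (N * (k * d)))}

/-- `Δ_BF(z) = 2 (m(z) - m(2z)) + ((z m(z))' - m(0))`. -/
def indexBF (m : ℝ → ℝ) (z : ℝ) : ℝ :=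
  2 * (m z - m (2 * z)) + (deriv (fun s => s * m s) z - m 0)

/-- `Δ_MI(z) = (z m(z))'' ((z m(z))' - m(0)) / (m(z) - m(2z)) · Δ_BF(z)`. -/
def indexMI (m : ℝ → ℝ) (z : ℝ) : ℝ :=
  iteratedDeriv 2 (fun s => s * m s) z * (deriv (fun s => s * m s) z - m 0)
    / (m z - m (2 * z)) * indexBF m z

/-! ### Periodic traveling waves -/

/-- `w` is a smooth `2π`-periodic profile of a traveling wave `u(x,t) = w(k(x - ct))`:
`𝓜_κ w - c w + w² = B` for some real constant `B`, where `𝓜_κ e^{inz} = m(κ n) e^{inz}`.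
The value `(𝓜_κ w)(z)` is the sum of its (absolutely convergent) Fourier series, so the equation
says that this series sums to `c w(z) - w(z)² + B`. -/
structure IsTravelingWave (m : ℝ → ℝ) (κ c : ℝ) (w : C(AddCircle (2 * π), ℝ)) : Prop where
  smooth : ContDiff ℝ ∞ (fun z : ℝ => w (z : AddCircle (2 * π)))
  equation : ∃ B : ℝ, ∀ z : AddCircle (2 * π),
    HasSum (fun n : ℤ => (m (κ * n) : ℂ) * fourierCoeff (fun x => (w x : ℂ)) n * fourier n z)
      ((c * w z - w z ^ 2 + B : ℝ) : ℂ)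

/-! ### The Bloch operators and their spectra -/

/-- The space `L²_{2π}` of complex functions, with respect to `dz/(2π)`. -/
abbrev L2per : Type := Lp ℂ 2 (haarAddCircle : Measure (AddCircle (2 * π)))

/-- Multiplication by a real continuous periodic function, as a bounded operator on `L²_{2π}`. -/
def mulOp (w : C(AddCircle (2 * π), ℝ)) : L2per →L[ℂ] L2per :=
  (ContinuousLinearMap.mul ℂ ℂ).holderL haarAddCircle ∞ 2 2
    (ContinuousMap.toLp ∞ haarAddCircle ℂ
      (⟨fun x => (w x : ℂ), by fun_prop⟩ : C(AddCircle (2 * π), ℂ)))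

theorem coeFn_mulOp (w : C(AddCircle (2 * π), ℝ)) (φ : L2per) :
    mulOp w φ =ᵐ[haarAddCircle] fun x => (w x : ℂ) * φ x := by
  filter_upwards [(ContinuousLinearMap.mul ℂ ℂ).coeFn_holder (r := 2)
    (ContinuousMap.toLp ∞ haarAddCircle ℂ
      (⟨fun x => (w x : ℂ), by fun_prop⟩ : C(AddCircle (2 * π), ℂ))) φ,
    ContinuousMap.coeFn_toLp (p := ∞) (𝕜 := ℂ) haarAddCircle
      (⟨fun x => (w x : ℂ), by fun_prop⟩ : C(AddCircle (2 * π), ℂ))] with x h1 h2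
  refine Eq.trans h1 ?_
  rw [h2]
  rfl

/-- The `n`-th Fourier coefficient of
`𝓛_ξ φ = e^{-iξz} ∂_z (-𝓜_κ + c - 2w) (e^{iξz} φ)`, for `φ ∈ L²_{2π}` (in the sense of
periodic distributions): conjugation with `e^{iξz}` shifts the frequency `n` to `n + ξ`. -/
def blochCoeff (m : ℝ → ℝ) (κ c : ℝ) (w : C(AddCircle (2 * π), ℝ)) (ξ : ℝ)
    (φ : L2per) (n : ℤ) : ℂ :=
  Complex.I * (n + ξ) *
    ((c - m (κ * (n + ξ)) : ℝ) * fourierCoeff φ n - 2 * fourierCoeff (mulOp w φ) n)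

theorem blochCoeff_add (m : ℝ → ℝ) (κ c : ℝ) (w : C(AddCircle (2 * π), ℝ)) (ξ : ℝ)
    (φ ψ : L2per) : blochCoeff m κ c w ξ (φ + ψ)
      = blochCoeff m κ c w ξ φ + blochCoeff m κ c w ξ ψ := by
  ext n
  simp only [blochCoeff, Pi.add_apply, ← fourierBasis_repr, map_add, lp.coeFn_add]
  ring

theorem blochCoeff_smul (m : ℝ → ℝ) (κ c : ℝ) (w : C(AddCircle (2 * π), ℝ)) (ξ : ℝ)
    (a : ℂ) (φ : L2per) : blochCoeff m κ c w ξ (a • φ) = a • blochCoeff m κ c w ξ φ := by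
  ext n
  simp only [blochCoeff, Pi.smul_apply, ← fourierBasis_repr, map_smul, lp.coeFn_smul,
    smul_eq_mul]
  ring

/-- The unbounded operator `𝓛_ξ` on `L²_{2π}` with its maximal domain
`{φ ∈ L²_{2π} : 𝓛_ξ φ ∈ L²_{2π}}`. -/
def blochOp (m : ℝ → ℝ) (κ c : ℝ) (w : C(AddCircle (2 * π), ℝ)) (ξ : ℝ) :
    L2per →ₗ.[ℂ] L2per where
  domain :=
    { carrier := {φ | Memℓp (blochCoeff m κ c w ξ φ) 2}
      add_mem' := fun {φ ψ} hφ hψ => by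
        rw [Set.mem_ofPred_eq, blochCoeff_add]; exact hφ.add hψ
      zero_mem' := by
        have h := blochCoeff_smul m κ c w ξ 0 0
        rw [zero_smul, zero_smul] at h
        rw [Set.mem_ofPred_eq, h]; exact zero_memℓp
      smul_mem' := fun a φ hφ => by
        rw [Set.mem_ofPred_eq, blochCoeff_smul]; exact hφ.const_smul a }
  toFun :=
    { toFun := fun φ => fourierBasis.repr.symm ⟨blochCoeff m κ c w ξ φ, φ.2⟩
      map_add' := fun φ ψ => by
        rw [← map_add]; congr 1; ext n
        exact congrFun (blochCoeff_add m κ c w ξ φ ψ) n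
      map_smul' := fun a φ => by
        rw [RingHom.id_apply, ← map_smul]; congr 1; ext n
        exact congrFun (blochCoeff_smul m κ c w ξ a φ) n }

/-- The spectrum of an unbounded operator `A`: the complement of the set of `lam ∈ ℂ` for which
`lam - A : dom A → E` is a bijection with a bounded inverse `R`. -/
def unboundedSpectrum {E : Type*} [NormedAddCommGroup E] [NormedSpace ℂ E] (A : E →ₗ.[ℂ] E) :
    Set ℂ :=
  {lam | ∃ R : E →L[ℂ] E,
    (∀ f : E, ∃ h : R f ∈ A.domain, lam • R f - A ⟨R f, h⟩ = f) ∧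
    ∀ φ : A.domain, R (lam • (φ : E) - A φ) = φ}ᶜ

/-- The wave `(w, c)` is modulationally unstable: arbitrarily close to `ξ = 0` there are Bloch
operators `𝓛_ξ` with spectrum arbitrarily close to the origin and off the imaginary axis. -/
def ModulationallyUnstable (m : ℝ → ℝ) (κ c : ℝ) (w : C(AddCircle (2 * π), ℝ)) : Prop :=
  ∀ ε > 0, ∃ ξ : ℝ, |ξ| < ε ∧
    ∃ lam ∈ unboundedSpectrum (blochOp m κ c w ξ), ‖lam‖ < ε ∧ lam.re ≠ 0

/-- Modulational stability is the absence of modulational instability: for all small `|ξ|`, the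
spectrum of `𝓛_ξ` in a neighborhood of the origin lies on the imaginary axis. -/
def ModulationallyStable (m : ℝ → ℝ) (κ c : ℝ) (w : C(AddCircle (2 * π), ℝ)) : Prop :=
  ∃ ε > 0, ∀ ξ : ℝ, |ξ| < ε →
    ∀ lam ∈ unboundedSpectrum (blochOp m κ c w ξ), ‖lam‖ < ε → lam.re = 0

end

end Whitham

/-! Put κ = kd and λ = iμ. On Fourier coefficients the equation `𝓛_ξ φ = λ φ` reads (n+ξ)[(c -
m(κ(n+ξ))) φ_n - 2 (w∗φ)_n] = μ φ_n, so instability means that nonreal μ occur arbitrarily close to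
0.

For a small wave c is close to m(κ), and nonresonance keeps c - m(κ(n+ξ)) away from 0 for |n| ≥ 2.
The high modes are therefore eliminated by a Neumann series (`liftOp`), and near the origin λ lies
in the spectrum exactly when the determinant of a 3×3 matrix, holomorphic in μ, vanishes
(`det_reducedMatrix_eq_zero_iff`, `exists_solution_operator`).

A translation and the removal of the mean make the wave even with a positive first coefficient a
(`exists_smallWave`). Its second coefficient is close to σa², σ = 1/(m(κ) - m(2κ)). Since w' solves
the linearized equation at ξ = 0, the speed correction c - m(κ) drops out of the matrix. What
remains is an explicit leading-order model (`exists_nearModel`), valid when a is small and μ, ξ are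
small compared with a².

Let s = κm'(κ), q = κ²m''(κ)/2, ν₀ = m(κ) - m(0), Γ = ν₀ + s and μ = νξ. The determinant divided by
ξ³ is close to -4(ν+s)²(ν₀-ν), up to O(a²): a simple root at ν₀ and a double root at -s. The wave
splits the double root: with ν = -s + ay the determinant becomes -4Γa²ξ³(y² - K) to leading order,
where K = 4(q+s)(σ + 2/Γ) is a positive multiple of the index (`discriminant_eq_mul_indexMI`). If K
< 0, a root near y = i√|K| is nonreal. If K > 0, the roots come in conjugate pairs because the wave
has real coefficients, and near simple real roots of the model a nonreal pair is impossible.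

The comparison with the model must hold uniformly from |ν+s| of order a up to order 1. `DetClose`
therefore carries a free scale h ≥ a, and `exists_root_dichotomy` treats the ranges of μ and ν one
by one. -/

namespace Whitham

noncomputable section

/-! ### Square-summable sequences, diagonal operators and convolutions -/

/-- Square-summable complex sequences indexed by `ℤ`. -/
abbrev EllTwo : Type := lp (fun _ : ℤ => ℂ) 2

namespace EllTwo

theorem memℓp_iff {f : ℤ → ℂ} : Memℓp f 2 ↔ Summable fun n => ‖f n‖ ^ 2 := by
  rw [memℓp_gen_iff (by norm_num)]
  simp

theorem hasSum_norm_sq (x : EllTwo) : HasSum (fun n => ‖x n‖ ^ 2) (‖x‖ ^ 2) := by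
  simpa using lp.hasSum_norm (by norm_num : 0 < (2 : ℝ≥0∞).toReal) x

theorem norm_apply_le (x : EllTwo) (n : ℤ) : ‖x n‖ ≤ ‖x‖ :=
  lp.norm_apply_le_norm (by norm_num) x n

theorem add_apply (x y : EllTwo) (n : ℤ) : (x + y) n = x n + y n := rfl

theorem sub_apply (x y : EllTwo) (n : ℤ) : (x - y) n = x n - y n := rfl

theorem smul_apply (a : ℂ) (x : EllTwo) (n : ℤ) : (a • x) n = a * x n := rfl

theorem norm_le_of_forall {x y : EllTwo} {a : ℝ} (ha : 0 ≤ a) (h : ∀ n, ‖x n‖ ≤ a * ‖y n‖) :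
    ‖x‖ ≤ a * ‖y‖ := by
  have : ‖x‖ ≤ ‖(a : ℂ) • y‖ := by
    refine lp.norm_mono (by norm_num) fun n => ?_
    rw [smul_apply, norm_mul, Complex.norm_real, Real.norm_of_nonneg ha]
    exact h n
  rwa [norm_smul, Complex.norm_real, Real.norm_of_nonneg ha] at this

/-- The sequence of absolute values. -/
def absSeq (x : EllTwo) : EllTwo :=
  ⟨fun n => (‖x n‖ : ℂ), memℓp_iff.2 (by simpa using (hasSum_norm_sq x).summable)⟩

theorem absSeq_apply (x : EllTwo) (n : ℤ) : absSeq x n = (‖x n‖ : ℂ) := rfl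

theorem norm_absSeq (x : EllTwo) : ‖absSeq x‖ = ‖x‖ := by
  refine le_antisymm ?_ ?_ <;> refine lp.norm_mono (by norm_num) fun n => ?_ <;>
    simp [absSeq_apply]

/-- Passing to sequences of absolute values turns the pointwise domination into domination by a
single element of `EllTwo`, to which the triangle inequality applies. -/
theorem norm_le_of_forall_add {x y z : EllTwo} {a b : ℝ} (ha : 0 ≤ a) (hb : 0 ≤ b)
    (h : ∀ n, ‖x n‖ ≤ a * ‖y n‖ + b * ‖z n‖) : ‖x‖ ≤ a * ‖y‖ + b * ‖z‖ := by
  have h1 : ‖x‖ ≤ ‖(a : ℂ) • absSeq y + (b : ℂ) • absSeq z‖ := by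
    refine lp.norm_mono (by norm_num) fun n => ?_
    have : (((a : ℂ) • absSeq y + (b : ℂ) • absSeq z : EllTwo) : ℤ → ℂ) n
        = ((a * ‖y n‖ + b * ‖z n‖ : ℝ) : ℂ) := by
      rw [add_apply, smul_apply, smul_apply, absSeq_apply, absSeq_apply]
      push_cast
      rfl
    rw [this, Complex.norm_real, Real.norm_of_nonneg (by positivity)]
    exact h n
  refine h1.trans ((norm_add_le _ _).trans ?_)
  rw [norm_smul, norm_smul, norm_absSeq, norm_absSeq, Complex.norm_real, Complex.norm_real,
    Real.norm_of_nonneg ha, Real.norm_of_nonneg hb]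

/-- Reindexing a square-summable sequence along a permutation of `ℤ`. -/
def reindex (e : ℤ ≃ ℤ) (x : EllTwo) : EllTwo :=
  ⟨fun n => x (e n), memℓp_iff.2 (e.summable_iff.2 (hasSum_norm_sq x).summable)⟩

@[simp] theorem reindex_apply (e : ℤ ≃ ℤ) (x : EllTwo) (n : ℤ) : reindex e x n = x (e n) := rfl

theorem norm_reindex (e : ℤ ≃ ℤ) (x : EllTwo) : ‖reindex e x‖ = ‖x‖ := by
  have h1 := hasSum_norm_sq (reindex e x)
  have h2 := e.hasSum_iff.2 (hasSum_norm_sq x)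
  exact (pow_left_inj₀ (norm_nonneg _) (norm_nonneg _) two_ne_zero).1 (h1.unique h2)

/-- The reflection `n ↦ -n`. -/
def reflect (x : EllTwo) : EllTwo := reindex (Equiv.neg ℤ) x

@[simp] theorem reflect_apply (x : EllTwo) (n : ℤ) : reflect x n = x (-n) := rfl

theorem norm_reflect (x : EllTwo) : ‖reflect x‖ = ‖x‖ := norm_reindex _ x

/-- The standard unit sequences. -/
def unitSeq (j : ℤ) : EllTwo := lp.single 2 j (1 : ℂ)

theorem unitSeq_apply (j n : ℤ) : unitSeq j n = if n = j then 1 else 0 := by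
  rcases eq_or_ne n j with rfl | h
  · simp [unitSeq]
  · simp [unitSeq, h]

theorem norm_unitSeq (j : ℤ) : ‖unitSeq j‖ = 1 := by
  simp [unitSeq, lp.norm_single]

/-- Bounded multiplication of a sequence by a sequence (`0` if the multiplier is unbounded). -/
def diagOp (d : ℤ → ℂ) : EllTwo →L[ℂ] EllTwo :=
  open Classical in
  if h : ∃ C, ∀ n, ‖d n‖ ≤ C then
    LinearMap.mkContinuous
      { toFun := fun x => ⟨fun n => d n * x n, by
          obtain ⟨C, hC⟩ := h
          refine memℓp_iff.2 (Summable.of_nonneg_of_le (fun _ => by positivity) (fun n => ?_)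
            ((hasSum_norm_sq x).summable.mul_left (C ^ 2)))
          rw [norm_mul, mul_pow]
          have := hC n
          gcongr⟩
        map_add' := fun x y => by ext n; exact mul_add _ _ _
        map_smul' := fun a x => by ext n; exact mul_left_comm _ _ _ }
      |Classical.choose h| (fun x => by
        refine norm_le_of_forall (abs_nonneg _) fun n => ?_
        rw [LinearMap.coe_mk, AddHom.coe_mk, norm_mul]
        gcongr
        exact (Classical.choose_spec h n).trans (le_abs_self _))
  else 0

theorem diagOp_apply {d : ℤ → ℂ} {C : ℝ} (h : ∀ n, ‖d n‖ ≤ C) (x : EllTwo) (n : ℤ) :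
    diagOp d x n = d n * x n := by
  have h' : ∃ C, ∀ n, ‖d n‖ ≤ C := ⟨C, h⟩
  rw [diagOp, dif_pos h']
  rfl

theorem norm_diagOp_le {d : ℤ → ℂ} {C : ℝ} (h : ∀ n, ‖d n‖ ≤ C) : ‖diagOp d‖ ≤ C := by
  have hC : 0 ≤ C := (norm_nonneg _).trans (h 0)
  refine ContinuousLinearMap.opNorm_le_bound _ hC fun x => norm_le_of_forall hC fun n => ?_
  rw [diagOp_apply h, norm_mul]
  gcongr
  exact h n

/-- `W` is convolution with the sequence `v`. -/
def IsConv (W : EllTwo →L[ℂ] EllTwo) (v : EllTwo) : Prop :=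
  ∀ (φ : EllTwo) (n : ℤ), HasSum (fun j => v (n - j) * φ j) (W φ n)

namespace IsConv

variable {W : EllTwo →L[ℂ] EllTwo} {v : EllTwo}

/-- Cauchy–Schwarz in the convolution sum. It matters that `‖v‖` appears and not `‖W‖`: for a small
wave `‖v‖` is of the order of the amplitude a, while `‖W‖` is only known to be at most ε. -/
theorem norm_apply_le (h : IsConv W v) (φ : EllTwo) (n : ℤ) : ‖W φ n‖ ≤ ‖v‖ * ‖φ‖ := by
  have hq : ((2 : ℝ≥0∞).toReal).HolderConjugate (2 : ℝ≥0∞).toReal := by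
    simpa using Real.HolderConjugate.two_two
  have h1 := lp.summable_mul hq (reindex (Equiv.subLeft n) v) φ
  have h2 := lp.tsum_mul_le_mul_norm hq (reindex (Equiv.subLeft n) v) φ
  rw [norm_reindex] at h2
  rw [← (h φ n).tsum_eq]
  refine (norm_tsum_le_tsum_norm ?_).trans (le_trans (le_of_eq ?_) h2.2)
  · simpa using h1
  · simp

theorem apply_unitSeq (h : IsConv W v) (j : ℤ) : W (unitSeq j) = reindex (Equiv.subRight j) v := by
  ext n
  refine (h (unitSeq j) n).unique ?_
  have := hasSum_single (f := fun i => v (n - i) * unitSeq j i) j (fun i hi => by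
    simp [unitSeq_apply, hi])
  simpa [unitSeq_apply] using this

theorem norm_apply_unitSeq (h : IsConv W v) (j : ℤ) : ‖W (unitSeq j)‖ = ‖v‖ := by
  rw [h.apply_unitSeq, norm_reindex]

theorem apply_unitSeq_apply (h : IsConv W v) (j n : ℤ) : W (unitSeq j) n = v (n - j) := by
  rw [h.apply_unitSeq]; rfl

theorem norm_le_norm (h : IsConv W v) : ‖v‖ ≤ ‖W‖ := by
  rw [← h.norm_apply_unitSeq 0]
  simpa [norm_unitSeq] using W.le_opNorm (unitSeq 0)

theorem apply_star (h : IsConv W v) (hv : ∀ n, star (v n) = v n) (φ : EllTwo) :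
    W (star φ) = star (W φ) := by
  ext n
  refine (h (star φ) n).unique ?_
  have := (h φ n).star
  simpa [lp.star_apply, hv] using this

theorem apply_reflect (h : IsConv W v) (hv : ∀ n, v (-n) = v n) (φ : EllTwo) :
    W (reflect φ) = reflect (W φ) := by
  ext n
  refine (h (reflect φ) n).unique ?_
  have := (Equiv.neg ℤ).hasSum_iff.2 (h φ (-n))
  refine this.congr_fun fun j => ?_
  simp only [Function.comp, Equiv.neg_apply, reflect_apply]
  rw [← hv (n - j), show -n - -j = -(n - j) by ring]

/-- Convolution is commutative. -/
theorem comm {W' : EllTwo →L[ℂ] EllTwo} {v' : EllTwo} (h : IsConv W v) (h' : IsConv W' v') :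
    W v' = W' v := by
  ext n
  refine (h v' n).unique ?_
  have := (Equiv.subLeft n).hasSum_iff.2 (h' v n)
  refine this.congr_fun fun j => ?_
  simp [mul_comm]

end IsConv

end EllTwo

end

end Whitham

namespace Whitham

noncomputable section

/-! ### Regular dispersion symbols -/

/-- The properties of the symbol `m` at the wave number `κ` on which the spectral analysis near
the origin relies; `s = κ m'(κ)` and `q = κ² m''(κ) / 2`. -/
structure RegularSymbol (m : ℝ → ℝ) (κ δ L s q : ℝ) : Prop where
  even : ∀ z, m (-z) = m z
  continuousAt_zero : ContinuousAt m 0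
  gap_pos : 0 < δ
  lip_nonneg : 0 ≤ L
  gap : ∀ n : ℤ, 2 ≤ |n| → δ ≤ |m (κ * n) - m κ|
  lip : ∀ n : ℤ, 2 ≤ |n| → ∀ ξ : ℝ, |ξ| ≤ 1 / 2 → |m (κ * (n + ξ)) - m (κ * n)| ≤ L * |ξ|
  second : ∀ n : ℤ, 2 ≤ |n| → ∀ ξ : ℝ, |ξ| ≤ 1 / 2 →
    |m (κ * (n + ξ)) + m (κ * (n - ξ)) - 2 * m (κ * n)| ≤ L * ξ ^ 2
  taylor : (fun ξ => m (κ * (1 + ξ)) - m κ - s * ξ - q * ξ ^ 2) =o[nhds 0] fun ξ => ξ ^ 2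

theorem abs_sub_le_of_hasDerivAt {f f' : ℝ → ℝ} {κ L : ℝ}
    (hf : ∀ z, κ ≤ z → HasDerivAt f (f' z) z) (hL : ∀ z, κ ≤ z → |f' z| ≤ L) {x y : ℝ}
    (hx : κ ≤ x) (hy : κ ≤ y) : |f y - f x| ≤ L * |y - x| :=
  (convex_Ici κ).norm_image_sub_le_of_norm_hasDerivWithin_le
    (fun z hz => (hf z hz).hasDerivWithinAt) (fun z hz => hL z hz) hx hy

/-- The mean value inequality is used twice: for t ↦ f(x+t) + f(x-t), and for its derivative, which
is an increment of `f₁`. The condition on `x` keeps all arguments in the half-line where the bounds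
hold. -/
theorem abs_second_difference_le {f f₁ f₂ : ℝ → ℝ} {κ L : ℝ}
    (hf : ∀ z, κ ≤ z → HasDerivAt f (f₁ z) z) (hf₁ : ∀ z, κ ≤ z → HasDerivAt f₁ (f₂ z) z)
    (hL : ∀ z, κ ≤ z → |f₂ z| ≤ L) (hL0 : 0 ≤ L) {x h : ℝ} (hx : κ + |h| ≤ x) :
    |f (x + h) + f (x - h) - 2 * f x| ≤ 2 * L * h ^ 2 := by
  have key : ∀ t ∈ Set.Icc (-|h|) |h|,
      HasDerivWithinAt (fun t => f (x + t) + f (x - t)) (f₁ (x + t) - f₁ (x - t))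
        (Set.Icc (-|h|) |h|) t := by
    intro t ht
    have h1 : HasDerivAt (fun t => f (x + t)) (f₁ (x + t)) t := by
      simpa using (hf (x + t) (by linarith [ht.1])).comp_const_add x t
    have h2 : HasDerivAt (fun t => f (x - t)) (-f₁ (x - t)) t := by
      simpa using (hf (x - t) (by linarith [ht.2])).comp_const_sub x t
    exact (h1.add h2).hasDerivWithinAt
  have bound : ∀ t ∈ Set.Icc (-|h|) |h|, ‖f₁ (x + t) - f₁ (x - t)‖ ≤ 2 * L * |h| := by
    intro t ht
    have := abs_sub_le_of_hasDerivAt hf₁ hL (x := x - t) (y := x + t) (by linarith [ht.2])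
      (by linarith [ht.1])
    rw [Real.norm_eq_abs]
    refine this.trans ?_
    have h3 : |x + t - (x - t)| = 2 * |t| := by
      rw [show x + t - (x - t) = 2 * t by ring, abs_mul, abs_two]
    have h4 : |t| ≤ |h| := abs_le.2 ht
    rw [h3]
    nlinarith
  have := (convex_Icc (-|h|) |h|).norm_image_sub_le_of_norm_hasDerivWithin_le key bound
    (x := 0) (y := h) (by simp) ⟨neg_abs_le h, le_abs_self h⟩
  simp only [sub_zero, add_zero, Real.norm_eq_abs] at this
  calc _ = |f (x + h) + f (x - h) - (f x + f x)| := by ring_nf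
    _ ≤ 2 * L * |h| * |h| := this
    _ = 2 * L * h ^ 2 := by rw [mul_assoc, ← sq, sq_abs]

/-- The second-order Taylor formula with Peano remainder. -/
theorem isLittleO_second_order {f f₁ : ℝ → ℝ} {x b : ℝ}
    (hf : ∀ᶠ z in nhds x, HasDerivAt f (f₁ z) z) (hf₁ : HasDerivAt f₁ b x) :
    (fun h => f (x + h) - f x - f₁ x * h - b / 2 * h ^ 2) =o[nhds 0] fun h => h ^ 2 := by
  refine Asymptotics.isLittleO_iff.2 fun η hη => ?_
  have h1 := Asymptotics.isLittleO_iff.1 (hasDerivAt_iff_isLittleO_nhds_zero.1 hf₁) hη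
  have ht : Filter.Tendsto (fun h => x + h) (nhds 0) (nhds x) := by
    simpa using (continuous_const_add x).tendsto 0
  obtain ⟨r, hr, hball⟩ := Metric.eventually_nhds_iff_ball.1 (h1.and (ht.eventually hf))
  filter_upwards [Metric.ball_mem_nhds (0 : ℝ) hr] with h hh
  rw [mem_ball_zero_iff, Real.norm_eq_abs] at hh
  have hmem : ∀ t ∈ Set.Icc (-|h|) |h|, t ∈ Metric.ball (0 : ℝ) r := by
    intro t ht
    rw [mem_ball_zero_iff, Real.norm_eq_abs]
    exact (abs_le.2 ht).trans_lt hh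
  have key : ∀ t ∈ Set.Icc (-|h|) |h|,
      HasDerivWithinAt (fun t => f (x + t) - f₁ x * t - b / 2 * t ^ 2)
        (f₁ (x + t) - f₁ x - t * b) (Set.Icc (-|h|) |h|) t := by
    intro t ht
    have h2 : HasDerivAt (fun t => f (x + t)) (f₁ (x + t)) t := by
      simpa using ((hball t (hmem t ht)).2).comp_const_add x t
    have h3 := (h2.sub ((hasDerivAt_id t).const_mul (f₁ x))).sub
      ((hasDerivAt_pow 2 t).const_mul (b / 2))
    refine (h3.congr_deriv ?_).hasDerivWithinAt
    simp
    ring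
  have bound : ∀ t ∈ Set.Icc (-|h|) |h|, ‖f₁ (x + t) - f₁ x - t * b‖ ≤ η * |h| := by
    intro t ht
    have := (hball t (hmem t ht)).1
    simp only [smul_eq_mul, Real.norm_eq_abs] at this ⊢
    exact this.trans (mul_le_mul_of_nonneg_left (abs_le.2 ht) hη.le)
  have := (convex_Icc (-|h|) |h|).norm_image_sub_le_of_norm_hasDerivWithin_le key bound
    (x := 0) (y := h) (by simp) ⟨neg_abs_le h, le_abs_self h⟩
  simp only [sub_zero, add_zero, Real.norm_eq_abs, mul_zero, ne_eq, OfNat.ofNat_ne_zero,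
    not_false_eq_true, zero_pow] at this
  calc _ = |f (x + h) - f₁ x * h - b / 2 * h ^ 2 - f x| := by
        rw [Real.norm_eq_abs]; ring_nf
    _ ≤ η * |h| * |h| := this
    _ = η * ‖h ^ 2‖ := by rw [mul_assoc, ← abs_mul, ← sq, Real.norm_eq_abs]

/-- For |n| ≥ 2 and |ξ| ≤ 1/2 the points κ|n+ξ| stay above κ, so derivative bounds on [κ, ∞) give
the Lipschitz and second-difference estimates; evenness covers negative n. Growth at infinity
reduces the uniform gap to finitely many nonresonance conditions. -/
theorem RegularSymbol.of_hasDerivAt {m m₁ m₂ : ℝ → ℝ} {κ L : ℝ} (hκ : 0 < κ)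
    (even : ∀ z, m (-z) = m z) (hcont : ContinuousAt m 0)
    (hm : ∀ z, 0 < z → HasDerivAt m (m₁ z) z) (hm₁ : ∀ z, 0 < z → HasDerivAt m₁ (m₂ z) z)
    (hL₁ : ∀ z, κ ≤ z → |m₁ z| ≤ L) (hL₂ : ∀ z, κ ≤ z → |m₂ z| ≤ L)
    (htop : Filter.Tendsto m Filter.atTop Filter.atTop)
    (hne : ∀ N : ℕ, 2 ≤ N → m κ ≠ m (N * κ)) :
    ∃ δ L', RegularSymbol m κ δ L' (κ * m₁ κ) (κ ^ 2 * m₂ κ / 2) := by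
  have hL0 : 0 ≤ L := (abs_nonneg _).trans (hL₁ κ le_rfl)
  have hm' : ∀ z, κ ≤ z → HasDerivAt m (m₁ z) z := fun z hz => hm z (hκ.trans_le hz)
  have hm₁' : ∀ z, κ ≤ z → HasDerivAt m₁ (m₂ z) z := fun z hz => hm₁ z (hκ.trans_le hz)
  obtain ⟨δ, hδ, hgap⟩ : ∃ δ > 0, ∀ N : ℕ, 2 ≤ N → δ ≤ |m (κ * N) - m κ| := by
    have h1 : Filter.Tendsto (fun N : ℕ => m (κ * N)) Filter.atTop Filter.atTop :=
      htop.comp (tendsto_natCast_atTop_atTop.const_mul_atTop hκ)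
    -- Beyond `N₀` the gap is at least 1; below it the minimum of finitely many positive numbers is
    -- taken, by induction.
    obtain ⟨N₀, hN₀⟩ := Filter.eventually_atTop.1 (h1.eventually_ge_atTop (m κ + 1))
    have hfin : ∀ M : ℕ, ∃ δ > 0, ∀ N : ℕ, 2 ≤ N → N < M → δ ≤ |m (κ * N) - m κ| := by
      intro M
      induction M with
      | zero => exact ⟨1, one_pos, fun N _ h => absurd h (Nat.not_lt_zero N)⟩
      | succ M ih =>
        obtain ⟨δ, hδ, h⟩ := ih
        rcases lt_or_ge M 2 with h2 | h2
        · exact ⟨δ, hδ, fun N hN hM => h N hN (by omega)⟩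
        · have hpos : 0 < |m (κ * M) - m κ| := by
            rw [abs_pos, sub_ne_zero, mul_comm]
            exact (hne M h2).symm
          refine ⟨min δ |m (κ * M) - m κ|, lt_min hδ hpos, fun N hN hM => ?_⟩
          rcases Nat.lt_succ_iff_lt_or_eq.1 hM with h3 | rfl
          · exact (min_le_left _ _).trans (h N hN h3)
          · exact min_le_right _ _
    obtain ⟨δ, hδ, h⟩ := hfin N₀
    refine ⟨min δ 1, lt_min hδ one_pos, fun N hN => ?_⟩
    rcases lt_or_ge N N₀ with h2 | h2
    · exact (min_le_left _ _).trans (h N hN h2)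
    · refine (min_le_right _ _).trans (le_trans ?_ (le_abs_self _))
      linarith [hN₀ N h2]
  have hlip : ∀ x : ℝ, 2 ≤ x → ∀ ξ : ℝ, |ξ| ≤ 1 / 2 →
      |m (κ * (x + ξ)) - m (κ * x)| ≤ L * κ * |ξ| := by
    intro x hx ξ hξ
    have h2 := abs_le.1 hξ
    have := abs_sub_le_of_hasDerivAt hm' hL₁ (x := κ * x) (y := κ * (x + ξ)) (by nlinarith)
      (by nlinarith)
    rwa [show κ * (x + ξ) - κ * x = κ * ξ by ring, abs_mul, abs_of_pos hκ, ← mul_assoc] at this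
  have hsec : ∀ x : ℝ, 2 ≤ x → ∀ ξ : ℝ, |ξ| ≤ 1 / 2 →
      |m (κ * (x + ξ)) + m (κ * (x - ξ)) - 2 * m (κ * x)| ≤ 2 * L * κ ^ 2 * ξ ^ 2 := by
    intro x hx ξ hξ
    have := abs_second_difference_le hm' hm₁' hL₂ hL0 (x := κ * x) (h := κ * ξ) (by
      rw [abs_mul, abs_of_pos hκ]; nlinarith)
    rwa [← mul_add, ← mul_sub, mul_pow, ← mul_assoc] at this
  have hcast : ∀ n : ℤ, 2 ≤ |n| → (2 : ℝ) ≤ |(n : ℝ)| := fun n hn => by exact_mod_cast hn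
  have habs : ∀ z, m |z| = m z := fun z => by
    rcases abs_choice z with h | h <;> rw [h]
    exact even z
  refine ⟨δ, L * κ + 2 * L * κ ^ 2, even, hcont, hδ, by positivity, ?_, ?_, ?_, ?_⟩
  · intro n hn
    have := hgap n.natAbs (by
      rw [Int.abs_eq_natAbs] at hn; exact_mod_cast hn)
    rwa [Nat.cast_natAbs, Int.cast_abs, ← abs_of_pos hκ, ← abs_mul, habs, abs_of_pos hκ] at this
  · intro n hn ξ hξ
    have h0 : L * κ * |ξ| ≤ (L * κ + 2 * L * κ ^ 2) * |ξ| := by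
      gcongr; linarith [show 0 ≤ 2 * L * κ ^ 2 by positivity]
    refine le_trans ?_ h0
    rcases le_total 0 (n : ℝ) with h | h
    · exact hlip n (by simpa [abs_of_nonneg h] using hcast n hn) ξ hξ
    · have := hlip (-n) (by simpa [abs_of_nonpos h] using hcast n hn) (-ξ) (by simpa using hξ)
      rwa [← neg_add, mul_neg, mul_neg, even, even, abs_neg] at this
  · intro n hn ξ hξ
    have h0 : 2 * L * κ ^ 2 * ξ ^ 2 ≤ (L * κ + 2 * L * κ ^ 2) * ξ ^ 2 := by
      gcongr; linarith [show 0 ≤ L * κ by positivity]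
    refine le_trans ?_ h0
    rcases le_total 0 (n : ℝ) with h | h
    · exact hsec n (by simpa [abs_of_nonneg h] using hcast n hn) ξ hξ
    · have := hsec (-n) (by simpa [abs_of_nonpos h] using hcast n hn) (-ξ) (by simpa using hξ)
      rwa [← neg_add, sub_neg_eq_add, show -(n : ℝ) + ξ = -(n - ξ) by ring, mul_neg, mul_neg,
        mul_neg, even, even, even, neg_sq] at this
  · have h1 := isLittleO_second_order (f := m) (f₁ := m₁) (x := κ)
      ((eventually_gt_nhds hκ).mono hm) (hm₁ κ hκ)
    have ht : Filter.Tendsto (fun ξ => κ * ξ) (nhds 0) (nhds 0) := by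
      simpa using (continuous_const_mul κ).tendsto 0
    have h2 := h1.comp_tendsto ht
    have h3 : ((fun h : ℝ => h ^ 2) ∘ fun ξ => κ * ξ) =O[nhds 0] fun ξ : ℝ => ξ ^ 2 := by
      simp only [Function.comp_def, mul_pow]
      exact Asymptotics.isBigO_const_mul_self _ _ _
    refine (h2.trans_isBigO h3).congr_left fun ξ => ?_
    · simp only [Function.comp_def]
      ring_nf

end

end Whitham

namespace Whitham

noncomputable section

/-! ### The capillary-gravity phase speed is a regular symbol -/

theorem hasDerivAt_tanh (z : ℝ) : HasDerivAt Real.tanh (1 - Real.tanh z ^ 2) z := by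
  have hc : Real.cosh z ≠ 0 := (Real.cosh_pos z).ne'
  have h := (Real.hasDerivAt_sinh z).div (Real.hasDerivAt_cosh z) hc
  have he : Real.sinh / Real.cosh = Real.tanh := by
    ext x; rw [Pi.div_apply, Real.tanh_eq_sinh_div_cosh]
  rw [he] at h
  refine h.congr_deriv ?_
  rw [Real.tanh_eq_sinh_div_cosh]
  field_simp

theorem tanh_pos {z : ℝ} (hz : 0 < z) : 0 < Real.tanh z := by
  rw [Real.tanh_eq_sinh_div_cosh]
  exact div_pos (Real.sinh_pos_iff.2 hz) (Real.cosh_pos z)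

theorem tanh_monotone : Monotone Real.tanh :=
  monotone_of_hasDerivAt_nonneg hasDerivAt_tanh fun z => by
    have := Real.tanh_sq_lt_one z
    simpa using this.le

/-- Here 1 - tanh² = 1/cosh² and z ≤ sinh z. This is what keeps the derivatives of the squared speed
bounded although it contains the growing factor βz. -/
theorem mul_one_sub_tanh_sq_le {z : ℝ} (hz : 0 ≤ z) : z * (1 - Real.tanh z ^ 2) ≤ 1 := by
  have hc := Real.cosh_pos z
  have h1 : 1 - Real.tanh z ^ 2 = 1 / Real.cosh z ^ 2 := by
    rw [Real.tanh_eq_sinh_div_cosh]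
    field_simp
    linarith [Real.cosh_sq z]
  have h2 : z ≤ Real.sinh z := Real.self_le_sinh_iff.2 hz
  rw [h1, mul_one_div, div_le_one (by positivity), Real.cosh_sq]
  nlinarith

/-- `(1/z + β z) tanh z`, the square of the normalized phase speed. -/
def speedSq (β z : ℝ) : ℝ := (z⁻¹ + β * z) * Real.tanh z

def speedSqDeriv (β z : ℝ) : ℝ :=
  (-(z ^ 2)⁻¹ + β) * Real.tanh z + (z⁻¹ + β * z) * (1 - Real.tanh z ^ 2)

def speedSqDeriv₂ (β z : ℝ) : ℝ :=
  2 * (z ^ 3)⁻¹ * Real.tanh z + 2 * ((-(z ^ 2)⁻¹ + β) * (1 - Real.tanh z ^ 2))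
    - 2 * ((z⁻¹ + β * z) * (1 - Real.tanh z ^ 2)) * Real.tanh z

theorem hasDerivAt_speedSq (β : ℝ) {z : ℝ} (hz : z ≠ 0) :
    HasDerivAt (speedSq β) (speedSqDeriv β z) z := by
  refine ((((hasDerivAt_inv hz).add ((hasDerivAt_id z).const_mul β)).mul
    (hasDerivAt_tanh z))).congr_deriv ?_
  simp [speedSqDeriv]

theorem hasDerivAt_speedSqDeriv (β : ℝ) {z : ℝ} (hz : z ≠ 0) :
    HasDerivAt (speedSqDeriv β) (speedSqDeriv₂ β z) z := by
  have h1 : HasDerivAt (fun x : ℝ => -(x ^ 2)⁻¹ + β) (2 * (z ^ 3)⁻¹) z := by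
    refine (((hasDerivAt_pow 2 z).inv (pow_ne_zero 2 hz)).neg.add_const β).congr_deriv ?_
    field_simp
    simp
    ring
  have h2 := (hasDerivAt_inv hz).add ((hasDerivAt_id z).const_mul β)
  have h3 : HasDerivAt (fun x => 1 - Real.tanh x ^ 2)
      (-(2 * Real.tanh z * (1 - Real.tanh z ^ 2))) z := by
    refine (((hasDerivAt_tanh z).pow 2).const_sub 1).congr_deriv ?_
    simp
  refine ((h1.mul (hasDerivAt_tanh z)).add (h2.mul h3)).congr_deriv ?_
  simp [speedSqDeriv₂]
  ring

section Bounds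

variable {β κ z : ℝ}

/-- The linear lower bound serves twice: it keeps the square root away from 0 on [κ, ∞) and makes
the phase speed tend to infinity. -/
theorem speedSq_lower (hβ : 0 < β) (hκ : 0 < κ) (hz : κ ≤ z) :
    β * Real.tanh κ * z ≤ speedSq β z := by
  have hz0 : 0 < z := hκ.trans_le hz
  have h1 := tanh_monotone hz
  have h2 := tanh_pos hκ
  have h3 : 0 < z⁻¹ := inv_pos.2 hz0
  have h4 : β * z * Real.tanh κ ≤ β * z * Real.tanh z := by gcongr
  have h5 : 0 < z⁻¹ * Real.tanh z := mul_pos h3 (h2.trans_le h1)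
  rw [speedSq, add_mul]
  linarith

theorem speedSq_pos (hβ : 0 < β) (hz : 0 < z) : 0 < speedSq β z :=
  lt_of_lt_of_le (by have := tanh_pos hz; positivity) (speedSq_lower hβ hz le_rfl)

theorem abs_mul_one_sub_tanh_sq_le (hβ : 0 < β) (hκ : 0 < κ) (hz : κ ≤ z) :
    |(z⁻¹ + β * z) * (1 - Real.tanh z ^ 2)| ≤ κ⁻¹ + β := by
  have hz0 : 0 < z := hκ.trans_le hz
  have h1 := Real.tanh_sq_lt_one z
  have h2 := mul_one_sub_tanh_sq_le hz0.le
  have h3 : z⁻¹ ≤ κ⁻¹ := inv_anti₀ hκ hz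
  have h4 : 0 < z⁻¹ := inv_pos.2 hz0
  have h5 : 1 - Real.tanh z ^ 2 ≤ 1 := by linarith [sq_nonneg (Real.tanh z)]
  have h6 : 0 < 1 - Real.tanh z ^ 2 := by linarith
  rw [abs_of_nonneg (by positivity)]
  have h7 : z⁻¹ * (1 - Real.tanh z ^ 2) ≤ κ⁻¹ * 1 := by gcongr
  have h8 : β * (z * (1 - Real.tanh z ^ 2)) ≤ β * 1 := by gcongr
  linarith

theorem abs_neg_inv_sq_add_le (hβ : 0 < β) (hκ : 0 < κ) (hz : κ ≤ z) :
    |-(z ^ 2)⁻¹ + β| ≤ (κ ^ 2)⁻¹ + β := by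
  have h1 : (z ^ 2)⁻¹ ≤ (κ ^ 2)⁻¹ := inv_anti₀ (by positivity) (by gcongr)
  have h2 : 0 ≤ (z ^ 2)⁻¹ := by positivity
  exact abs_le.2 ⟨by linarith, by linarith⟩

theorem abs_speedSqDeriv_le (hβ : 0 < β) (hκ : 0 < κ) (hz : κ ≤ z) :
    |speedSqDeriv β z| ≤ ((κ ^ 2)⁻¹ + β) + (κ⁻¹ + β) := by
  refine (abs_add_le _ _).trans (add_le_add ?_ (abs_mul_one_sub_tanh_sq_le hβ hκ hz))
  rw [abs_mul]
  exact (mul_le_of_le_one_right (abs_nonneg _) (Real.abs_tanh_lt_one z).le).trans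
    (abs_neg_inv_sq_add_le hβ hκ hz)

theorem abs_speedSqDeriv₂_le (hβ : 0 < β) (hκ : 0 < κ) (hz : κ ≤ z) :
    |speedSqDeriv₂ β z| ≤ 2 * (κ ^ 3)⁻¹ + 2 * ((κ ^ 2)⁻¹ + β) + 2 * (κ⁻¹ + β) := by
  have hz0 : 0 < z := hκ.trans_le hz
  have ht := (Real.abs_tanh_lt_one z).le
  have h1 := Real.tanh_sq_lt_one z
  have h2 : |1 - Real.tanh z ^ 2| ≤ 1 := abs_le.2 ⟨by linarith, by linarith [sq_nonneg (Real.tanh z)]⟩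
  refine (abs_sub _ _).trans (add_le_add ((abs_add_le _ _).trans (add_le_add ?_ ?_)) ?_)
  · rw [abs_mul]
    refine (mul_le_of_le_one_right (abs_nonneg _) ht).trans ?_
    rw [abs_of_pos (by positivity)]
    gcongr
  · rw [abs_mul, abs_two, abs_mul]
    gcongr
    exact (mul_le_of_le_one_right (abs_nonneg _) h2).trans (abs_neg_inv_sq_add_le hβ hκ hz)
  · rw [abs_mul]
    refine (mul_le_of_le_one_right (abs_nonneg _) ht).trans ?_
    rw [abs_mul, abs_two]
    gcongr
    exact abs_mul_one_sub_tanh_sq_le hβ hκ hz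

end Bounds

/-! ### Monotonicity for strong surface tension -/

theorem pos_of_hasDerivAt_pos {f f' : ℝ → ℝ} (hf : ∀ z, HasDerivAt f (f' z) z) (h0 : 0 ≤ f 0)
    (hf' : ∀ z, 0 < z → 0 < f' z) {z : ℝ} (hz : 0 < z) : 0 < f z := by
  have h : StrictMonoOn f (Set.Ici 0) := by
    refine strictMonoOn_of_deriv_pos (convex_Ici 0)
      (fun x _ => (hf x).continuousAt.continuousWithinAt) fun x hx => ?_
    rw [interior_Ici] at hx
    rw [(hf x).deriv]
    exact hf' x hx
  exact h0.trans_lt (h Set.self_mem_Ici (Set.mem_Ici.2 hz.le) hz)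

/-- The function and its first three derivatives vanish at 0, and the fourth derivative is 8x cosh x
+ x² sinh x > 0. With x = 2z this is, up to a positive factor, the numerator of `speedSqDeriv` at
the critical value β = 1/3. -/
theorem sinh_cubic_pos {x : ℝ} (hx : 0 < x) :
    0 < (x ^ 2 - 12) * Real.sinh x + (12 * x + x ^ 3) := by
  have hs := Real.hasDerivAt_sinh
  have hc := Real.hasDerivAt_cosh
  have hp : ∀ (n : ℕ) (z : ℝ), HasDerivAt (fun x : ℝ => x ^ n) (n * z ^ (n - 1)) z :=
    fun n z => hasDerivAt_pow n z
  have d3 : ∀ z : ℝ, HasDerivAt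
      (fun x => 6 * x * Real.sinh x + (x ^ 2 - 6) * Real.cosh x + 6)
      (8 * z * Real.cosh z + z ^ 2 * Real.sinh z) z := fun z => by
    refine (((((hasDerivAt_id z).const_mul 6).mul (hs z)).add
      (((hp 2 z).sub_const 6).mul (hc z))).add_const 6).congr_deriv ?_
    simp; ring
  have p3 : ∀ z : ℝ, 0 < z → 0 < 8 * z * Real.cosh z + z ^ 2 * Real.sinh z := fun z hz => by
    have := Real.sinh_pos_iff.2 hz
    have := Real.cosh_pos z
    positivity
  have d2 : ∀ z : ℝ, HasDerivAt
      (fun x => (x ^ 2 - 10) * Real.sinh x + 4 * x * Real.cosh x + 6 * x)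
      (6 * z * Real.sinh z + (z ^ 2 - 6) * Real.cosh z + 6) z := fun z => by
    refine (((((hp 2 z).sub_const 10).mul (hs z)).add
      (((hasDerivAt_id z).const_mul 4).mul (hc z))).add
      ((hasDerivAt_id z).const_mul 6)).congr_deriv ?_
    simp; ring
  have d1 : ∀ z : ℝ, HasDerivAt
      (fun x => 2 * x * Real.sinh x + (x ^ 2 - 12) * Real.cosh x + (12 + 3 * x ^ 2))
      ((z ^ 2 - 10) * Real.sinh z + 4 * z * Real.cosh z + 6 * z) z := fun z => by
    refine (((((hasDerivAt_id z).const_mul 2).mul (hs z)).add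
      (((hp 2 z).sub_const 12).mul (hc z))).add
      (((hp 2 z).const_mul 3).const_add 12)).congr_deriv ?_
    simp; ring
  have d0 : ∀ z : ℝ, HasDerivAt
      (fun x => (x ^ 2 - 12) * Real.sinh x + (12 * x + x ^ 3))
      (2 * z * Real.sinh z + (z ^ 2 - 12) * Real.cosh z + (12 + 3 * z ^ 2)) z := fun z => by
    refine ((((hp 2 z).sub_const 12).mul (hs z)).add
      (((hasDerivAt_id z).const_mul 12).add (hp 3 z))).congr_deriv ?_
    simp
  refine pos_of_hasDerivAt_pos d0 (by simp) (fun z hz => ?_) hx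
  refine pos_of_hasDerivAt_pos d1 (by simp) (fun z hz => ?_) hz
  refine pos_of_hasDerivAt_pos d2 (by simp) (fun z hz => ?_) hz
  exact pos_of_hasDerivAt_pos d3 (by simp) p3 hz

/-- After multiplication by z² cosh² z the derivative is increasing in β, so the case β = 1/3
decides. -/
theorem speedSqDeriv_pos {β z : ℝ} (hβ : 1 / 3 ≤ β) (hz : 0 < z) : 0 < speedSqDeriv β z := by
  have hc := Real.cosh_pos z
  have hs := Real.sinh_pos_iff.2 hz
  have h1 := sinh_cubic_pos (x := 2 * z) (by positivity)
  rw [Real.sinh_two_mul] at h1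
  have h2 : speedSqDeriv β z * (z ^ 2 * Real.cosh z ^ 2)
      = (β * z ^ 2 - 1) * (Real.sinh z * Real.cosh z) + z * (1 + β * z ^ 2) := by
    rw [speedSqDeriv, Real.tanh_eq_sinh_div_cosh]
    field_simp
    rw [Real.cosh_sq]
    ring
  have h3 : 0 < (β * z ^ 2 - 1) * (Real.sinh z * Real.cosh z) + z * (1 + β * z ^ 2) := by
    have h4 : 0 ≤ (β - 1 / 3) * (z ^ 2 * (Real.sinh z * Real.cosh z) + z ^ 3) :=
      mul_nonneg (by linarith) (by positivity)
    nlinarith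
  rw [← h2] at h3
  exact pos_of_mul_pos_left h3 (by positivity)

theorem speedSq_strictMonoOn {β : ℝ} (hβ : 1 / 3 ≤ β) :
    StrictMonoOn (speedSq β) (Set.Ioi 0) := by
  refine strictMonoOn_of_deriv_pos (convex_Ioi 0)
    (fun x hx => (hasDerivAt_speedSq β (ne_of_gt hx)).continuousAt.continuousWithinAt)
    fun x hx => ?_
  rw [interior_Ioi] at hx
  rw [(hasDerivAt_speedSq β (ne_of_gt hx)).deriv]
  exact speedSqDeriv_pos hβ hx

/-! ### The phase speed -/

section PhaseSpeed

variable {g d T : ℝ}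

theorem phaseSpeed_eq {z : ℝ} (hz : z ≠ 0) :
    phaseSpeed g d T z = √(g * d * speedSq (T / (g * d ^ 2)) z) := by
  rw [phaseSpeed, if_neg hz, speedSq]
  congr 1
  field_simp

theorem phaseSpeed_neg (z : ℝ) : phaseSpeed g d T (-z) = phaseSpeed g d T z := by
  simp [phaseSpeed, Real.tanh_neg, neg_div_neg_eq]

theorem continuousAt_phaseSpeed_zero : ContinuousAt (phaseSpeed g d T) 0 := by
  have h1 : Filter.Tendsto (fun z : ℝ => Real.tanh z / z) (nhdsWithin 0 {0}ᶜ) (nhds 1) := by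
    have := hasDerivAt_iff_tendsto_slope.1 (hasDerivAt_tanh 0)
    simpa [slope_fun_def, div_eq_inv_mul] using this
  have h2 : Filter.Tendsto (fun z : ℝ => g * d * (1 + T / (g * d ^ 2) * z ^ 2))
      (nhdsWithin 0 {0}ᶜ) (nhds (g * d * (1 + T / (g * d ^ 2) * 0 ^ 2))) :=
    ((by fun_prop : Continuous fun z : ℝ => g * d * (1 + T / (g * d ^ 2) * z ^ 2)).tendsto
      0).mono_left nhdsWithin_le_nhds
  have h3 := (h2.mul h1).sqrt
  rw [continuousAt_iff_punctured_nhds]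
  have h4 : phaseSpeed g d T 0 = √(g * d * (1 + T / (g * d ^ 2) * 0 ^ 2) * 1) := by
    simp [phaseSpeed]
  rw [h4]
  refine h3.congr' ?_
  filter_upwards [self_mem_nhdsWithin] with z hz
  rw [phaseSpeed, if_neg (Set.mem_compl_singleton_iff.1 hz)]

def phaseSpeedDeriv (g d T z : ℝ) : ℝ :=
  g * d * speedSqDeriv (T / (g * d ^ 2)) z / (2 * √(g * d * speedSq (T / (g * d ^ 2)) z))

def phaseSpeedDeriv₂ (g d T z : ℝ) : ℝ :=
  (g * d * speedSqDeriv₂ (T / (g * d ^ 2)) z * (2 * √(g * d * speedSq (T / (g * d ^ 2)) z))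
    - g * d * speedSqDeriv (T / (g * d ^ 2)) z * (2 * phaseSpeedDeriv g d T z))
    / (2 * √(g * d * speedSq (T / (g * d ^ 2)) z)) ^ 2

theorem hasDerivAt_sqrt_speedSq (hg : 0 < g) (hd : 0 < d) (hT : 0 < T) {z : ℝ} (hz : 0 < z) :
    HasDerivAt (fun z => √(g * d * speedSq (T / (g * d ^ 2)) z)) (phaseSpeedDeriv g d T z) z := by
  have hβ : 0 < T / (g * d ^ 2) := by positivity
  have hpos := speedSq_pos hβ hz
  exact ((hasDerivAt_speedSq _ hz.ne').const_mul (g * d)).sqrt (by positivity)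

theorem hasDerivAt_phaseSpeed (hg : 0 < g) (hd : 0 < d) (hT : 0 < T) {z : ℝ} (hz : 0 < z) :
    HasDerivAt (phaseSpeed g d T) (phaseSpeedDeriv g d T z) z := by
  refine (hasDerivAt_sqrt_speedSq hg hd hT hz).congr_of_eventuallyEq ?_
  filter_upwards [eventually_gt_nhds hz] with x hx
  exact phaseSpeed_eq hx.ne'

theorem hasDerivAt_phaseSpeedDeriv (hg : 0 < g) (hd : 0 < d) (hT : 0 < T) {z : ℝ} (hz : 0 < z) :
    HasDerivAt (phaseSpeedDeriv g d T) (phaseSpeedDeriv₂ g d T z) z := by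
  have hβ : 0 < T / (g * d ^ 2) := by positivity
  have hpos := speedSq_pos hβ hz
  exact ((hasDerivAt_speedSqDeriv _ hz.ne').const_mul (g * d)).div
    ((hasDerivAt_sqrt_speedSq hg hd hT hz).const_mul 2) (by positivity)

theorem phaseSpeedDeriv_bounds (hg : 0 < g) (hd : 0 < d) (hT : 0 < T) {κ : ℝ} (hκ : 0 < κ) :
    ∃ L, (∀ z, κ ≤ z → |phaseSpeedDeriv g d T z| ≤ L) ∧
      ∀ z, κ ≤ z → |phaseSpeedDeriv₂ g d T z| ≤ L := by
  set β := T / (g * d ^ 2) with hβdef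
  have hβ : 0 < β := by positivity
  set h₀ := 2 * √(g * d * (β * Real.tanh κ * κ)) with hh₀
  have h₀pos : 0 < h₀ := by have := tanh_pos hκ; positivity
  have hlow : ∀ z, κ ≤ z → h₀ ≤ 2 * √(g * d * speedSq β z) := fun z hz => by
    have h1 := speedSq_lower hβ hκ hz
    have h2 : β * Real.tanh κ * κ ≤ β * Real.tanh κ * z := by
      have := tanh_pos hκ
      gcongr
    rw [hh₀]
    gcongr
    exact h2.trans h1
  set C₁ := ((κ ^ 2)⁻¹ + β) + (κ⁻¹ + β)
  set C₂ := 2 * (κ ^ 3)⁻¹ + 2 * ((κ ^ 2)⁻¹ + β) + 2 * (κ⁻¹ + β)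
  have hA : 0 < g * d := by positivity
  have hC₁ : 0 ≤ C₁ := by positivity
  have hC₂ : 0 ≤ C₂ := by positivity
  have b₁ : ∀ z, κ ≤ z → |phaseSpeedDeriv g d T z| ≤ g * d * C₁ / h₀ := fun z hz => by
    have h1 := hlow z hz
    rw [phaseSpeedDeriv, abs_div, abs_of_pos (h₀pos.trans_le h1), abs_mul, abs_of_pos hA]
    gcongr
    exact abs_speedSqDeriv_le hβ hκ hz
  have b₂ : ∀ z, κ ≤ z → |phaseSpeedDeriv₂ g d T z|
      ≤ g * d * C₂ / h₀ + g * d * C₁ * (2 * (g * d * C₁ / h₀)) / h₀ ^ 2 := fun z hz => by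
    have h1 := hlow z hz
    have h2 := h₀pos.trans_le h1
    have h3 (x r : ℝ) (hr : 0 < r) : x * r / r ^ 2 = x / r := by field_simp
    rw [phaseSpeedDeriv₂, ← hβdef, sub_div, h3 _ _ h2]
    refine (abs_sub _ _).trans (add_le_add ?_ ?_)
    · rw [abs_div, abs_of_pos h2, abs_mul, abs_of_pos hA]
      gcongr
      exact abs_speedSqDeriv₂_le hβ hκ hz
    · rw [abs_div, abs_of_pos (pow_pos h2 2), abs_mul, abs_mul, abs_of_pos hA, abs_mul, abs_two]
      gcongr
      · exact abs_speedSqDeriv_le hβ hκ hz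
      · exact b₁ z hz
  exact ⟨_, fun z hz => (b₁ z hz).trans (le_max_left _ _),
    fun z hz => (b₂ z hz).trans (le_max_right _ _)⟩

theorem tendsto_phaseSpeed_atTop (hg : 0 < g) (hd : 0 < d) (hT : 0 < T) :
    Filter.Tendsto (phaseSpeed g d T) Filter.atTop Filter.atTop := by
  have hβ : 0 < T / (g * d ^ 2) := by positivity
  have h1 : Filter.Tendsto (fun z => √(g * d * (T / (g * d ^ 2) * Real.tanh 1 * z)))
      Filter.atTop Filter.atTop := by
    refine Real.tendsto_sqrt_atTop.comp ?_
    simp only [← mul_assoc]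
    have := tanh_pos one_pos
    exact Filter.tendsto_id.const_mul_atTop (by positivity)
  refine Filter.tendsto_atTop_mono' _ ?_ h1
  filter_upwards [Filter.eventually_ge_atTop 1] with z hz
  rw [phaseSpeed_eq (by positivity)]
  have := speedSq_lower hβ one_pos hz
  gcongr

/-- For weak surface tension this is the definition of admissibility; for strong surface tension it
holds because the phase speed is strictly increasing. -/
theorem phaseSpeed_ne_of_admissible (hg : 0 < g) (hd : 0 < d) (hT : 0 < T)
    (hT3 : T / (g * d ^ 2) ≠ 1 / 3) {k : ℝ} (hk : k ∈ admissible g d T) (N : ℕ) (hN : 2 ≤ N) :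
    phaseSpeed g d T (k * d) ≠ phaseSpeed g d T (N * (k * d)) := by
  obtain ⟨hk0, hk⟩ := hk
  rcases lt_or_gt_of_ne hT3 with h | h
  · exact hk h N hN
  · have hκ : 0 < k * d := by positivity
    have hN' : (2 : ℝ) ≤ N := by exact_mod_cast hN
    have hNκ : k * d < N * (k * d) := by nlinarith
    have h1 := speedSq_strictMonoOn h.le hκ (hκ.trans hNκ : (0 : ℝ) < _) hNκ
    have h2 : 0 < speedSq (T / (g * d ^ 2)) (k * d) := speedSq_pos (by positivity) hκ
    rw [phaseSpeed_eq hκ.ne', phaseSpeed_eq (hκ.trans hNκ).ne']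
    refine (Real.sqrt_lt_sqrt (by positivity) ?_).ne
    have hA : 0 < g * d := by positivity
    gcongr

theorem exists_regularSymbol_phaseSpeed (hg : 0 < g) (hd : 0 < d) (hT : 0 < T)
    (hT3 : T / (g * d ^ 2) ≠ 1 / 3) {k : ℝ} (hk : k ∈ admissible g d T) :
    ∃ δ L, RegularSymbol (phaseSpeed g d T) (k * d) δ L
      (k * d * phaseSpeedDeriv g d T (k * d)) ((k * d) ^ 2 * phaseSpeedDeriv₂ g d T (k * d) / 2) := by
  have hκ : 0 < k * d := mul_pos hk.1 hd
  obtain ⟨L, hL₁, hL₂⟩ := phaseSpeedDeriv_bounds hg hd hT hκ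
  exact RegularSymbol.of_hasDerivAt hκ phaseSpeed_neg continuousAt_phaseSpeed_zero
    (fun z hz => hasDerivAt_phaseSpeed hg hd hT hz)
    (fun z hz => hasDerivAt_phaseSpeedDeriv hg hd hT hz) hL₁ hL₂
    (tendsto_phaseSpeed_atTop hg hd hT) (phaseSpeed_ne_of_admissible hg hd hT hT3 hk)

theorem deriv_mul_phaseSpeed (hg : 0 < g) (hd : 0 < d) (hT : 0 < T) {z : ℝ} (hz : 0 < z) :
    deriv (fun s => s * phaseSpeed g d T s) z
      = phaseSpeed g d T z + z * phaseSpeedDeriv g d T z := by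
  refine (((hasDerivAt_id z).mul (hasDerivAt_phaseSpeed hg hd hT hz)).congr_deriv ?_).deriv
  simp

theorem iteratedDeriv_mul_phaseSpeed (hg : 0 < g) (hd : 0 < d) (hT : 0 < T) {z : ℝ}
    (hz : 0 < z) : iteratedDeriv 2 (fun s => s * phaseSpeed g d T s) z
      = 2 * phaseSpeedDeriv g d T z + z * phaseSpeedDeriv₂ g d T z := by
  rw [iteratedDeriv_succ, iteratedDeriv_one]
  have h1 : deriv (fun s => s * phaseSpeed g d T s)
      =ᶠ[nhds z] fun s => phaseSpeed g d T s + s * phaseSpeedDeriv g d T s := by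
    filter_upwards [eventually_gt_nhds hz] with x hx
    exact deriv_mul_phaseSpeed hg hd hT hx
  rw [h1.deriv_eq]
  refine (((hasDerivAt_phaseSpeed hg hd hT hz).add
    ((hasDerivAt_id z).mul (hasDerivAt_phaseSpeedDeriv hg hd hT hz))).congr_deriv ?_).deriv
  simp
  ring

end PhaseSpeed

end

end Whitham

namespace Whitham

noncomputable section

/-! ### Elimination of the high modes -/

open EllTwo

/-- The multiplier `1 / (c - m(κ(n+ξ)))` on the modes `|n| ≥ 2`. -/
def highRes (m : ℝ → ℝ) (κ c ξ : ℝ) (n : ℤ) : ℂ :=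
  if 2 ≤ |n| then (((c - m (κ * (n + ξ)))⁻¹ : ℝ) : ℂ) else 0

/-- The multiplier `1 / (n + ξ)` on the modes `|n| ≥ 2`. -/
def highInv (ξ : ℝ) (n : ℤ) : ℂ :=
  if 2 ≤ |n| then (((n + ξ)⁻¹ : ℝ) : ℂ) else 0

/-- The high-mode part of the spectral equation reads `φ = p + highOp φ`, where `p` is the
low-mode part of `φ`. -/
def highOp (m : ℝ → ℝ) (κ c : ℝ) (W : EllTwo →L[ℂ] EllTwo) (μ : ℂ) (ξ : ℝ) :
    EllTwo →L[ℂ] EllTwo :=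
  (2 : ℂ) • (diagOp (highRes m κ c ξ)).comp W
    + μ • diagOp (fun n => highRes m κ c ξ n * highInv ξ n)

/-- The lift `(1 - highOp)⁻¹` of a low-mode vector to a solution of the high-mode equations. -/
def liftOp (m : ℝ → ℝ) (κ c : ℝ) (W : EllTwo →L[ℂ] EllTwo) (μ : ℂ) (ξ : ℝ) :
    EllTwo →L[ℂ] EllTwo :=
  Ring.inverse (1 - highOp m κ c W μ ξ)

/-- The parameters are in the perturbative regime. -/
structure Perturbative (m : ℝ → ℝ) (κ δ L s q c : ℝ) (W : EllTwo →L[ℂ] EllTwo) (μ : ℂ) (ξ : ℝ) :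
    Prop where
  symbol : RegularSymbol m κ δ L s q
  speed : |c - m κ| ≤ δ / 16
  norm_le : ‖W‖ ≤ δ / 16
  abs_xi_le : |ξ| ≤ 1 / 2
  lip_xi_le : L * |ξ| ≤ δ / 4
  norm_mu_le : ‖μ‖ ≤ δ / 8

namespace Perturbative

variable {m : ℝ → ℝ} {κ δ L s q c : ℝ} {W : EllTwo →L[ℂ] EllTwo} {μ : ℂ} {ξ : ℝ}

theorem neg (h : Perturbative m κ δ L s q c W μ ξ) :
    Perturbative m κ δ L s q c W (-μ) (-ξ) :=
  ⟨h.symbol, h.speed, h.norm_le, by simpa using h.abs_xi_le, by simpa using h.lip_xi_le,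
    by simpa using h.norm_mu_le⟩

theorem zero (h : Perturbative m κ δ L s q c W μ ξ) :
    Perturbative m κ δ L s q c W 0 0 :=
  ⟨h.symbol, h.speed, h.norm_le, by simp, by have := h.symbol.gap_pos; simp; positivity,
    by have := h.symbol.gap_pos; simp; positivity⟩

/-- The gap δ loses at most δ/4 through the shift by ξ and δ/16 through the change of speed. -/
theorem gap (h : Perturbative m κ δ L s q c W μ ξ) {n : ℤ} (hn : 2 ≤ |n|) :
    δ / 2 ≤ |c - m (κ * (n + ξ))| := by
  have h1 := h.symbol.gap n hn
  have h2 := h.symbol.lip n hn ξ h.abs_xi_le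
  have h3 := h.speed
  have h4 := h.lip_xi_le
  have hδ := h.symbol.gap_pos
  have h5 : |m (κ * n) - m κ| ≤ |c - m (κ * (n + ξ))| + |m (κ * (n + ξ)) - m (κ * n)|
      + |c - m κ| := by
    have e : m (κ * n) - m κ = -(c - m (κ * (n + ξ))) - (m (κ * (n + ξ)) - m (κ * n))
      + (c - m κ) := by ring
    rw [e]
    refine (abs_add_le _ _).trans (add_le_add ((abs_sub _ _).trans ?_) le_rfl)
    rw [abs_neg]
  linarith

theorem abs_add_ge (h : Perturbative m κ δ L s q c W μ ξ) {n : ℤ} (hn : 2 ≤ |n|) :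
    3 / 2 ≤ |(n : ℝ) + ξ| := by
  have h1 : (2 : ℝ) ≤ |(n : ℝ)| := by exact_mod_cast hn
  have h2 := h.abs_xi_le
  have h3 := abs_sub_abs_le_abs_sub (n : ℝ) (-ξ)
  rw [abs_neg, sub_neg_eq_add] at h3
  linarith

theorem norm_highRes_le (h : Perturbative m κ δ L s q c W μ ξ) (n : ℤ) :
    ‖highRes m κ c ξ n‖ ≤ 2 / δ := by
  have hδ := h.symbol.gap_pos
  rw [highRes]
  split_ifs with hn
  · rw [Complex.norm_real, norm_inv, Real.norm_eq_abs, ← inv_div]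
    exact inv_anti₀ (by positivity) (h.gap hn)
  · simp; positivity

theorem norm_highInv_le (h : Perturbative m κ δ L s q c W μ ξ) (n : ℤ) :
    ‖highInv ξ n‖ ≤ 1 := by
  rw [highInv]
  split_ifs with hn
  · rw [Complex.norm_real, norm_inv, Real.norm_eq_abs]
    exact inv_le_one_of_one_le₀ (by linarith [h.abs_add_ge hn])
  · simp

theorem norm_highRes_mul_highInv_le (h : Perturbative m κ δ L s q c W μ ξ) (n : ℤ) :
    ‖highRes m κ c ξ n * highInv ξ n‖ ≤ 2 / δ := by
  rw [norm_mul]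
  exact (mul_le_of_le_one_right (norm_nonneg _) (h.norm_highInv_le n)).trans (h.norm_highRes_le n)

theorem highOp_apply (h : Perturbative m κ δ L s q c W μ ξ) (x : EllTwo) (n : ℤ) :
    highOp m κ c W μ ξ x n
      = highRes m κ c ξ n * (2 * W x n) + μ * (highRes m κ c ξ n * highInv ξ n * x n) := by
  have e : highOp m κ c W μ ξ x n = 2 * diagOp (highRes m κ c ξ) (W x) n
    + μ * diagOp (fun n => highRes m κ c ξ n * highInv ξ n) x n := rfl
  rw [e, diagOp_apply h.norm_highRes_le, diagOp_apply h.norm_highRes_mul_highInv_le]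
  ring

theorem highOp_apply_low (h : Perturbative m κ δ L s q c W μ ξ) (x : EllTwo) {n : ℤ}
    (hn : ¬ 2 ≤ |n|) : highOp m κ c W μ ξ x n = 0 := by
  rw [h.highOp_apply, highRes, if_neg hn]
  simp

/-- This fixes the fractions in `Perturbative`: the convolution part contributes 2·(2/δ)·(δ/16) =
1/4 and the spectral part (δ/8)·(2/δ) = 1/4. -/
theorem norm_highOp_le (h : Perturbative m κ δ L s q c W μ ξ) : ‖highOp m κ c W μ ξ‖ ≤ 1 / 2 := by
  have hδ := h.symbol.gap_pos
  refine (norm_add_le _ _).trans ?_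
  rw [norm_smul, norm_smul]
  have h1 : ‖(diagOp (highRes m κ c ξ)).comp W‖ ≤ 2 / δ * (δ / 16) :=
    (ContinuousLinearMap.opNorm_comp_le _ _).trans
      (mul_le_mul (norm_diagOp_le h.norm_highRes_le) h.norm_le (norm_nonneg _) (by positivity))
  have h2 : ‖μ‖ * ‖diagOp (fun n => highRes m κ c ξ n * highInv ξ n)‖ ≤ δ / 8 * (2 / δ) :=
    mul_le_mul h.norm_mu_le (norm_diagOp_le h.norm_highRes_mul_highInv_le) (norm_nonneg _)
      (by positivity)
  have h3 : 2 / δ * (δ / 16) = 1 / 8 := by field_simp; norm_num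
  have h4 : δ / 8 * (2 / δ) = 1 / 4 := by field_simp; norm_num
  have h5 : ‖(2 : ℂ)‖ = 2 := by simp
  rw [h5]
  linarith

theorem isUnit (h : Perturbative m κ δ L s q c W μ ξ) : IsUnit (1 - highOp m κ c W μ ξ) :=
  isUnit_one_sub_of_norm_lt_one (h.norm_highOp_le.trans_lt (by norm_num))

theorem liftOp_mul (h : Perturbative m κ δ L s q c W μ ξ) :
    liftOp m κ c W μ ξ * (1 - highOp m κ c W μ ξ) = 1 :=
  Ring.inverse_mul_cancel _ h.isUnit

theorem mul_liftOp (h : Perturbative m κ δ L s q c W μ ξ) :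
    (1 - highOp m κ c W μ ξ) * liftOp m κ c W μ ξ = 1 :=
  Ring.mul_inverse_cancel _ h.isUnit

theorem liftOp_eq (h : Perturbative m κ δ L s q c W μ ξ) (x : EllTwo) :
    liftOp m κ c W μ ξ x = x + highOp m κ c W μ ξ (liftOp m κ c W μ ξ x) := by
  have h1 : ((1 - highOp m κ c W μ ξ) * liftOp m κ c W μ ξ) x = x := by rw [h.mul_liftOp]; rfl
  have h2 : ((1 - highOp m κ c W μ ξ) * liftOp m κ c W μ ξ) x
    = liftOp m κ c W μ ξ x - highOp m κ c W μ ξ (liftOp m κ c W μ ξ x) := rfl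
  rw [h2] at h1
  exact sub_eq_iff_eq_add.1 h1

theorem eq_liftOp (h : Perturbative m κ δ L s q c W μ ξ) {x y : EllTwo}
    (hy : y = x + highOp m κ c W μ ξ y) : y = liftOp m κ c W μ ξ x := by
  have h1 : (liftOp m κ c W μ ξ * (1 - highOp m κ c W μ ξ)) y = y := by rw [h.liftOp_mul]; rfl
  have h2 : (liftOp m κ c W μ ξ * (1 - highOp m κ c W μ ξ)) y
    = liftOp m κ c W μ ξ (y - highOp m κ c W μ ξ y) := rfl
  rw [h2, sub_eq_iff_eq_add.2 hy] at h1
  exact h1.symm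

theorem norm_liftOp_apply_le (h : Perturbative m κ δ L s q c W μ ξ) (x : EllTwo) :
    ‖liftOp m κ c W μ ξ x‖ ≤ 2 * ‖x‖ := by
  have h1 : ‖liftOp m κ c W μ ξ x‖ ≤ ‖x‖ + ‖highOp m κ c W μ ξ (liftOp m κ c W μ ξ x)‖ := by
    conv_lhs => rw [h.liftOp_eq x]
    exact norm_add_le _ _
  have h2 := ContinuousLinearMap.le_of_opNorm_le _ h.norm_highOp_le (liftOp m κ c W μ ξ x)
  linarith

theorem liftOp_apply_low (h : Perturbative m κ δ L s q c W μ ξ) (x : EllTwo) {n : ℤ}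
    (hn : ¬ 2 ≤ |n|) : liftOp m κ c W μ ξ x n = x n := by
  rw [h.liftOp_eq, add_apply, h.highOp_apply_low _ hn, add_zero]

/-- Resolvent identity for the lifts. -/
theorem liftOp_sub {μ' : ℂ} {ξ' : ℝ} (h : Perturbative m κ δ L s q c W μ ξ)
    (h' : Perturbative m κ δ L s q c W μ' ξ') (x : EllTwo) :
    liftOp m κ c W μ ξ x - liftOp m κ c W μ' ξ' x
      = liftOp m κ c W μ ξ (highOp m κ c W μ ξ (liftOp m κ c W μ' ξ' x)
        - highOp m κ c W μ' ξ' (liftOp m κ c W μ' ξ' x)) := by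
  refine h.eq_liftOp ?_
  have e1 := h.liftOp_eq x
  have e2 := h'.liftOp_eq x
  rw [map_sub]
  set y := liftOp m κ c W μ ξ x
  set z := liftOp m κ c W μ' ξ' x
  have e3 : y - z = (x + highOp m κ c W μ ξ y) - (x + highOp m κ c W μ' ξ' z) := by
    rw [← e1, ← e2]
  rw [e3]
  abel

theorem abs_highRes_arg_sub (h : Perturbative m κ δ L s q c W μ ξ) {n : ℤ} (hn : 2 ≤ |n|) :
    |(c - m (κ * (n + ξ))) - (c - m (κ * n))| ≤ L * |ξ| := by
  have := h.symbol.lip n hn ξ h.abs_xi_le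
  rw [← abs_neg] at this
  convert this using 2
  ring

theorem norm_highRes_sub_le (h : Perturbative m κ δ L s q c W μ ξ) (n : ℤ) :
    ‖highRes m κ c ξ n - highRes m κ c 0 n‖ ≤ (2 / δ) ^ 2 * (L * |ξ|) := by
  have hδ := h.symbol.gap_pos
  have hL := h.symbol.lip_nonneg
  have h1 := h.norm_highRes_le n
  have h2 := h.zero.norm_highRes_le n
  rw [highRes, highRes] at *
  split_ifs at * with hn
  · have g1 : c - m (κ * (n + ξ)) ≠ 0 := abs_pos.1 (by linarith [h.gap hn])
    have g2 : c - m (κ * (n + (0 : ℝ))) ≠ 0 := abs_pos.1 (by linarith [h.zero.gap hn])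
    have e : (c - m (κ * (n + ξ)))⁻¹ - (c - m (κ * (n + (0 : ℝ))))⁻¹
      = -((c - m (κ * (n + ξ)))⁻¹ * (c - m (κ * (n + (0 : ℝ))))⁻¹
        * ((c - m (κ * (n + ξ))) - (c - m (κ * (n + (0 : ℝ)))))) := by
      field_simp
      ring
    have h3 := h.abs_highRes_arg_sub hn
    rw [← Complex.ofReal_sub, Complex.norm_real, e, norm_neg, norm_mul, norm_mul, sq]
    rw [Complex.norm_real] at h1 h2
    gcongr
    simpa using h3
  · simp; positivity

theorem norm_highRes_second_le (h : Perturbative m κ δ L s q c W μ ξ) (n : ℤ) :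
    ‖highRes m κ c ξ n + highRes m κ c (-ξ) n - 2 * highRes m κ c 0 n‖
      ≤ ((2 / δ) ^ 2 * L + 2 * (2 / δ) ^ 3 * L ^ 2) * ξ ^ 2 := by
  have hδ := h.symbol.gap_pos
  have hL := h.symbol.lip_nonneg
  have h1 := h.norm_highRes_le n
  have h2 := h.zero.norm_highRes_le n
  have h3 := h.neg.norm_highRes_le n
  rw [highRes, highRes, highRes] at *
  split_ifs at * with hn
  · rw [Complex.norm_real, Real.norm_eq_abs] at h1 h2 h3
    have g1 : c - m (κ * (n + ξ)) ≠ 0 := abs_pos.1 (by linarith [h.gap hn])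
    have g2 : c - m (κ * (n + (0 : ℝ))) ≠ 0 := abs_pos.1 (by linarith [h.zero.gap hn])
    have g3 : c - m (κ * (n + -ξ)) ≠ 0 := abs_pos.1 (by linarith [h.neg.gap hn])
    have k1 := h.abs_highRes_arg_sub hn
    have k3 := h.neg.abs_highRes_arg_sub hn
    have k2 := h.symbol.second n hn ξ h.abs_xi_le
    rw [abs_neg] at k3
    rw [sub_eq_add_neg (n : ℝ) ξ] at k2
    rw [add_zero] at *
    set Dp := c - m (κ * (n + ξ)) with hp
    set Dm := c - m (κ * (n + -ξ)) with hq
    set Dz := c - m (κ * n) with h0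
    have k2' : |Dp + Dm - 2 * Dz| ≤ L * ξ ^ 2 := by
      rw [← abs_neg] at k2
      convert k2 using 2
      rw [hp, hq, h0]; ring
    -- The second difference of a reciprocal splits into a second difference of the denominators and
    -- a product of two first differences; both are O(ξ²).
    have e : Dp⁻¹ + Dm⁻¹ - 2 * Dz⁻¹ = -(Dp⁻¹ * Dm⁻¹ * (Dp + Dm - 2 * Dz))
        - 2 * (Dz⁻¹ * Dp⁻¹ * Dm⁻¹) * ((Dp - Dz) * (Dm - Dz)) := by
      field_simp
      ring
    have e' : (((Dp⁻¹ : ℝ) : ℂ) + ((Dm⁻¹ : ℝ) : ℂ) - 2 * ((Dz⁻¹ : ℝ) : ℂ))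
        = ((Dp⁻¹ + Dm⁻¹ - 2 * Dz⁻¹ : ℝ) : ℂ) := by push_cast; ring
    rw [e', Complex.norm_real, e, Real.norm_eq_abs]
    refine (abs_sub _ _).trans ?_
    simp only [abs_neg, abs_mul, abs_two]
    have hA : 0 ≤ 2 / δ := by positivity
    have b1 : |Dp⁻¹| * |Dm⁻¹| * |Dp + Dm - 2 * Dz| ≤ 2 / δ * (2 / δ) * (L * ξ ^ 2) := by gcongr
    have b2 : 2 * (|Dz⁻¹| * |Dp⁻¹| * |Dm⁻¹|) * (|Dp - Dz| * |Dm - Dz|)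
        ≤ 2 * (2 / δ * (2 / δ) * (2 / δ)) * (L * |ξ| * (L * |ξ|)) := by gcongr
    have b3 : L * |ξ| * (L * |ξ|) = L ^ 2 * ξ ^ 2 := by rw [← sq_abs ξ]; ring
    rw [b3] at b2
    linarith
  · simp; positivity

theorem norm_highInv_sub_le (h : Perturbative m κ δ L s q c W μ ξ) (n : ℤ) :
    ‖highInv ξ n - highInv (-ξ) n‖ ≤ 2 * |ξ| := by
  rw [highInv, highInv]
  split_ifs with hn
  · have h1 := h.abs_add_ge hn
    have h2 := h.neg.abs_add_ge hn
    have g1 : (n : ℝ) + ξ ≠ 0 := abs_pos.1 (by linarith)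
    have g2 : (n : ℝ) + -ξ ≠ 0 := abs_pos.1 (by linarith)
    have e : ((n : ℝ) + ξ)⁻¹ - ((n : ℝ) + -ξ)⁻¹ = -((n + ξ)⁻¹ * (n + -ξ)⁻¹ * (2 * ξ)) := by
      field_simp
      ring
    rw [← Complex.ofReal_sub, Complex.norm_real, e, norm_neg, norm_mul, norm_mul, norm_mul]
    have k1 : ‖((n : ℝ) + ξ)⁻¹‖ ≤ 1 := by
      rw [norm_inv, Real.norm_eq_abs]; exact inv_le_one_of_one_le₀ (by linarith)
    have k2 : ‖((n : ℝ) + -ξ)⁻¹‖ ≤ 1 := by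
      rw [norm_inv, Real.norm_eq_abs]; exact inv_le_one_of_one_le₀ (by linarith)
    calc _ ≤ 1 * 1 * (‖(2 : ℝ)‖ * ‖ξ‖) := by gcongr
      _ = 2 * |ξ| := by simp
  · simp

end Perturbative

end

end Whitham

namespace Whitham

noncomputable section

open EllTwo

/-! ### Dependence of the lifts on the parameters -/

/-- The sequence is supported on the modes `0, ±1`. -/
def IsLow (x : EllTwo) : Prop := ∀ n : ℤ, 2 ≤ |n| → x n = 0

/-- Constants for the first and second differences of `highOp`. -/
def diffConst (δ L : ℝ) : ℝ := 2 * (2 / δ) ^ 2 * L + 2 * (2 / δ) ^ 2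

def oppConst (δ L : ℝ) : ℝ := 2 / δ * L + 2 * (2 / δ)

def secondConst (δ L : ℝ) : ℝ :=
  2 * ((2 / δ) ^ 2 * L + 2 * (2 / δ) ^ 3 * L ^ 2)
    + 2 * (2 / δ) * (2 * (2 / δ) + 2 * (2 / δ) ^ 2 * L)

namespace Perturbative

variable {m : ℝ → ℝ} {κ δ L s q c : ℝ} {W : EllTwo →L[ℂ] EllTwo} {μ : ℂ} {ξ ρ : ℝ}

theorem norm_highOp_zero_apply_le (h : Perturbative m κ δ L s q c W μ ξ) (y : EllTwo) :
    ‖highOp m κ c W 0 0 y‖ ≤ 2 / δ * 2 * ‖W y‖ := by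
  have hδ := h.symbol.gap_pos
  refine norm_le_of_forall (by positivity) fun n => ?_
  rw [h.zero.highOp_apply, zero_mul, add_zero, norm_mul, norm_mul, mul_assoc]
  have := h.zero.norm_highRes_le n
  simp only [Complex.norm_ofNat]
  gcongr

/-- Applying `W` to the fixed-point equation of the lift gives ‖Wy‖ ≤ ‖Wx‖ + ‖Wy‖/4, and the last
term is absorbed. The point is to keep a bound proportional to `‖W x‖`, hence to the amplitude. -/
theorem norm_conv_lift_zero_le (h : Perturbative m κ δ L s q c W μ ξ) (x : EllTwo) :
    ‖W (liftOp m κ c W 0 0 x)‖ ≤ 2 * ‖W x‖ := by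
  have hδ := h.symbol.gap_pos
  set y := liftOp m κ c W 0 0 x with hy
  have h1 : ‖W y‖ ≤ ‖W x‖ + ‖W (highOp m κ c W 0 0 y)‖ := by
    conv_lhs => rw [hy, h.zero.liftOp_eq x, map_add, ← hy]
    exact norm_add_le _ _
  have h2 := h.norm_highOp_zero_apply_le y
  have h3 := ContinuousLinearMap.le_of_opNorm_le _ h.norm_le (highOp m κ c W 0 0 y)
  have h4 : δ / 16 * (2 / δ * 2 * ‖W y‖) = ‖W y‖ / 4 := by field_simp; ring
  have h5 : δ / 16 * ‖highOp m κ c W 0 0 y‖ ≤ δ / 16 * (2 / δ * 2 * ‖W y‖) := by gcongr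
  linarith [norm_nonneg (W y)]

theorem norm_lift_zero_apply_le (h : Perturbative m κ δ L s q c W μ ξ) {x : EllTwo}
    (hx : IsLow x) {n : ℤ} (hn : 2 ≤ |n|) :
    ‖liftOp m κ c W 0 0 x n‖ ≤ 2 * (2 / δ) * ‖W (liftOp m κ c W 0 0 x) n‖ := by
  have hδ := h.symbol.gap_pos
  rw [h.zero.liftOp_eq x, add_apply, hx n hn, zero_add, ← h.zero.liftOp_eq x,
    h.zero.highOp_apply, zero_mul, add_zero, norm_mul, norm_mul]
  have := h.zero.norm_highRes_le n
  simp only [Complex.norm_ofNat]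
  rw [mul_left_comm, mul_assoc]
  gcongr

/-- The term with μ contains the high modes of the lift itself. As `x` has only low modes, these are
controlled by `W` of the lift, so this term too carries a factor of the amplitude. -/
theorem norm_highOp_sub_lift_le (h : Perturbative m κ δ L s q c W μ ξ) (hμ : ‖μ‖ ≤ ρ)
    (hξ : |ξ| ≤ ρ) {x : EllTwo} (hx : IsLow x) :
    ‖highOp m κ c W μ ξ (liftOp m κ c W 0 0 x) - highOp m κ c W 0 0 (liftOp m κ c W 0 0 x)‖
      ≤ diffConst δ L * ρ * ‖W (liftOp m κ c W 0 0 x)‖ := by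
  have hδ := h.symbol.gap_pos
  have hL := h.symbol.lip_nonneg
  have hρ : 0 ≤ ρ := (abs_nonneg _).trans hξ
  set y := liftOp m κ c W 0 0 x with hy
  refine norm_le_of_forall (by unfold diffConst; positivity) fun n => ?_
  rw [sub_apply]
  by_cases hn : 2 ≤ |n|
  · have h1 := h.norm_lift_zero_apply_le hx hn
    rw [← hy] at h1
    have h2 := h.norm_highRes_sub_le n
    have h3 := h.norm_highRes_mul_highInv_le n
    rw [h.highOp_apply, h.zero.highOp_apply, zero_mul, add_zero]
    have e : highRes m κ c ξ n * (2 * W y n) + μ * (highRes m κ c ξ n * highInv ξ n * y n)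
        - highRes m κ c 0 n * (2 * W y n) = (highRes m κ c ξ n - highRes m κ c 0 n) * (2 * W y n)
        + μ * (highRes m κ c ξ n * highInv ξ n * y n) := by ring
    rw [e]
    refine (norm_add_le _ _).trans ?_
    rw [norm_mul, norm_mul, norm_mul, norm_mul (highRes m κ c ξ n * highInv ξ n),
      Complex.norm_ofNat]
    calc _ ≤ (2 / δ) ^ 2 * (L * ρ) * (2 * ‖W y n‖)
          + ρ * (2 / δ * (2 * (2 / δ) * ‖W y n‖)) := by gcongr; exact h2.trans (by gcongr)
      _ = _ := by unfold diffConst; ring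
  · rw [h.highOp_apply_low _ hn, h.zero.highOp_apply_low _ hn, sub_self, norm_zero]
    unfold diffConst
    positivity

theorem norm_lift_sub_le (h : Perturbative m κ δ L s q c W μ ξ) (hμ : ‖μ‖ ≤ ρ)
    (hξ : |ξ| ≤ ρ) {x : EllTwo} (hx : IsLow x) :
    ‖liftOp m κ c W μ ξ x - liftOp m κ c W 0 0 x‖ ≤ 4 * diffConst δ L * ρ * ‖W x‖ := by
  have hδ := h.symbol.gap_pos
  have hL := h.symbol.lip_nonneg
  have hρ : 0 ≤ ρ := (abs_nonneg _).trans hξ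
  have hK : 0 ≤ diffConst δ L := by unfold diffConst; positivity
  rw [h.liftOp_sub h.zero]
  refine (h.norm_liftOp_apply_le _).trans ?_
  have h1 := h.norm_highOp_sub_lift_le hμ hξ hx
  have h2 : diffConst δ L * ρ * ‖W (liftOp m κ c W 0 0 x)‖ ≤ diffConst δ L * ρ * (2 * ‖W x‖) := by
    gcongr; exact h.norm_conv_lift_zero_le x
  linarith

theorem norm_highRes_opp_le (h : Perturbative m κ δ L s q c W μ ξ) (n : ℤ) :
    ‖highRes m κ c ξ n - highRes m κ c (-ξ) n‖ ≤ 2 * ((2 / δ) ^ 2 * (L * |ξ|)) := by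
  have h1 := h.norm_highRes_sub_le n
  have h2 := h.neg.norm_highRes_sub_le n
  rw [abs_neg] at h2
  rw [show highRes m κ c ξ n - highRes m κ c (-ξ) n = (highRes m κ c ξ n - highRes m κ c 0 n)
    - (highRes m κ c (-ξ) n - highRes m κ c 0 n) by ring]
  refine (norm_sub_le _ _).trans ?_
  linarith

/-- A bound by `‖x‖` is enough here: it is applied to a lift increment that already carries the
factor ρ and the amplitude. -/
theorem norm_highOp_opp_le (h : Perturbative m κ δ L s q c W μ ξ) (hμ : ‖μ‖ ≤ ρ)
    (hξ : |ξ| ≤ ρ) (x : EllTwo) :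
    ‖highOp m κ c W (-μ) (-ξ) x - highOp m κ c W μ ξ x‖ ≤ oppConst δ L * ρ * ‖x‖ := by
  have hδ := h.symbol.gap_pos
  have hL := h.symbol.lip_nonneg
  have hρ : 0 ≤ ρ := (abs_nonneg _).trans hξ
  have key : ‖highOp m κ c W (-μ) (-ξ) x - highOp m κ c W μ ξ x‖
      ≤ 4 * (2 / δ) ^ 2 * L * ρ * ‖W x‖ + 2 * (2 / δ) * ρ * ‖x‖ := by
    refine norm_le_of_forall_add (by positivity) (by positivity) fun n => ?_
    rw [sub_apply, h.highOp_apply, h.neg.highOp_apply]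
    have e : highRes m κ c (-ξ) n * (2 * W x n)
          + -μ * (highRes m κ c (-ξ) n * highInv (-ξ) n * x n)
        - (highRes m κ c ξ n * (2 * W x n) + μ * (highRes m κ c ξ n * highInv ξ n * x n))
        = -((highRes m κ c ξ n - highRes m κ c (-ξ) n) * (2 * W x n))
        - (μ * (highRes m κ c (-ξ) n * highInv (-ξ) n * x n)
          + μ * (highRes m κ c ξ n * highInv ξ n * x n)) := by ring
    rw [e]
    refine (norm_sub_le _ _).trans ?_
    rw [norm_neg]
    have h1 := h.norm_highRes_mul_highInv_le n
    have h2 := h.neg.norm_highRes_mul_highInv_le n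
    have h3 := h.norm_highRes_opp_le n
    have b1 : ‖(highRes m κ c ξ n - highRes m κ c (-ξ) n) * (2 * W x n)‖
        ≤ 2 * ((2 / δ) ^ 2 * (L * ρ)) * (2 * ‖W x n‖) := by
      rw [norm_mul, norm_mul, Complex.norm_ofNat]
      gcongr
      exact h3.trans (by gcongr)
    have b2 : ‖μ * (highRes m κ c (-ξ) n * highInv (-ξ) n * x n)
        + μ * (highRes m κ c ξ n * highInv ξ n * x n)‖
        ≤ ρ * (2 / δ * ‖x n‖) + ρ * (2 / δ * ‖x n‖) := by
      refine (norm_add_le _ _).trans (add_le_add ?_ ?_) <;> rw [norm_mul, norm_mul] <;> gcongr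
    linarith
  have h1 := ContinuousLinearMap.le_of_opNorm_le _ h.norm_le x
  have h2 : 4 * (2 / δ) ^ 2 * L * ρ * ‖W x‖ ≤ 4 * (2 / δ) ^ 2 * L * ρ * (δ / 16 * ‖x‖) := by
    gcongr
  have h3 : 4 * (2 / δ) ^ 2 * L * ρ * (δ / 16 * ‖x‖) = (1 / 2) * (2 / δ * L * ρ * ‖x‖) := by
    field_simp; ring
  have h4 : 0 ≤ 2 / δ * L * ρ * ‖x‖ := by positivity
  unfold oppConst
  linarith

theorem norm_highOp_second_lift_le (h : Perturbative m κ δ L s q c W μ ξ) (hμ : ‖μ‖ ≤ ρ)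
    (hξ : |ξ| ≤ ρ) {x : EllTwo} (hx : IsLow x) :
    ‖highOp m κ c W μ ξ (liftOp m κ c W 0 0 x) + highOp m κ c W (-μ) (-ξ) (liftOp m κ c W 0 0 x)
        - (2 : ℂ) • highOp m κ c W 0 0 (liftOp m κ c W 0 0 x)‖
      ≤ secondConst δ L * ρ ^ 2 * ‖W (liftOp m κ c W 0 0 x)‖ := by
  have hδ := h.symbol.gap_pos
  have hL := h.symbol.lip_nonneg
  have hρ : 0 ≤ ρ := (abs_nonneg _).trans hξ
  set y := liftOp m κ c W 0 0 x with hy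
  refine norm_le_of_forall (by unfold secondConst; positivity) fun n => ?_
  rw [sub_apply, add_apply, smul_apply]
  by_cases hn : 2 ≤ |n|
  · have h1 := h.norm_lift_zero_apply_le hx hn
    rw [← hy] at h1
    have h2 := h.norm_highRes_second_le n
    have h3 := h.norm_highRes_opp_le n
    have h4 := h.norm_highInv_sub_le n
    have h5 := h.neg.norm_highInv_le n
    have h6 := h.norm_highRes_le n
    rw [h.highOp_apply, h.neg.highOp_apply, h.zero.highOp_apply, zero_mul, add_zero]
    have e : highRes m κ c ξ n * (2 * W y n) + μ * (highRes m κ c ξ n * highInv ξ n * y n)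
        + (highRes m κ c (-ξ) n * (2 * W y n)
          + -μ * (highRes m κ c (-ξ) n * highInv (-ξ) n * y n))
        - 2 * (highRes m κ c 0 n * (2 * W y n))
        = (highRes m κ c ξ n + highRes m κ c (-ξ) n - 2 * highRes m κ c 0 n) * (2 * W y n)
        + μ * ((highRes m κ c ξ n * (highInv ξ n - highInv (-ξ) n)
          + (highRes m κ c ξ n - highRes m κ c (-ξ) n) * highInv (-ξ) n) * y n) := by ring
    have hξ2 : ξ ^ 2 ≤ ρ ^ 2 := sq_le_sq' (abs_le.1 hξ).1 (abs_le.1 hξ).2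
    have b1 : ‖(highRes m κ c ξ n + highRes m κ c (-ξ) n - 2 * highRes m κ c 0 n) * (2 * W y n)‖
        ≤ ((2 / δ) ^ 2 * L + 2 * (2 / δ) ^ 3 * L ^ 2) * ρ ^ 2 * (2 * ‖W y n‖) := by
      rw [norm_mul, norm_mul, Complex.norm_ofNat]
      gcongr
      exact h2.trans (by gcongr)
    have b2 : ‖highRes m κ c ξ n * (highInv ξ n - highInv (-ξ) n)
          + (highRes m κ c ξ n - highRes m κ c (-ξ) n) * highInv (-ξ) n‖
        ≤ 2 / δ * (2 * ρ) + 2 * ((2 / δ) ^ 2 * (L * ρ)) * 1 := by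
      refine (norm_add_le _ _).trans (add_le_add ?_ ?_) <;> rw [norm_mul] <;> gcongr
      · exact h4.trans (by gcongr)
      · exact h3.trans (by gcongr)
    rw [e]
    refine (norm_add_le _ _).trans ?_
    rw [norm_mul μ, norm_mul _ (y n)]
    calc _ ≤ ((2 / δ) ^ 2 * L + 2 * (2 / δ) ^ 3 * L ^ 2) * ρ ^ 2 * (2 * ‖W y n‖)
          + ρ * ((2 / δ * (2 * ρ) + 2 * ((2 / δ) ^ 2 * (L * ρ)) * 1)
            * (2 * (2 / δ) * ‖W y n‖)) := by gcongr
      _ = _ := by unfold secondConst; ring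
  · rw [h.highOp_apply_low _ hn, h.neg.highOp_apply_low _ hn, h.zero.highOp_apply_low _ hn]
    simp only [add_zero, mul_zero, sub_zero, norm_zero]
    unfold secondConst
    positivity

/-- The second difference of the lifts is of second order. -/
theorem norm_lift_second_le (h : Perturbative m κ δ L s q c W μ ξ) (hμ : ‖μ‖ ≤ ρ)
    (hξ : |ξ| ≤ ρ) {x : EllTwo} (hx : IsLow x) :
    ‖liftOp m κ c W μ ξ x + liftOp m κ c W (-μ) (-ξ) x - (2 : ℂ) • liftOp m κ c W 0 0 x‖
      ≤ (4 * secondConst δ L + 8 * oppConst δ L * diffConst δ L) * ρ ^ 2 * ‖W x‖ := by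
  have hδ := h.symbol.gap_pos
  have hL := h.symbol.lip_nonneg
  have hρ : 0 ≤ ρ := (abs_nonneg _).trans hξ
  have hK₁ : 0 ≤ diffConst δ L := by unfold diffConst; positivity
  have hK₂ : 0 ≤ oppConst δ L := by unfold oppConst; positivity
  have hK₃ : 0 ≤ secondConst δ L := by unfold secondConst; positivity
  have hμ' : ‖-μ‖ ≤ ρ := by rwa [norm_neg]
  have hξ' : |-ξ| ≤ ρ := by rwa [abs_neg]
  have g1 := h.norm_highOp_second_lift_le hμ hξ hx
  have g2 := h.neg.norm_highOp_sub_lift_le hμ' hξ' hx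
  have g3 := h.norm_conv_lift_zero_le x
  have e1 := h.liftOp_sub h.zero x
  have e2 := h.neg.liftOp_sub h.zero x
  set y := liftOp m κ c W 0 0 x
  set z := highOp m κ c W (-μ) (-ξ) y - highOp m κ c W 0 0 y
  have e3 := h.neg.liftOp_sub h z
  -- Resolvent identities write the second difference of lifts as the lift of the second difference
  -- of `highOp` plus a product of two first-order increments.
  have e : liftOp m κ c W μ ξ x + liftOp m κ c W (-μ) (-ξ) x - (2 : ℂ) • y
      = liftOp m κ c W μ ξ (highOp m κ c W μ ξ y + highOp m κ c W (-μ) (-ξ) y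
        - (2 : ℂ) • highOp m κ c W 0 0 y)
      + liftOp m κ c W (-μ) (-ξ) (highOp m κ c W (-μ) (-ξ) (liftOp m κ c W μ ξ z)
        - highOp m κ c W μ ξ (liftOp m κ c W μ ξ z)) := by
    rw [← e3]
    have e4 : liftOp m κ c W μ ξ x + liftOp m κ c W (-μ) (-ξ) x - (2 : ℂ) • y
      = (liftOp m κ c W μ ξ x - y) + (liftOp m κ c W (-μ) (-ξ) x - y) := by
      rw [two_smul]; abel
    have e5 : highOp m κ c W μ ξ y + highOp m κ c W (-μ) (-ξ) y
        - (2 : ℂ) • highOp m κ c W 0 0 y = (highOp m κ c W μ ξ y - highOp m κ c W 0 0 y) + z := by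
      rw [two_smul]
      show _ = _ + (highOp m κ c W (-μ) (-ξ) y - highOp m κ c W 0 0 y)
      abel
    rw [e4, e1, e2, e5, map_add]
    abel
  rw [e]
  refine (norm_add_le _ _).trans ?_
  have f1 := h.norm_liftOp_apply_le (highOp m κ c W μ ξ y + highOp m κ c W (-μ) (-ξ) y
        - (2 : ℂ) • highOp m κ c W 0 0 y)
  have f2 := h.neg.norm_liftOp_apply_le (highOp m κ c W (-μ) (-ξ) (liftOp m κ c W μ ξ z)
        - highOp m κ c W μ ξ (liftOp m κ c W μ ξ z))
  have f3 := h.norm_highOp_opp_le hμ hξ (liftOp m κ c W μ ξ z)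
  have f4 := h.norm_liftOp_apply_le z
  have f5 : oppConst δ L * ρ * ‖liftOp m κ c W μ ξ z‖
      ≤ oppConst δ L * ρ * (2 * (diffConst δ L * ρ * (2 * ‖W x‖))) := by
    gcongr
    refine f4.trans ?_
    gcongr
    exact g2.trans (by gcongr)
  have f6 : secondConst δ L * ρ ^ 2 * ‖W y‖ ≤ secondConst δ L * ρ ^ 2 * (2 * ‖W x‖) := by gcongr
  calc _ ≤ 2 * (secondConst δ L * ρ ^ 2 * (2 * ‖W x‖))
        + 2 * (oppConst δ L * ρ * (2 * (diffConst δ L * ρ * (2 * ‖W x‖)))) := by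
        linarith
    _ = _ := by ring

end Perturbative

end

end Whitham

namespace Whitham

noncomputable section

open EllTwo

/-! ### Reduction of the spectral problem to a `3 × 3` matrix -/

/-- The `n`-th coefficient of `(𝓛_ξ / i - μ) φ`, for `𝓛_ξ` acting on Fourier coefficients. -/
def spectralCoeff (m : ℝ → ℝ) (κ c : ℝ) (W : EllTwo →L[ℂ] EllTwo) (μ : ℂ) (ξ : ℝ)
    (φ : EllTwo) (n : ℤ) : ℂ :=
  ((n : ℂ) + ξ) * (((c - m (κ * (n + ξ)) : ℝ) : ℂ) * φ n - 2 * W φ n) - μ * φ n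

/-- The odd, constant and even low-mode vectors. -/
def lowVec : Fin 3 → EllTwo :=
  ![unitSeq 1 - unitSeq (-1), unitSeq 0, unitSeq 1 + unitSeq (-1)]

def lowCoef (φ : EllTwo) : Fin 3 → ℂ := ![(φ 1 - φ (-1)) / 2, φ 0, (φ 1 + φ (-1)) / 2]

def evalAt (n : ℤ) : EllTwo →L[ℂ] ℂ := lp.evalCLM ℂ (fun _ : ℤ => ℂ) 2 n

@[simp] theorem evalAt_apply (n : ℤ) (x : EllTwo) : evalAt n x = x n := rfl

/-- The `n`-th spectral equation divided by `n + ξ`. -/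
def dividedRow (m : ℝ → ℝ) (κ c : ℝ) (W : EllTwo →L[ℂ] EllTwo) (μ : ℂ) (ξ : ℝ) (n : ℤ) :
    EllTwo →L[ℂ] ℂ :=
  (((c - m (κ * (n + ξ)) : ℝ) : ℂ) - μ / (n + ξ)) • evalAt n - (2 : ℂ) • (evalAt n).comp W

/-- The equation for n = 0 is left undivided, since its factor n + ξ = ξ may vanish. -/
def zeroRow (m : ℝ → ℝ) (κ c : ℝ) (W : EllTwo →L[ℂ] EllTwo) (μ : ℂ) (ξ : ℝ) :
    EllTwo →L[ℂ] ℂ :=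
  ((ξ * (c - m (κ * ξ)) : ℝ) - μ) • evalAt 0 - (2 * ξ : ℂ) • (evalAt 0).comp W

/-- Differences and sums of the rows ±1 match the parity of the basis `lowVec`, so that for an even
wave the couplings of opposite parity vanish at μ = ξ = 0. -/
def lowRow (m : ℝ → ℝ) (κ c : ℝ) (W : EllTwo →L[ℂ] EllTwo) (μ : ℂ) (ξ : ℝ) :
    Fin 3 → EllTwo →L[ℂ] ℂ :=
  ![dividedRow m κ c W μ ξ 1 - dividedRow m κ c W μ ξ (-1), zeroRow m κ c W μ ξ,
    dividedRow m κ c W μ ξ 1 + dividedRow m κ c W μ ξ (-1)]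

def reducedMatrix (m : ℝ → ℝ) (κ c : ℝ) (W : EllTwo →L[ℂ] EllTwo) (μ : ℂ) (ξ : ℝ) :
    Matrix (Fin 3) (Fin 3) ℂ :=
  Matrix.of fun i j => lowRow m κ c W μ ξ i (liftOp m κ c W μ ξ (lowVec j))

/-- The low-mode equations for the right-hand side `h`. -/
def lowRhs (ξ : ℝ) : Fin 3 → EllTwo →L[ℂ] ℂ :=
  ![(1 + ξ : ℂ)⁻¹ • evalAt 1 - (-1 + ξ : ℂ)⁻¹ • evalAt (-1), evalAt 0,
    (1 + ξ : ℂ)⁻¹ • evalAt 1 + (-1 + ξ : ℂ)⁻¹ • evalAt (-1)]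

def highRhs (m : ℝ → ℝ) (κ c ξ : ℝ) : EllTwo →L[ℂ] EllTwo :=
  diagOp (fun n => highRes m κ c ξ n * highInv ξ n)

theorem int_cases_abs_lt_two {n : ℤ} (hn : ¬ 2 ≤ |n|) : n = 1 ∨ n = 0 ∨ n = -1 := by
  rw [not_le, abs_lt] at hn
  omega

theorem isLow_lowVec (k : Fin 3) : IsLow (lowVec k) := by
  intro n hn
  have h1 : n ≠ 1 := by rintro rfl; norm_num at hn
  have h2 : n ≠ -1 := by rintro rfl; norm_num at hn
  have h3 : n ≠ 0 := by rintro rfl; norm_num at hn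
  fin_cases k <;> simp [lowVec, unitSeq_apply, add_apply, sub_apply, h1, h2, h3]

theorem isLow_sum_lowVec (a : Fin 3 → ℂ) : IsLow (∑ k, a k • lowVec k) := by
  intro n hn
  simp only [Fin.sum_univ_three, add_apply, smul_apply, isLow_lowVec _ n hn, mul_zero, add_zero]

theorem sum_lowVec_apply (a : Fin 3 → ℂ) :
    (∑ k, a k • lowVec k) 1 = a 0 + a 2 ∧ (∑ k, a k • lowVec k) 0 = a 1 ∧
      (∑ k, a k • lowVec k) (-1) = -a 0 + a 2 := by
  simp [Fin.sum_univ_three, lowVec, unitSeq_apply, add_apply, sub_apply, smul_apply]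

theorem sum_lowCoef_apply (φ : EllTwo) {n : ℤ} (hn : ¬ 2 ≤ |n|) :
    (∑ k, lowCoef φ k • lowVec k) n = φ n := by
  obtain ⟨h1, h0, hm⟩ := sum_lowVec_apply (lowCoef φ)
  rcases int_cases_abs_lt_two hn with rfl | rfl | rfl
  · rw [h1]; simp [lowCoef]; ring
  · rw [h0]; simp [lowCoef]
  · rw [hm]; simp [lowCoef]; ring

namespace Perturbative

variable {m : ℝ → ℝ} {κ δ L s q c : ℝ} {W : EllTwo →L[ℂ] EllTwo} {μ : ℂ} {ξ : ℝ}

theorem highRhs_apply (h : Perturbative m κ δ L s q c W μ ξ) (x : EllTwo) (n : ℤ) :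
    highRhs m κ c ξ x n = highRes m κ c ξ n * highInv ξ n * x n :=
  diagOp_apply h.norm_highRes_mul_highInv_le x n

theorem add_ne_zero_of_ne (h : Perturbative m κ δ L s q c W μ ξ) {n : ℤ} (hn : n ≠ 0) :
    (n : ℂ) + ξ ≠ 0 := by
  have h1 : (1 : ℝ) ≤ |(n : ℝ)| := by exact_mod_cast Int.one_le_abs hn
  have h2 := h.abs_xi_le
  intro h0
  have h3 : (n : ℝ) + ξ = 0 := by exact_mod_cast h0
  rw [show (n : ℝ) = -ξ by linarith, abs_neg] at h1
  linarith

theorem spectralCoeff_eq_dividedRow (h : Perturbative m κ δ L s q c W μ ξ) {n : ℤ} (hn : n ≠ 0)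
    (φ : EllTwo) :
    spectralCoeff m κ c W μ ξ φ n = ((n : ℂ) + ξ) * dividedRow m κ c W μ ξ n φ := by
  have h0 := h.add_ne_zero_of_ne hn
  have e : dividedRow m κ c W μ ξ n φ
    = (((c - m (κ * (n + ξ)) : ℝ) : ℂ) - μ / (n + ξ)) * φ n - 2 * W φ n := rfl
  rw [spectralCoeff, e]
  field_simp
  ring

theorem spectralCoeff_zero (φ : EllTwo) :
    spectralCoeff m κ c W μ ξ φ 0 = zeroRow m κ c W μ ξ φ := by
  have e : zeroRow m κ c W μ ξ φ
    = ((ξ * (c - m (κ * ξ)) : ℝ) - μ) * φ 0 - 2 * ξ * W φ 0 := rfl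
  rw [spectralCoeff, e]
  push_cast
  rw [zero_add, zero_add]
  ring

/-- Division by (n+ξ)(c - m(κ(n+ξ))), which is nonzero for high modes, turns the equation into
fixed-point form. -/
theorem spectralCoeff_high (h : Perturbative m κ δ L s q c W μ ξ) {n : ℤ} (hn : 2 ≤ |n|)
    (φ g : EllTwo) :
    spectralCoeff m κ c W μ ξ φ n = g n
      ↔ φ n = highRhs m κ c ξ g n + highOp m κ c W μ ξ φ n := by
  have hn0 : n ≠ 0 := by rintro rfl; norm_num at hn
  have h0 := h.add_ne_zero_of_ne hn0
  have hD : c - m (κ * (n + ξ)) ≠ 0 := by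
    have := h.gap hn
    have := h.symbol.gap_pos
    exact abs_pos.1 (by linarith)
  have hD' : ((c - m (κ * (n + ξ)) : ℝ) : ℂ) ≠ 0 := by exact_mod_cast hD
  rw [h.highRhs_apply, h.highOp_apply, highRes, highInv, if_pos hn, if_pos hn, spectralCoeff]
  rw [Complex.ofReal_inv, Complex.ofReal_inv]
  generalize ((c - m (κ * (n + ξ)) : ℝ) : ℂ) = D at *
  rw [show (((n : ℝ) + ξ : ℝ) : ℂ) = (n : ℂ) + ξ by push_cast; rfl]
  constructor
  · intro e
    field_simp
    linear_combination e
  · intro e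
    field_simp at e
    linear_combination e

theorem solution_iff_dividedRow (h : Perturbative m κ δ L s q c W μ ξ) (φ g : EllTwo) :
    (∀ i, lowRow m κ c W μ ξ i φ = lowRhs ξ i g) ↔
      ∀ n : ℤ, ¬ 2 ≤ |n| → spectralCoeff m κ c W μ ξ φ n = g n := by
  have e1 := h.spectralCoeff_eq_dividedRow one_ne_zero φ
  have e2 := h.spectralCoeff_eq_dividedRow (n := -1) (by norm_num) φ
  have e0 := spectralCoeff_zero (m := m) (κ := κ) (c := c) (W := W) (μ := μ) (ξ := ξ) φ
  have n1 := h.add_ne_zero_of_ne one_ne_zero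
  have n2 := h.add_ne_zero_of_ne (n := -1) (by norm_num)
  push_cast at e1 e2 n1 n2
  have r0 : lowRow m κ c W μ ξ 0 φ
    = dividedRow m κ c W μ ξ 1 φ - dividedRow m κ c W μ ξ (-1) φ := rfl
  have r1 : lowRow m κ c W μ ξ 1 φ = zeroRow m κ c W μ ξ φ := rfl
  have r2 : lowRow m κ c W μ ξ 2 φ
    = dividedRow m κ c W μ ξ 1 φ + dividedRow m κ c W μ ξ (-1) φ := rfl
  have s0 : lowRhs ξ 0 g = (1 + ξ : ℂ)⁻¹ * g 1 - (-1 + ξ : ℂ)⁻¹ * g (-1) := rfl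
  have s1 : lowRhs ξ 1 g = g 0 := rfl
  have s2 : lowRhs ξ 2 g = (1 + ξ : ℂ)⁻¹ * g 1 + (-1 + ξ : ℂ)⁻¹ * g (-1) := rfl
  constructor
  · intro H n hn
    have H0 := H 0
    have H1 := H 1
    have H2 := H 2
    rw [r0, s0] at H0
    rw [r1, s1] at H1
    rw [r2, s2] at H2
    rcases int_cases_abs_lt_two hn with rfl | rfl | rfl
    · have : dividedRow m κ c W μ ξ 1 φ = (1 + ξ : ℂ)⁻¹ * g 1 := by
        linear_combination (H0 + H2) / 2
      rw [e1, this, mul_inv_cancel_left₀ n1]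
    · rw [e0, H1]
    · have : dividedRow m κ c W μ ξ (-1) φ = (-1 + ξ : ℂ)⁻¹ * g (-1) := by
        linear_combination (H2 - H0) / 2
      rw [e2, this, mul_inv_cancel_left₀ n2]
  · intro H
    have H1 := H 1 (by norm_num)
    have H0 := H 0 (by norm_num)
    have H2 := H (-1) (by norm_num)
    rw [e1, ← eq_inv_mul_iff_mul_eq₀ n1] at H1
    rw [e2, ← eq_inv_mul_iff_mul_eq₀ n2] at H2
    rw [e0] at H0
    rw [Fin.forall_fin_succ, Fin.forall_fin_succ, Fin.forall_fin_succ]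
    refine ⟨?_, ?_, ?_, fun i => i.elim0⟩
    · rw [r0, s0, H1, H2]
    · exact r1.trans (H0.trans s1.symm)
    · refine r2.trans (Eq.trans ?_ s2.symm)
      rw [H1, H2]

/-- A solution of the full problem is a lift, and satisfies the low-mode equations. -/
theorem solution_iff (h : Perturbative m κ δ L s q c W μ ξ) (φ g : EllTwo) :
    (∀ n, spectralCoeff m κ c W μ ξ φ n = g n) ↔
      φ = liftOp m κ c W μ ξ ((∑ k, lowCoef φ k • lowVec k) + highRhs m κ c ξ g) ∧
      ∀ i, lowRow m κ c W μ ξ i φ = lowRhs ξ i g := by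
  rw [h.solution_iff_dividedRow]
  have hlow : ∀ n : ℤ, ¬ 2 ≤ |n| → highRhs m κ c ξ g n = 0 := fun n hn => by
    rw [h.highRhs_apply, highRes, if_neg hn, zero_mul, zero_mul]
  constructor
  · intro H
    refine ⟨h.eq_liftOp ?_, fun n _ => H n⟩
    ext n
    rw [add_apply, add_apply]
    by_cases hn : 2 ≤ |n|
    · rw [isLow_sum_lowVec _ n hn, zero_add]
      exact (h.spectralCoeff_high hn φ g).1 (H n)
    · rw [h.highOp_apply_low _ hn, hlow n hn, sum_lowCoef_apply φ hn, add_zero, add_zero]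
  · rintro ⟨H1, H2⟩ n
    by_cases hn : 2 ≤ |n|
    · rw [h.spectralCoeff_high hn]
      have := congrArg (fun x : EllTwo => x n) (h.liftOp_eq
        ((∑ k, lowCoef φ k • lowVec k) + highRhs m κ c ξ g))
      rw [← H1] at this
      simp only [add_apply] at this
      rwa [isLow_sum_lowVec _ n hn, zero_add] at this
    · exact H2 n hn

theorem mulVec_reducedMatrix (a : Fin 3 → ℂ) (i : Fin 3) :
    (reducedMatrix m κ c W μ ξ).mulVec a i
      = lowRow m κ c W μ ξ i (liftOp m κ c W μ ξ (∑ k, a k • lowVec k)) := by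
  simp only [Matrix.mulVec, dotProduct, reducedMatrix, Matrix.of_apply, map_sum, map_smul,
    smul_eq_mul]
  exact Finset.sum_congr rfl fun _ _ => mul_comm _ _

theorem lowCoef_liftOp (h : Perturbative m κ δ L s q c W μ ξ) (a : Fin 3 → ℂ) {x : EllTwo}
    (hx : ∀ n : ℤ, ¬ 2 ≤ |n| → x n = 0) :
    lowCoef (liftOp m κ c W μ ξ ((∑ k, a k • lowVec k) + x)) = a := by
  obtain ⟨h1, h0, hm⟩ := sum_lowVec_apply a
  have l1 : ¬ (2 : ℤ) ≤ |1| := by norm_num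
  have l0 : ¬ (2 : ℤ) ≤ |0| := by norm_num
  have lm : ¬ (2 : ℤ) ≤ |-1| := by norm_num
  rw [lowCoef, h.liftOp_apply_low _ l1, h.liftOp_apply_low _ l0, h.liftOp_apply_low _ lm]
  simp only [add_apply]
  rw [hx 1 l1, hx 0 l0, hx (-1) lm, h1, h0, hm]
  ext i
  fin_cases i <;> simp
  ring

/-- The reduced matrix is singular exactly when the spectral equation has a nontrivial solution. -/
theorem det_reducedMatrix_eq_zero_iff (h : Perturbative m κ δ L s q c W μ ξ) :
    (reducedMatrix m κ c W μ ξ).det = 0 ↔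
      ∃ φ : EllTwo, φ ≠ 0 ∧ ∀ n, spectralCoeff m κ c W μ ξ φ n = 0 := by
  rw [← Matrix.exists_mulVec_eq_zero_iff]
  constructor
  · rintro ⟨a, ha, h0⟩
    have hc := h.lowCoef_liftOp a (x := 0) (fun n _ => rfl)
    rw [add_zero] at hc
    refine ⟨liftOp m κ c W μ ξ (∑ k, a k • lowVec k), fun hz => ha ?_, fun n => ?_⟩
    · rw [← hc, hz]
      ext i
      fin_cases i <;> simp [lowCoef]
    · refine (h.solution_iff _ 0).2 ⟨?_, fun i => ?_⟩ n
      · rw [hc, map_zero, add_zero]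
      · rw [← mulVec_reducedMatrix, h0, map_zero]
        rfl
  · rintro ⟨φ, hφ, H⟩
    obtain ⟨H1, H2⟩ := (h.solution_iff φ 0).1 H
    rw [map_zero, add_zero] at H1
    refine ⟨lowCoef φ, fun hz => hφ ?_, ?_⟩
    · rw [H1, hz]
      simp
    · ext i
      rw [mulVec_reducedMatrix, ← H1, H2, map_zero]
      rfl

/-- If the reduced matrix is regular, the spectral equation is uniquely solvable by a bounded
operator. -/
theorem exists_solution_operator (h : Perturbative m κ δ L s q c W μ ξ)
    (hdet : (reducedMatrix m κ c W μ ξ).det ≠ 0) :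
    ∃ R : EllTwo →L[ℂ] EllTwo, ∀ g n, spectralCoeff m κ c W μ ξ (R g) n = g n := by
  set A := reducedMatrix m κ c W μ ξ
  set G := highRhs m κ c ξ
  set T := liftOp m κ c W μ ξ
  -- `b g` is what remains of the low-mode equations once the lift of the high-mode forcing is
  -- subtracted; inverting the reduced matrix then gives the low-mode coefficients `a g`.
  let b : EllTwo →L[ℂ] (Fin 3 → ℂ) := ContinuousLinearMap.pi fun i =>
    lowRhs ξ i - (lowRow m κ c W μ ξ i).comp (T.comp G)
  let a : EllTwo →L[ℂ] (Fin 3 → ℂ) := (LinearMap.toContinuousLinearMap (A⁻¹).mulVecLin).comp b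
  refine ⟨T.comp (G + ∑ k, ((ContinuousLinearMap.proj k).comp a).smulRight (lowVec k)),
    fun g n => ?_⟩
  have e : (T.comp (G + ∑ k, ((ContinuousLinearMap.proj k).comp a).smulRight (lowVec k))) g
      = T ((∑ k, a g k • lowVec k) + G g) := by
    rw [ContinuousLinearMap.comp_apply, _root_.add_apply,
      _root_.sum_apply, add_comm]
    rfl
  rw [e]
  have hG : ∀ n : ℤ, ¬ 2 ≤ |n| → G g n = 0 := fun n hn => by
    show highRhs m κ c ξ g n = 0
    rw [h.highRhs_apply, highRes, if_neg hn, zero_mul, zero_mul]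
  refine (h.solution_iff _ g).2 ⟨?_, fun i => ?_⟩ n
  · rw [h.lowCoef_liftOp _ hG]
  · rw [map_add, map_add, ← mulVec_reducedMatrix]
    have h1 : A.mulVec (a g) = b g := by
      show A.mulVec ((A⁻¹).mulVec (b g)) = b g
      rw [Matrix.mulVec_mulVec, Matrix.mul_nonsing_inv _ (isUnit_iff_ne_zero.2 hdet),
        Matrix.one_mulVec]
    rw [h1]
    exact sub_add_cancel (lowRhs ξ i g) _

end Perturbative

end

end Whitham

namespace Whitham

noncomputable section

open EllTwo

/-! ### Small waves in normalized form -/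

/-- A traveling wave of mean zero whose Fourier coefficients `v` are real and even, with
`v 1 = a > 0`; `W` is the multiplication by the wave, i.e. convolution with `v`. -/
structure SmallWave (m : ℝ → ℝ) (κ c ε a : ℝ) (v : EllTwo) (W : EllTwo →L[ℂ] EllTwo) : Prop where
  conv : IsConv W v
  real : ∀ n, star (v n) = v n
  even : ∀ n, v (-n) = v n
  mean : v 0 = 0
  amplitude : v 1 = (a : ℂ)
  pos : 0 < a
  norm_le : ‖W‖ ≤ ε
  speed : |c - m κ| ≤ ε
  equation : ∀ n : ℤ, n ≠ 0 → ((c - m (κ * n) : ℝ) : ℂ) * v n = W v n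
  derivative : Memℓp (fun n : ℤ => (n : ℂ) * v n) 2

/-- The part of a sequence in the modes `|n| ≥ 2`. -/
def highPart (v : EllTwo) : EllTwo := diagOp (fun n => if 2 ≤ |n| then 1 else 0) v

theorem highPart_apply (v : EllTwo) (n : ℤ) : highPart v n = if 2 ≤ |n| then v n else 0 := by
  rw [highPart, diagOp_apply (C := 1)]
  · split_ifs <;> simp
  · intro n; split_ifs <;> simp

theorem lowVec_two_apply (n : ℤ) : lowVec 2 n = if n = 1 ∨ n = -1 then 1 else 0 := by
  have : lowVec 2 n = unitSeq 1 n + unitSeq (-1) n := rfl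
  rw [this, unitSeq_apply, unitSeq_apply]
  rcases eq_or_ne n 1 with rfl | h1
  · norm_num
  · simp [h1]

namespace SmallWave

variable {m : ℝ → ℝ} {κ δ L s q c ε a : ℝ} {v : EllTwo} {W : EllTwo →L[ℂ] EllTwo}

theorem perturbative (h : SmallWave m κ c ε a v W) (hm : RegularSymbol m κ δ L s q)
    (hε : ε ≤ δ / 16) {μ : ℂ} {ξ : ℝ} (hξ : |ξ| ≤ 1 / 2) (hLξ : L * |ξ| ≤ δ / 4)
    (hμ : ‖μ‖ ≤ δ / 8) : Perturbative m κ δ L s q c W μ ξ :=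
  ⟨hm, h.speed.trans hε, h.norm_le.trans hε, hξ, hLξ, hμ⟩

theorem perturbative_zero (h : SmallWave m κ c ε a v W) (hm : RegularSymbol m κ δ L s q)
    (hε : ε ≤ δ / 16) : Perturbative m κ δ L s q c W 0 0 := by
  have := hm.gap_pos
  refine h.perturbative hm hε ?_ ?_ ?_ <;> simp <;> positivity

theorem amplitude_le (h : SmallWave m κ c ε a v W) : a ≤ ε := by
  have h1 := EllTwo.norm_apply_le v 1
  rw [h.amplitude, Complex.norm_real, Real.norm_of_nonneg h.pos.le] at h1
  exact h1.trans (h.conv.norm_le_norm.trans h.norm_le)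

theorem eq_add_highPart (h : SmallWave m κ c ε a v W) :
    v = (a : ℂ) • lowVec 2 + highPart v := by
  ext n
  rw [add_apply, smul_apply, highPart_apply, lowVec_two_apply]
  by_cases hn : 2 ≤ |n|
  · have h1 : n ≠ 1 := by rintro rfl; norm_num at hn
    have h2 : n ≠ -1 := by rintro rfl; norm_num at hn
    simp [hn, h1, h2]
  · rcases int_cases_abs_lt_two hn with rfl | rfl | rfl
    · simp [h.amplitude]
    · simp [h.mean]
    · have := h.even 1
      simp [this, h.amplitude]

theorem norm_le_add (h : SmallWave m κ c ε a v W) : ‖v‖ ≤ 2 * a + ‖highPart v‖ := by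
  conv_lhs => rw [h.eq_add_highPart]
  refine (norm_add_le _ _).trans (add_le_add ?_ le_rfl)
  rw [norm_smul, Complex.norm_real, Real.norm_of_nonneg h.pos.le, mul_comm]
  have : ‖lowVec 2‖ ≤ 2 := (norm_add_le _ _).trans (by rw [norm_unitSeq, norm_unitSeq]; norm_num)
  exact mul_le_mul_of_nonneg_right this h.pos.le

/-- The high part r of the wave satisfies ‖r‖ ≤ (2/δ)‖Wv‖, and ‖Wv‖ ≤ 2a‖v‖ + ε‖r‖ with ‖v‖ ≤ 2a +
‖r‖. The terms with r on the right are absorbed because a and ε are at most δ/16, which leaves a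
bound quadratic in a. -/
theorem highPart_bound (h : SmallWave m κ c ε a v W) (hm : RegularSymbol m κ δ L s q)
    (hε : ε ≤ δ / 16) : ‖highPart v‖ ≤ 8 * (2 / δ) * a ^ 2 := by
  have hδ := hm.gap_pos
  have ha := h.pos
  have hp := h.perturbative_zero hm hε
  have hae := h.amplitude_le
  have hε0 : 0 < ε := ha.trans_le hae
  have h1 : ‖highPart v‖ ≤ 2 / δ * ‖W v‖ := by
    refine norm_le_of_forall (by positivity) fun n => ?_
    rw [highPart_apply]
    split_ifs with hn
    · have hn0 : n ≠ 0 := by rintro rfl; norm_num at hn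
      have h2 := hp.gap hn
      rw [add_zero] at h2
      rw [← h.equation n hn0, norm_mul, Complex.norm_real, Real.norm_eq_abs, ← mul_assoc]
      refine le_mul_of_one_le_left (norm_nonneg _) ?_
      calc (1 : ℝ) = 2 / δ * (δ / 2) := by field_simp
        _ ≤ _ := by gcongr
    · rw [norm_zero]; positivity
  have h2 : ‖W v‖ ≤ 2 * a * ‖v‖ + ε * ‖highPart v‖ := by
    have e : W v = (a : ℂ) • (W (unitSeq 1) + W (unitSeq (-1))) + W (highPart v) := by
      conv_lhs => rw [h.eq_add_highPart]
      rw [map_add, map_smul]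
      congr 2
      exact map_add W _ _
    rw [e]
    refine (norm_add_le _ _).trans (add_le_add ?_
      (ContinuousLinearMap.le_of_opNorm_le _ h.norm_le _))
    rw [norm_smul, Complex.norm_real, Real.norm_of_nonneg ha.le]
    have := norm_add_le (W (unitSeq 1)) (W (unitSeq (-1)))
    rw [h.conv.norm_apply_unitSeq, h.conv.norm_apply_unitSeq] at this
    nlinarith
  have h3 := h.norm_le_add
  have h4 : 2 / δ * ε ≤ 1 / 8 := by
    calc 2 / δ * ε ≤ 2 / δ * (δ / 16) := by gcongr
      _ = 1 / 8 := by field_simp; norm_num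
  have h5 : 2 / δ * a ≤ 1 / 8 := le_trans (by gcongr) h4
  have hA : 0 < 2 / δ := by positivity
  have h6 : 0 ≤ ‖highPart v‖ := norm_nonneg _
  generalize ‖highPart v‖ = r at *
  generalize ‖v‖ = N at *
  generalize ‖W v‖ = M at *
  generalize 2 / δ = A at *
  have h7 : A * M ≤ A * (2 * a * (2 * a + r) + ε * r) := by
    gcongr
    exact h2.trans (by gcongr)
  have h8 : A * ε * r ≤ 1 / 8 * r := by gcongr
  have h9 : A * a * r ≤ 1 / 8 * r := by gcongr
  nlinarith

theorem norm_bound (h : SmallWave m κ c ε a v W) (hm : RegularSymbol m κ δ L s q)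
    (hε : ε ≤ δ / 16) : ‖v‖ ≤ 3 * a := by
  have hδ := hm.gap_pos
  have h1 := h.highPart_bound hm hε
  have h2 := h.norm_le_add
  have h3 : 8 * (2 / δ) * a ^ 2 ≤ a := by
    have h4 : 2 / δ * a ≤ 1 / 8 := by
      have := h.amplitude_le
      calc 2 / δ * a ≤ 2 / δ * (δ / 16) := by gcongr; linarith
        _ = 1 / 8 := by field_simp; norm_num
    nlinarith [h.pos]
  linarith

theorem conv_lowVec_le (h : SmallWave m κ c ε a v W) (hm : RegularSymbol m κ δ L s q)
    (hε : ε ≤ δ / 16) (k : Fin 3) : ‖W (lowVec k)‖ ≤ 6 * a := by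
  have h1 := h.norm_bound hm hε
  have h2 := h.pos
  have hn := h.conv.norm_apply_unitSeq
  fin_cases k
  · have e : W (lowVec 0) = W (unitSeq 1) - W (unitSeq (-1)) := map_sub W _ _
    have := norm_sub_le (W (unitSeq 1)) (W (unitSeq (-1)))
    rw [hn, hn] at this
    show ‖W (lowVec 0)‖ ≤ _
    rw [e]; linarith
  · show ‖W (unitSeq 0)‖ ≤ _
    rw [hn]; linarith
  · have e : W (lowVec 2) = W (unitSeq 1) + W (unitSeq (-1)) := map_add W _ _
    have := norm_add_le (W (unitSeq 1)) (W (unitSeq (-1)))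
    rw [hn, hn] at this
    show ‖W (lowVec 2)‖ ≤ _
    rw [e]; linarith

/-- Reflection symmetry of the lifts. -/
theorem reflect_lift (h : SmallWave m κ c ε a v W) {μ : ℂ} {ξ : ℝ}
    (hp : Perturbative m κ δ L s q c W μ ξ) (x : EllTwo) :
    reflect (liftOp m κ c W μ ξ x) = liftOp m κ c W (-μ) (-ξ) (reflect x) := by
  refine hp.neg.eq_liftOp ?_
  ext n
  have h1 := congrArg (fun y : EllTwo => y (-n)) (hp.liftOp_eq x)
  simp only [add_apply] at h1
  rw [reflect_apply, h1, add_apply, reflect_apply, hp.highOp_apply, hp.neg.highOp_apply,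
    h.conv.apply_reflect h.even, reflect_apply, reflect_apply]
  have e1 : highRes m κ c ξ (-n) = highRes m κ c (-ξ) n := by
    rw [highRes, highRes, abs_neg, Int.cast_neg, show κ * (-(n : ℝ) + ξ) = -(κ * (n + -ξ)) by ring,
      hp.symbol.even]
  have e2 : highInv ξ (-n) = -highInv (-ξ) n := by
    rw [highInv, highInv, abs_neg, Int.cast_neg, show (-(n : ℝ) + ξ) = -(n + -ξ) by ring, inv_neg]
    split_ifs
    · exact Complex.ofReal_neg _
    · exact neg_zero.symm
  rw [e1, e2]
  ring

theorem reflect_lowVec_zero : reflect (lowVec 0) = -lowVec 0 := by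
  ext n
  have e : ∀ n, lowVec 0 n = unitSeq 1 n - unitSeq (-1) n := fun _ => rfl
  have e' : (-lowVec 0 : EllTwo) n = -lowVec 0 n := rfl
  rw [reflect_apply, e', e, e]
  simp only [unitSeq_apply, show -n = 1 ↔ n = -1 by omega, show -n = -1 ↔ n = 1 by omega]
  ring

theorem reflect_lowVec_one : reflect (lowVec 1) = lowVec 1 := by
  ext n
  have e : ∀ n, lowVec 1 n = unitSeq 0 n := fun _ => rfl
  rw [reflect_apply, e, e]
  simp [unitSeq_apply]

theorem reflect_lowVec_two : reflect (lowVec 2) = lowVec 2 := by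
  ext n
  rw [reflect_apply, lowVec_two_apply, lowVec_two_apply]
  exact if_congr (by omega) rfl rfl

theorem conv_lift_neg_apply (h : SmallWave m κ c ε a v W) {μ : ℂ} {ξ : ℝ}
    (hp : Perturbative m κ δ L s q c W μ ξ) (x : EllTwo) (n : ℤ) :
    W (liftOp m κ c W μ ξ x) (-n) = W (liftOp m κ c W (-μ) (-ξ) (reflect x)) n := by
  rw [← h.reflect_lift hp, h.conv.apply_reflect h.even, reflect_apply]

/-- The derivative of the wave is the lift of the odd low-mode vector, and solves the
linearized equation. -/
theorem conv_lift_odd_apply (h : SmallWave m κ c ε a v W) (hm : RegularSymbol m κ δ L s q)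
    (hε : ε ≤ δ / 16) :
    2 * W (liftOp m κ c W 0 0 (lowVec 0)) 1 = ((c - m κ : ℝ) : ℂ) := by
  have hp := h.perturbative_zero hm hε
  have ha : (a : ℂ) ≠ 0 := by exact_mod_cast h.pos.ne'
  set φ : EllTwo := ⟨fun n : ℤ => (n : ℂ) * v n, h.derivative⟩ with hφ
  have hφn : ∀ n, φ n = (n : ℂ) * v n := fun _ => rfl
  -- The product rule (w²)' = 2ww' in coefficients: the sum is averaged with its image under j ↦ n -
  -- j.
  have hW : ∀ n : ℤ, 2 * W φ n = n * W v n := by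
    intro n
    have e1 := h.conv φ n
    have e2 := (Equiv.subLeft n).hasSum_iff.2 e1
    have e3 := (e1.add e2)
    have e4 := (h.conv v n).mul_left (n : ℂ)
    rw [two_mul]
    refine e3.unique (e4.congr_fun fun j => ?_)
    simp only [Function.comp, hφn, Equiv.subLeft_apply, sub_sub_cancel]
    push_cast
    ring
  have hrow : ∀ n : ℤ, ((c - m (κ * n) : ℝ) : ℂ) * φ n = 2 * W φ n := by
    intro n
    rcases eq_or_ne n 0 with rfl | hn
    · rw [hW, hφn]; simp
    · rw [hW, hφn, ← h.equation n hn]; ring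
  -- The low modes of `φ` are those of a times the odd vector, because the wave is even. So `φ` is a
  -- lift, and its row n = 1 divided by a is the claim.
  have hlift : φ = liftOp m κ c W 0 0 ((a : ℂ) • lowVec 0) := by
    refine hp.eq_liftOp ?_
    ext n
    have e : ∀ n, lowVec 0 n = unitSeq 1 n - unitSeq (-1) n := fun _ => rfl
    by_cases hn : 2 ≤ |n|
    · have hD := hp.gap hn
      have hδ := hm.gap_pos
      have hD0 : ((c - m (κ * n) : ℝ) : ℂ) ≠ 0 := by
        rw [add_zero] at hD
        have : c - m (κ * n) ≠ 0 := abs_pos.1 (by linarith)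
        exact_mod_cast this
      rw [add_apply, smul_apply, isLow_lowVec 0 n hn, hp.highOp_apply, zero_mul, mul_zero, zero_add,
        add_zero, ← hrow, highRes, if_pos hn, add_zero, Complex.ofReal_inv,
        inv_mul_cancel_left₀ hD0]
    · rw [add_apply, smul_apply, hp.highOp_apply_low _ hn, add_zero, hφn, e]
      simp only [unitSeq_apply]
      rcases int_cases_abs_lt_two hn with rfl | rfl | rfl
      · simp [h.amplitude]
      · simp
      · have := h.even 1
        simp [this, h.amplitude]
  have h1 := hrow 1
  rw [hφn, hlift, map_smul, map_smul, smul_apply, h.amplitude] at h1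
  push_cast at h1
  rw [mul_one, one_mul] at h1
  have h2 : (a : ℂ) * (2 * W (liftOp m κ c W 0 0 (lowVec 0)) 1) = a * ((c - m κ : ℝ) : ℂ) := by
    push_cast
    linear_combination -h1
  exact mul_left_cancel₀ ha h2

end SmallWave

end

end Whitham

namespace Whitham

noncomputable section

open EllTwo

/-! ### Asymptotics of the reduced matrix -/

theorem div_sq_le_div_sq_mul {δ a ε C : ℝ} (hae : a ≤ ε) (hC : 0 ≤ C) :
    C / δ ^ 2 * (a ^ 2 * a) ≤ C / δ ^ 2 * (a ^ 2 * ε) := by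
  gcongr

namespace SmallWave

variable {m : ℝ → ℝ} {κ δ L s q c ε a : ℝ} {v : EllTwo} {W : EllTwo →L[ℂ] EllTwo}

/-- The Stokes expansion of the second harmonic: at n = 2 the wave equation has the forcing v₁² = a²
plus terms of third order, and replacing c by m(κ) costs a relative error ε. -/
theorem second_coeff_asymptotics (h : SmallWave m κ c ε a v W) (hm : RegularSymbol m κ δ L s q)
    (hε : ε ≤ δ / 16) :
    ‖v 2 - ((a ^ 2 * (m κ - m (κ * 2))⁻¹ : ℝ) : ℂ)‖ ≤ 130 / δ ^ 2 * (a ^ 2 * ε) := by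
  have hδ := hm.gap_pos
  have ha := h.pos
  have hp := h.perturbative_zero hm hε
  have hr := h.highPart_bound hm hε
  have hv := h.norm_bound hm hε
  have g1 : δ / 2 ≤ |c - m (κ * 2)| := by
    have := hp.gap (n := 2) (by norm_num)
    rwa [add_zero, Int.cast_ofNat] at this
  have g2 : δ ≤ |m κ - m (κ * 2)| := by
    have := hm.gap 2 (by norm_num)
    rwa [abs_sub_comm, Int.cast_ofNat] at this
  have n1 : c - m (κ * 2) ≠ 0 := abs_pos.1 (by linarith)
  have n2 : m κ - m (κ * 2) ≠ 0 := abs_pos.1 (by linarith)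
  have eqn := h.equation 2 (by norm_num)
  -- The modes ±1 of the wave feed mode 2 through v₁ = a and v₃.
  have eW : W v 2 = a * (a + v 3) + W (highPart v) 2 := by
    conv_lhs => rw [h.eq_add_highPart]
    rw [map_add, map_smul, add_apply, smul_apply]
    congr 2
    have e2 : W (lowVec 2) 2 = W (unitSeq 1) 2 + W (unitSeq (-1)) 2 := by
      rw [← add_apply, ← map_add]; rfl
    rw [e2, h.conv.apply_unitSeq_apply, h.conv.apply_unitSeq_apply]
    rw [show (2 : ℤ) - 1 = 1 by norm_num, show (2 : ℤ) - -1 = 3 by norm_num, h.amplitude]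
  have b3 : ‖v 3‖ ≤ 8 * (2 / δ) * a ^ 2 := by
    have := EllTwo.norm_apply_le (highPart v) 3
    rw [highPart_apply, if_pos (by norm_num)] at this
    exact this.trans hr
  have b4 : ‖W (highPart v) 2‖ ≤ 3 * a * (8 * (2 / δ) * a ^ 2) :=
    (h.conv.norm_apply_le _ _).trans (by gcongr)
  push_cast at eqn
  rw [eW] at eqn
  set e : ℂ := a * v 3 + W (highPart v) 2 with he
  have be : ‖e‖ ≤ 64 / δ * (a ^ 2 * a) := by
    refine (norm_add_le _ _).trans ?_
    rw [norm_mul, Complex.norm_real, Real.norm_of_nonneg ha.le]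
    calc _ ≤ a * (8 * (2 / δ) * a ^ 2) + 3 * a * (8 * (2 / δ) * a ^ 2) := by gcongr
      _ = _ := by ring
  have n1' : (c : ℂ) - m (κ * 2) ≠ 0 := by exact_mod_cast n1
  have n2' : (m κ : ℂ) - m (κ * 2) ≠ 0 := by exact_mod_cast n2
  have e5 : v 2 - ((a ^ 2 * (m κ - m (κ * 2))⁻¹ : ℝ) : ℂ)
      = (((c - m (κ * 2))⁻¹ : ℝ) : ℂ) * e
        - ((a ^ 2 * (c - m κ) * ((c - m (κ * 2))⁻¹ * (m κ - m (κ * 2))⁻¹) : ℝ) : ℂ) := by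
    push_cast
    field_simp
    linear_combination ((m κ : ℂ) - m (κ * 2)) * eqn
  have i1 : |(c - m (κ * 2))⁻¹| ≤ 2 / δ := by
    rw [abs_inv, ← inv_div]; exact inv_anti₀ (by positivity) g1
  have i2 : |(m κ - m (κ * 2))⁻¹| ≤ 1 / δ := by
    rw [abs_inv, one_div]; exact inv_anti₀ hδ g2
  rw [e5]
  refine (norm_sub_le _ _).trans ?_
  rw [norm_mul, Complex.norm_real, Complex.norm_real, Real.norm_eq_abs, Real.norm_eq_abs, abs_mul,
    abs_mul, abs_mul, abs_of_nonneg (sq_nonneg a)]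
  have := h.speed
  calc _ ≤ 2 / δ * (64 / δ * (a ^ 2 * a)) + a ^ 2 * ε * (2 / δ * (1 / δ)) := by
        have hε0 : 0 ≤ ε := ha.le.trans h.amplitude_le
        gcongr
    _ = 128 / δ ^ 2 * (a ^ 2 * a) + 2 / δ ^ 2 * (a ^ 2 * ε) := by
        field_simp; ring
    _ ≤ 128 / δ ^ 2 * (a ^ 2 * ε) + 2 / δ ^ 2 * (a ^ 2 * ε) := by
        gcongr; exact h.amplitude_le
    _ = _ := by ring

/-- The effective coupling from mode -1 to mode 1. The direct path contributes v₂. Paths through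
high modes are of higher order: one intermediate mode costs a third power of a, and two or more give
a²ε. -/
theorem coupling_asymptotics (h : SmallWave m κ c ε a v W) (hm : RegularSymbol m κ δ L s q)
    (hε : ε ≤ δ / 16) :
    ‖W (liftOp m κ c W 0 0 (unitSeq (-1))) 1 - ((a ^ 2 * (m κ - m (κ * 2))⁻¹ : ℝ) : ℂ)‖
      ≤ 700 / δ ^ 2 * (a ^ 2 * ε) := by
  have hδ := hm.gap_pos
  have ha := h.pos
  have hae := h.amplitude_le
  have hε0 : 0 ≤ ε := ha.le.trans hae
  have hp := h.perturbative_zero hm hε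
  have hr := h.highPart_bound hm hε
  have hv := h.norm_bound hm hε
  set Z := highOp m κ c W 0 0 with hZ
  set y := liftOp m κ c W 0 0 (unitSeq (-1)) with hy
  have e1 : y = unitSeq (-1) + Z y := hp.liftOp_eq _
  -- The Neumann series is expanded to second order, with exact remainder.
  have e2 : W y = W (unitSeq (-1)) + (W (Z (unitSeq (-1))) + W (Z (Z y))) := by
    conv_lhs => rw [e1, map_add]
    conv_lhs => rw [e1, map_add, map_add]
  have b1 : ‖W (Z (Z y)) 1‖ ≤ 288 / δ ^ 2 * (a ^ 2 * ε) := by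
    have c1 := hp.norm_highOp_zero_apply_le (Z y)
    have c2 := ContinuousLinearMap.le_of_opNorm_le _ h.norm_le (Z y)
    have c3 := hp.norm_highOp_zero_apply_le y
    have c4 := hp.norm_conv_lift_zero_le (unitSeq (-1))
    rw [h.conv.norm_apply_unitSeq, ← hy] at c4
    rw [← hZ] at c1 c3
    calc _ ≤ ‖v‖ * ‖Z (Z y)‖ := h.conv.norm_apply_le _ _
      _ ≤ 3 * a * (2 / δ * 2 * (ε * (2 / δ * 2 * (2 * (3 * a))))) := by
          gcongr
          refine c1.trans ?_
          gcongr
          refine c2.trans ?_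
          gcongr
          refine c3.trans ?_
          gcongr
          exact c4.trans (by gcongr)
      _ = _ := by field_simp; ring
  have b2 : ‖W (Z (unitSeq (-1))) 1‖ ≤ 256 / δ ^ 2 * (a ^ 2 * a) := by
    set x := Z (unitSeq (-1)) with hx
    set t : ℂ := 2 * a * highRes m κ c 0 (-2) with ht
    -- From mode -1 the fundamental reaches only 0 and -2, and 0 is not a high mode. So to leading
    -- order `x` sits at -2, from where mode 1 is reached only through v₃ = O(a²).
    have d1 : ‖x - t • unitSeq (-2)‖ ≤ 2 / δ * 2 * ‖reindex (Equiv.addRight 1) (highPart v)‖ := by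
      refine norm_le_of_forall (by positivity) fun n => ?_
      rw [sub_apply, smul_apply, reindex_apply, Equiv.coe_addRight]
      by_cases hn : 2 ≤ |n|
      · have f1 : x n = highRes m κ c 0 n * (2 * v (n + 1)) := by
          rw [hx, hZ, hp.highOp_apply, zero_mul, add_zero, h.conv.apply_unitSeq_apply,
            sub_neg_eq_add]
        have f2 : v (n + 1) = a * lowVec 2 (n + 1) + highPart v (n + 1) := by
          conv_lhs => rw [h.eq_add_highPart]
          rfl
        have f3 : x n - t * unitSeq (-2) n = highRes m κ c 0 n * (2 * highPart v (n + 1)) := by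
          rw [f1, f2, lowVec_two_apply, unitSeq_apply]
          by_cases h2 : n = -2
          · subst h2; simp [ht]; ring
          · have h3 : ¬ (n + 1 = 1 ∨ n + 1 = -1) := by
              rintro (h3 | h3)
              · have : n = 0 := by omega
                subst this; norm_num at hn
              · omega
            rw [if_neg h2, if_neg h3]; ring
        rw [f3, norm_mul, norm_mul, Complex.norm_ofNat, mul_assoc]
        have := hp.norm_highRes_le n
        gcongr
      · have f1 : x n = 0 := hp.highOp_apply_low _ hn
        have f2 : n ≠ -2 := by rintro rfl; norm_num at hn
        rw [f1, unitSeq_apply, if_neg f2, mul_zero, sub_zero, norm_zero]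
        positivity
    rw [norm_reindex] at d1
    have d2 : W x 1 = t * v 3 + W (x - t • unitSeq (-2)) 1 := by
      rw [map_sub, map_smul, sub_apply, smul_apply, h.conv.apply_unitSeq_apply,
        show (1 : ℤ) - -2 = 3 by norm_num]
      ring
    have d3 : ‖v 3‖ ≤ 8 * (2 / δ) * a ^ 2 := by
      have := EllTwo.norm_apply_le (highPart v) 3
      rw [highPart_apply, if_pos (by norm_num)] at this
      exact this.trans hr
    have d4 : ‖t‖ ≤ 2 * a * (2 / δ) := by
      have := hp.norm_highRes_le (-2)
      rw [ht, norm_mul, norm_mul, Complex.norm_ofNat, Complex.norm_real,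
        Real.norm_of_nonneg ha.le]
      gcongr
    rw [d2]
    refine (norm_add_le _ _).trans ?_
    rw [norm_mul]
    calc _ ≤ 2 * a * (2 / δ) * (8 * (2 / δ) * a ^ 2)
          + 3 * a * (2 / δ * 2 * (8 * (2 / δ) * a ^ 2)) := by
          gcongr
          refine (h.conv.norm_apply_le _ _).trans ?_
          gcongr
          exact d1.trans (by gcongr)
      _ = _ := by field_simp; ring
  have b3 := h.second_coeff_asymptotics hm hε
  have e3 : W y 1 = v 2 + (W (Z (unitSeq (-1))) 1 + W (Z (Z y)) 1) := by
    rw [e2, EllTwo.add_apply, EllTwo.add_apply, h.conv.apply_unitSeq_apply,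
      show (1 : ℤ) - -1 = 2 by norm_num]
  rw [e3, add_sub_right_comm]
  have b4 := div_sq_le_div_sq_mul (δ := δ) (a := a) hae (by norm_num : (0 : ℝ) ≤ 256)
  calc _ ≤ 130 / δ ^ 2 * (a ^ 2 * ε)
        + (256 / δ ^ 2 * (a ^ 2 * a) + 288 / δ ^ 2 * (a ^ 2 * ε)) :=
        (norm_add_le _ _).trans (add_le_add b3 ((norm_add_le _ _).trans (add_le_add b2 b1)))
    _ ≤ 130 / δ ^ 2 * (a ^ 2 * ε)
        + (256 / δ ^ 2 * (a ^ 2 * ε) + 288 / δ ^ 2 * (a ^ 2 * ε)) := by gcongr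
    _ = 674 / δ ^ 2 * (a ^ 2 * ε) := by ring
    _ ≤ _ := by gcongr; norm_num

end SmallWave

/-- The diagonal symbol of the divided equation for the mode `n`. -/
def dividedSymbol (m : ℝ → ℝ) (κ c : ℝ) (μ : ℂ) (ξ : ℝ) (n : ℤ) : ℂ :=
  ((c - m (κ * (n + ξ)) : ℝ) : ℂ) - μ / (n + ξ)

/-- Expansion of the symbols of the modes `±1`. -/
theorem RegularSymbol.dividedSymbol_asymptotics {m : ℝ → ℝ} {κ δ L s q : ℝ}
    (hm : RegularSymbol m κ δ L s q) {η : ℝ} (hη : 0 < η) :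
    ∃ ρ₀ > 0, ∀ (c : ℝ) (μ : ℂ) (ξ ρ : ℝ), ρ ≤ ρ₀ → |ξ| ≤ ρ → ‖μ‖ ≤ ρ →
      ‖dividedSymbol m κ c μ ξ 1 + dividedSymbol m κ c μ ξ (-1)
        - 2 * ((c - m κ : ℝ) : ℂ) - 2 * (μ * ξ - q * ξ ^ 2)‖ ≤ η * ρ ^ 2 ∧
      ‖dividedSymbol m κ c μ ξ 1 - dividedSymbol m κ c μ ξ (-1) + 2 * (μ + s * ξ)‖ ≤ η * ρ := by
  have h1 := Asymptotics.isLittleO_iff.1 hm.taylor (by positivity : 0 < η / 4)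
  obtain ⟨r, hr, hball⟩ := Metric.eventually_nhds_iff_ball.1 h1
  refine ⟨min (r / 2) (min (1 / 2) (η / 8)), by positivity, fun c μ ξ ρ hρ hξ hμ => ?_⟩
  have hρ1 : ρ ≤ r / 2 := hρ.trans (min_le_left _ _)
  have hρ2 : ρ ≤ 1 / 2 := hρ.trans ((min_le_right _ _).trans (min_le_left _ _))
  have hρ3 : ρ ≤ η / 8 := hρ.trans ((min_le_right _ _).trans (min_le_right _ _))
  have hρ0 : 0 ≤ ρ := (abs_nonneg _).trans hξ
  have hξ2 : ξ ^ 2 ≤ ρ ^ 2 := sq_le_sq' (abs_le.1 hξ).1 (abs_le.1 hξ).2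
  have hE : ∀ x : ℝ, |x| ≤ ρ → |m (κ * (1 + x)) - m κ - s * x - q * x ^ 2| ≤ η / 4 * x ^ 2 := by
    intro x hx
    have := hball x (by rw [mem_ball_zero_iff, Real.norm_eq_abs]; linarith)
    rwa [Real.norm_eq_abs, Real.norm_eq_abs, abs_of_nonneg (sq_nonneg x)] at this
  have hE1 := hE ξ hξ
  have hE2 := hE (-ξ) (by rwa [abs_neg])
  set E₁ := m (κ * (1 + ξ)) - m κ - s * ξ - q * ξ ^ 2 with hE₁
  set E₂ := m (κ * (1 + -ξ)) - m κ - s * (-ξ) - q * (-ξ) ^ 2 with hE₂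
  rw [neg_sq] at hE2
  have m1 : m (κ * (1 + ξ)) = m κ + s * ξ + q * ξ ^ 2 + E₁ := by rw [hE₁]; ring
  -- By evenness the expansion at -κ is that at κ with ξ reversed, so only the linear term changes
  -- sign.
  have m2 : m (κ * (-1 + ξ)) = m κ - s * ξ + q * ξ ^ 2 + E₂ := by
    rw [hE₂, ← hm.even (κ * (1 + -ξ)), show -(κ * (1 + -ξ)) = κ * (-1 + ξ) by ring]; ring
  have hξ' : |ξ| ≤ 1 / 2 := hξ.trans hρ2
  have hlow : 3 / 4 ≤ 1 - ξ ^ 2 := by nlinarith [abs_le.1 hξ']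
  have k0 : (1 : ℝ) - ξ ^ 2 ≠ 0 := by linarith
  have k0' : (1 : ℂ) - ξ ^ 2 ≠ 0 := by exact_mod_cast k0
  have k1 : (1 : ℂ) + ξ ≠ 0 := by
    have : (1 : ℝ) + ξ ≠ 0 := by linarith [(abs_le.1 hξ').1]
    exact_mod_cast this
  have k2 : (-1 : ℂ) + ξ ≠ 0 := by
    have : (-1 : ℝ) + ξ ≠ 0 := by linarith [(abs_le.1 hξ').2]
    exact_mod_cast this
  have d1 : dividedSymbol m κ c μ ξ 1
      = ((c - (m κ + s * ξ + q * ξ ^ 2 + E₁) : ℝ) : ℂ) - μ / (1 + ξ) := by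
    rw [dividedSymbol, Int.cast_one, Int.cast_one, m1]
  have d2 : dividedSymbol m κ c μ ξ (-1)
      = ((c - (m κ - s * ξ + q * ξ ^ 2 + E₂) : ℝ) : ℂ) - μ / (-1 + ξ) := by
    rw [dividedSymbol]
    push_cast
    rw [m2]
    push_cast
    ring
  have hinv : ‖(ξ ^ 2 / (1 - ξ ^ 2) : ℝ)‖ ≤ 2 * ρ ^ 2 := by
    rw [Real.norm_of_nonneg (by apply div_nonneg (sq_nonneg _); linarith),
      div_le_iff₀ (by linarith)]
    nlinarith [sq_nonneg ρ]
  constructor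
  · have e : dividedSymbol m κ c μ ξ 1 + dividedSymbol m κ c μ ξ (-1)
        - 2 * ((c - m κ : ℝ) : ℂ) - 2 * (μ * ξ - q * ξ ^ 2)
        = ((-(E₁ + E₂) : ℝ) : ℂ) + 2 * (μ * ξ) * ((ξ ^ 2 / (1 - ξ ^ 2) : ℝ) : ℂ) := by
      rw [d1, d2]
      push_cast
      field_simp
      ring
    rw [e]
    refine (norm_add_le _ _).trans ?_
    rw [norm_mul, norm_mul, norm_mul, Complex.norm_real, Complex.norm_real, Complex.norm_real,
      Complex.norm_ofNat, norm_neg, Real.norm_eq_abs, Real.norm_eq_abs ξ]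
    calc _ ≤ (η / 4 * ρ ^ 2 + η / 4 * ρ ^ 2) + 2 * (ρ * ρ) * (2 * ρ ^ 2) := by
          gcongr
          refine (abs_add_le _ _).trans (add_le_add (hE1.trans ?_) (hE2.trans ?_)) <;> gcongr
      _ ≤ η * ρ ^ 2 := by
          have : ρ ^ 2 ≤ η / 8 := by nlinarith
          nlinarith [sq_nonneg ρ]
  · have e : dividedSymbol m κ c μ ξ 1 - dividedSymbol m κ c μ ξ (-1) + 2 * (μ + s * ξ)
        = ((-(E₁ - E₂) : ℝ) : ℂ) - 2 * μ * ((ξ ^ 2 / (1 - ξ ^ 2) : ℝ) : ℂ) := by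
      rw [d1, d2]
      push_cast
      field_simp
      ring
    rw [e]
    refine (norm_sub_le _ _).trans ?_
    rw [norm_mul, norm_mul, Complex.norm_real, Complex.norm_real,
      Complex.norm_ofNat, norm_neg, Real.norm_eq_abs]
    calc _ ≤ (η / 4 * ρ ^ 2 + η / 4 * ρ ^ 2) + 2 * ρ * (2 * ρ ^ 2) := by
          gcongr
          refine (abs_sub _ _).trans (add_le_add (hE1.trans ?_) (hE2.trans ?_)) <;> gcongr
      _ ≤ η * ρ := by
          have h2 : ρ ^ 2 ≤ ρ := by nlinarith
          have h3 : ρ ^ 2 ≤ η / 8 := by nlinarith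
          nlinarith

end

end Whitham

/-! ### Leading-order form of the reduced matrix -/

namespace Whitham

noncomputable section

open EllTwo

/-- The entries of `B` are close to those of the leading-order model of the reduced matrix for a
wave of amplitude `a`, for parameters `μ`, `ξ` of size at most `ρ`. -/
structure NearModel (s q ν₀ σ η a ρ : ℝ) (μ : ℂ) (ξ : ℝ) (B : Matrix (Fin 3) (Fin 3) ℂ) :
    Prop where
  tt : ‖B 0 0 - 2 * (μ * ξ - q * ξ ^ 2)‖ ≤ η * ρ ^ 2
  tz : ‖B 0 1‖ ≤ η * ρ
  ts : ‖B 0 2 + 2 * (μ + s * ξ)‖ ≤ η * (a * ρ)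
  zt : ‖B 1 0‖ ≤ η * ρ ^ 2
  zz : ‖B 1 1 - (ν₀ * ξ - μ)‖ ≤ η * ρ
  zs : ‖B 1 2 + 4 * a * ξ‖ ≤ η * (a * ρ)
  st : ‖B 2 0 + 2 * (μ + s * ξ)‖ ≤ η * (a * ρ)
  sz : ‖B 2 1 + 4 * a‖ ≤ η * a
  ss : ‖B 2 2 + 8 * σ * a ^ 2‖ ≤ η * a ^ 2

theorem lowVec_apply_values :
    (lowVec 0 1 = 1 ∧ lowVec 0 0 = 0 ∧ lowVec 0 (-1) = -1) ∧
    (lowVec 1 1 = 0 ∧ lowVec 1 0 = 1 ∧ lowVec 1 (-1) = 0) ∧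
    (lowVec 2 1 = 1 ∧ lowVec 2 0 = 0 ∧ lowVec 2 (-1) = 1) := by
  have e0 : ∀ n, lowVec 0 n = unitSeq 1 n - unitSeq (-1) n := fun _ => rfl
  have e1 : ∀ n, lowVec 1 n = unitSeq 0 n := fun _ => rfl
  simp only [e0, e1, lowVec_two_apply, unitSeq_apply]
  norm_num

namespace Perturbative

variable {m : ℝ → ℝ} {κ δ L s q c : ℝ} {W : EllTwo →L[ℂ] EllTwo} {μ : ℂ} {ξ : ℝ}

theorem dividedRow_lift (h : Perturbative m κ δ L s q c W μ ξ) (x : EllTwo) {n : ℤ}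
    (hn : ¬ 2 ≤ |n|) : dividedRow m κ c W μ ξ n (liftOp m κ c W μ ξ x)
      = dividedSymbol m κ c μ ξ n * x n - 2 * W (liftOp m κ c W μ ξ x) n := by
  rw [← h.liftOp_apply_low x hn]
  rfl

theorem zeroRow_lift (h : Perturbative m κ δ L s q c W μ ξ) (x : EllTwo) :
    zeroRow m κ c W μ ξ (liftOp m κ c W μ ξ x)
      = ((ξ * (c - m (κ * ξ)) : ℝ) - μ) * x 0 - 2 * ξ * W (liftOp m κ c W μ ξ x) 0 := by
  rw [← h.liftOp_apply_low x (n := 0) (by norm_num)]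
  rfl

end Perturbative

/-- The entries of the reduced matrix. -/
theorem Perturbative.reducedMatrix_entries {m : ℝ → ℝ} {κ δ L s q c : ℝ}
    {W : EllTwo →L[ℂ] EllTwo} {μ : ℂ} {ξ : ℝ} (h : Perturbative m κ δ L s q c W μ ξ) (k : Fin 3) :
    let w := W (liftOp m κ c W μ ξ (lowVec k))
    let d := dividedSymbol m κ c μ ξ
    reducedMatrix m κ c W μ ξ 0 k
        = d 1 * lowVec k 1 - d (-1) * lowVec k (-1) - 2 * (w 1 - w (-1)) ∧
      reducedMatrix m κ c W μ ξ 1 k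
        = ((ξ * (c - m (κ * ξ)) : ℝ) - μ) * lowVec k 0 - 2 * ξ * w 0 ∧
      reducedMatrix m κ c W μ ξ 2 k
        = d 1 * lowVec k 1 + d (-1) * lowVec k (-1) - 2 * (w 1 + w (-1)) := by
  intro w d
  have h1 := h.dividedRow_lift (lowVec k) (n := 1) (by norm_num)
  have h2 := h.dividedRow_lift (lowVec k) (n := -1) (by norm_num)
  have h0 := h.zeroRow_lift (lowVec k)
  refine ⟨?_, h0, ?_⟩
  · have e : reducedMatrix m κ c W μ ξ 0 k
      = dividedRow m κ c W μ ξ 1 (liftOp m κ c W μ ξ (lowVec k))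
        - dividedRow m κ c W μ ξ (-1) (liftOp m κ c W μ ξ (lowVec k)) := rfl
    rw [e, h1, h2]
    ring
  · have e : reducedMatrix m κ c W μ ξ 2 k
      = dividedRow m κ c W μ ξ 1 (liftOp m κ c W μ ξ (lowVec k))
        + dividedRow m κ c W μ ξ (-1) (liftOp m κ c W μ ξ (lowVec k)) := rfl
    rw [e, h1, h2]
    ring

namespace SmallWave

variable {m : ℝ → ℝ} {κ δ L s q c ε a : ℝ} {v : EllTwo} {W : EllTwo →L[ℂ] EllTwo}

/-- A constant bounding all error terms of the reduced matrix. -/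
def errConst (δ L : ℝ) : ℝ :=
  1 + 72 * diffConst δ L + 18 * (4 * secondConst δ L + 8 * oppConst δ L * diffConst δ L)
    + 144 / δ + 8 * (700 / δ ^ 2)

theorem errConst_parts (hδ : 0 < δ) (hL : 0 ≤ L) :
    1 ≤ errConst δ L ∧ 72 * diffConst δ L ≤ errConst δ L ∧
      18 * (4 * secondConst δ L + 8 * oppConst δ L * diffConst δ L) ≤ errConst δ L ∧
      144 / δ ≤ errConst δ L ∧ 8 * (700 / δ ^ 2) ≤ errConst δ L := by
  have h1 : 0 ≤ diffConst δ L := by unfold diffConst; positivity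
  have h2 : 0 ≤ oppConst δ L := by unfold oppConst; positivity
  have h3 : 0 ≤ secondConst δ L := by unfold secondConst; positivity
  have h4 : 0 ≤ 144 / δ := by positivity
  have h5 : 0 ≤ 700 / δ ^ 2 := by positivity
  have h6 : 0 ≤ oppConst δ L * diffConst δ L := by positivity
  unfold errConst
  refine ⟨?_, ?_, ?_, ?_, ?_⟩ <;> linarith

/-- One factor a comes from Cauchy–Schwarz against the wave, the other from `W (lowVec k)` in the
bound for the increment of the lift. -/
theorem conv_lift_sub_bound (h : SmallWave m κ c ε a v W) (hε : ε ≤ δ / 16) {μ : ℂ} {ξ ρ : ℝ}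
    (hp : Perturbative m κ δ L s q c W μ ξ) (hμ : ‖μ‖ ≤ ρ) (hξ : |ξ| ≤ ρ) (k : Fin 3) (n : ℤ) :
    ‖W (liftOp m κ c W μ ξ (lowVec k)) n - W (liftOp m κ c W 0 0 (lowVec k)) n‖
      ≤ errConst δ L * (a ^ 2 * ρ) := by
  have hδ := hp.symbol.gap_pos
  have ha := h.pos
  have hρ : 0 ≤ ρ := (abs_nonneg _).trans hξ
  have hK : 0 ≤ diffConst δ L := by
    have := hp.symbol.lip_nonneg
    unfold diffConst; positivity
  have h1 := hp.norm_lift_sub_le hμ hξ (isLow_lowVec k)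
  have h2 := h.conv_lowVec_le hp.symbol hε k
  have h3 := h.norm_bound hp.symbol hε
  rw [← sub_apply, ← map_sub]
  calc _ ≤ 3 * a * (4 * diffConst δ L * ρ * (6 * a)) := by
        refine (h.conv.norm_apply_le _ _).trans ?_
        gcongr
        exact h1.trans (by gcongr)
    _ = 72 * diffConst δ L * (a ^ 2 * ρ) := by ring
    _ ≤ _ := by
        gcongr
        exact (errConst_parts hδ hp.symbol.lip_nonneg).2.1

theorem conv_lift_second_bound (h : SmallWave m κ c ε a v W) (hε : ε ≤ δ / 16) {μ : ℂ} {ξ ρ : ℝ}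
    (hp : Perturbative m κ δ L s q c W μ ξ) (hμ : ‖μ‖ ≤ ρ) (hξ : |ξ| ≤ ρ) (k : Fin 3) (n : ℤ) :
    ‖W (liftOp m κ c W μ ξ (lowVec k)) n + W (liftOp m κ c W (-μ) (-ξ) (lowVec k)) n
      - 2 * W (liftOp m κ c W 0 0 (lowVec k)) n‖ ≤ errConst δ L * (a ^ 2 * ρ ^ 2) := by
  have hδ := hp.symbol.gap_pos
  have hL := hp.symbol.lip_nonneg
  have ha := h.pos
  have hK : 0 ≤ 4 * secondConst δ L + 8 * oppConst δ L * diffConst δ L := by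
    have h1 : 0 ≤ diffConst δ L := by unfold diffConst; positivity
    have h2 : 0 ≤ oppConst δ L := by unfold oppConst; positivity
    have h3 : 0 ≤ secondConst δ L := by unfold secondConst; positivity
    positivity
  have h1 := hp.norm_lift_second_le hμ hξ (isLow_lowVec k)
  have h2 := h.conv_lowVec_le hp.symbol hε k
  have h3 := h.norm_bound hp.symbol hε
  rw [← smul_apply, ← add_apply, ← sub_apply, ← map_add, ← map_smul, ← map_sub]
  calc _ ≤ 3 * a * ((4 * secondConst δ L + 8 * oppConst δ L * diffConst δ L) * ρ ^ 2
          * (6 * a)) := by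
        refine (h.conv.norm_apply_le _ _).trans ?_
        gcongr
        exact h1.trans (by gcongr)
    _ = 18 * (4 * secondConst δ L + 8 * oppConst δ L * diffConst δ L) * (a ^ 2 * ρ ^ 2) := by ring
    _ ≤ _ := by
        gcongr
        exact (errConst_parts hδ hL).2.2.1

theorem conv_lift_zero_bound (h : SmallWave m κ c ε a v W) (hm : RegularSymbol m κ δ L s q)
    (hε : ε ≤ δ / 16) (k : Fin 3) (n : ℤ) :
    ‖W (liftOp m κ c W 0 0 (lowVec k)) n - W (lowVec k) n‖ ≤ errConst δ L * a ^ 2 := by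
  have hp := h.perturbative_zero hm hε
  have hδ := hm.gap_pos
  have ha := h.pos
  have h2 := h.conv_lowVec_le hm hε k
  have h3 := h.norm_bound hm hε
  have h4 := hp.norm_conv_lift_zero_le (lowVec k)
  have h5 := hp.norm_highOp_zero_apply_le (liftOp m κ c W 0 0 (lowVec k))
  rw [← sub_apply, ← map_sub, sub_eq_iff_eq_add'.2 (hp.liftOp_eq (lowVec k))]
  calc _ ≤ 3 * a * (2 / δ * 2 * (2 * (6 * a))) := by
        refine (h.conv.norm_apply_le _ _).trans ?_
        gcongr
        refine h5.trans ?_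
        gcongr
        exact h4.trans (by gcongr)
    _ = 144 / δ * a ^ 2 := by ring
    _ ≤ _ := by
        gcongr
        exact (errConst_parts hδ hm.lip_nonneg).2.2.2.1

theorem conv_lowVec_one_apply (h : SmallWave m κ c ε a v W) :
    W (lowVec 1) 1 = a ∧ W (lowVec 1) 0 = 0 ∧ W (lowVec 1) (-1) = a := by
  have e : ∀ n, W (lowVec 1) n = v n := fun n => by
    have := h.conv.apply_unitSeq_apply 0 n
    rwa [sub_zero] at this
  rw [e, e, e, h.even 1]
  exact ⟨h.amplitude, h.mean, h.amplitude⟩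

theorem conv_lowVec_two_apply_zero (h : SmallWave m κ c ε a v W) : W (lowVec 2) 0 = 2 * a := by
  have e : W (lowVec 2) 0 = W (unitSeq 1) 0 + W (unitSeq (-1)) 0 := by
    rw [← add_apply, ← map_add]; rfl
  rw [e, h.conv.apply_unitSeq_apply, h.conv.apply_unitSeq_apply, zero_sub, zero_sub, neg_neg,
    h.even, h.amplitude]
  ring

/-- Parity of the lifts at the origin. -/
theorem conv_lift_parity (h : SmallWave m κ c ε a v W) (hm : RegularSymbol m κ δ L s q)
    (hε : ε ≤ δ / 16) :
    W (liftOp m κ c W 0 0 (lowVec 0)) (-1) = -W (liftOp m κ c W 0 0 (lowVec 0)) 1 ∧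
    W (liftOp m κ c W 0 0 (lowVec 0)) 0 = 0 ∧
    W (liftOp m κ c W 0 0 (lowVec 1)) (-1) = W (liftOp m κ c W 0 0 (lowVec 1)) 1 ∧
    W (liftOp m κ c W 0 0 (lowVec 2)) (-1) = W (liftOp m κ c W 0 0 (lowVec 2)) 1 := by
  have hp := h.perturbative_zero hm hε
  have key : ∀ x n, W (liftOp m κ c W 0 0 x) (-n) = W (liftOp m κ c W 0 0 (reflect x)) n := by
    intro x n
    have := h.conv_lift_neg_apply hp x n
    rwa [neg_zero, neg_zero] at this
  have e0 : ∀ n, W (liftOp m κ c W 0 0 (lowVec 0)) (-n)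
      = -W (liftOp m κ c W 0 0 (lowVec 0)) n := by
    intro n
    rw [key, reflect_lowVec_zero, map_neg, map_neg]
    rfl
  refine ⟨e0 1, ?_, ?_, ?_⟩
  · have := e0 0
    rw [neg_zero] at this
    exact self_eq_neg.1 this
  · rw [key, reflect_lowVec_one]
  · rw [key, reflect_lowVec_two]

end SmallWave

set_option maxHeartbeats 1000000 in
/-- The reduced matrix of a small wave is close to the leading-order model. -/
theorem RegularSymbol.exists_nearModel {m : ℝ → ℝ} {κ δ L s q : ℝ}
    (hm : RegularSymbol m κ δ L s q) {η : ℝ} (hη : 0 < η) :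
    ∃ ε > 0, ∀ (c a : ℝ) (v : EllTwo) (W : EllTwo →L[ℂ] EllTwo), SmallWave m κ c ε a v W →
      a ≤ η ∧ ∃ ρ₀ > 0, ∀ (μ : ℂ) (ξ ρ : ℝ), ρ ≤ ρ₀ → |ξ| ≤ ρ → ‖μ‖ ≤ ρ →
        Perturbative m κ δ L s q c W μ ξ ∧
        NearModel s q (m κ - m 0) (m κ - m (κ * 2))⁻¹ η a ρ μ ξ (reducedMatrix m κ c W μ ξ) := by
  have hδ := hm.gap_pos
  have hL := hm.lip_nonneg
  obtain ⟨hC1, -, -, -, hC5⟩ := SmallWave.errConst_parts hδ hL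
  set C := SmallWave.errConst δ L with hC
  have hC0 : 0 < C := by linarith
  -- This choice turns every error of size C·a or C·ε into at most η/16, and depends neither on the
  -- wave nor on a.
  refine ⟨min (δ / 16) (min 1 (η / (16 * C))), by positivity, fun c a v W h => ?_⟩
  set ε := min (δ / 16) (min 1 (η / (16 * C))) with hεdef
  have hε1 : ε ≤ δ / 16 := min_le_left _ _
  have hε2 : ε ≤ 1 := (min_le_right _ _).trans (min_le_left _ _)
  have hε3 : C * ε ≤ η / 16 := by
    have : ε ≤ η / (16 * C) := (min_le_right _ _).trans (min_le_right _ _)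
    calc C * ε ≤ C * (η / (16 * C)) := by gcongr
      _ = η / 16 := by field_simp
  have ha := h.pos
  have hae := h.amplitude_le
  have hε0 : 0 < ε := ha.trans_le hae
  have ha1 : a ≤ 1 := hae.trans hε2
  have hCa : C * a ≤ η / 16 := le_trans (by gcongr) hε3
  refine ⟨by nlinarith, ?_⟩
  -- The accuracy is taken proportional to a, because the odd-even entries must be known up to
  -- η·a·ρ. This is allowed since ρ may depend on the wave.
  obtain ⟨ρ₁, hρ₁, hsym⟩ := hm.dividedSymbol_asymptotics (η := η * a / 4) (by positivity)
  obtain ⟨r, hr, hcont⟩ : ∃ r > 0, ∀ ξ : ℝ, |ξ| ≤ r → |m (κ * ξ) - m 0| ≤ η / 4 := by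
    have h1 : ContinuousAt (fun ξ => m (κ * ξ)) 0 := by
      refine ContinuousAt.comp (f := fun ξ => κ * ξ) ?_ (by fun_prop)
      simpa using hm.continuousAt_zero
    obtain ⟨r, hr, h2⟩ := Metric.continuousAt_iff.1 h1 (η / 4) (by positivity)
    refine ⟨r / 2, by positivity, fun ξ hξ => ?_⟩
    have := h2 (x := ξ) (by rw [Real.dist_eq, sub_zero]; linarith)
    rw [Real.dist_eq, mul_zero] at this
    exact this.le
  have hpar := h.conv_lift_parity hm hε1
  obtain ⟨p1, p2, p3, p4⟩ := hpar
  have hodd := h.conv_lift_odd_apply hm hε1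
  have hcoup := h.coupling_asymptotics hm hε1
  have hbase := h.conv_lift_zero_bound hm hε1
  obtain ⟨v11, v10, v1m⟩ := h.conv_lowVec_one_apply
  have v20 := h.conv_lowVec_two_apply_zero
  obtain ⟨⟨l01, l00, l0m⟩, ⟨l11, l10, l1m⟩, ⟨l21, l20, l2m⟩⟩ := lowVec_apply_values
  have ha2 : C * a ^ 2 ≤ η / 16 * a := by
    rw [sq, ← mul_assoc]; gcongr
  -- The last bound makes ρ small compared with a²: otherwise μξ and qξ² would compete with the a²
  -- term in the even-even entry.
  refine ⟨min (min (min ρ₁ r) (min ε (1 / 2))) (min (min (δ / 8) (δ / (4 * (L + 1))))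
    (a ^ 2 * η / (8 * (1 + |q| + η)))), by positivity, fun μ ξ ρ hρ hξ hμ => ?_⟩
  simp only [le_min_iff] at hρ
  obtain ⟨⟨⟨hρ1, hρ2⟩, hρ3, hρ4⟩, ⟨hρ5, hρ6⟩, hρ7⟩ := hρ
  have hρ0 : 0 ≤ ρ := (abs_nonneg _).trans hξ
  have hLξ : L * |ξ| ≤ δ / 4 := by
    rw [le_div_iff₀ (by positivity)] at hρ6
    nlinarith
  have hp : Perturbative m κ δ L s q c W μ ξ :=
    h.perturbative hm hε1 (hξ.trans hρ4) hLξ (hμ.trans hρ5)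
  refine ⟨hp, ?_⟩
  obtain ⟨s1, s2⟩ := hsym c μ ξ ρ hρ1 hξ hμ
  have hΔ := h.conv_lift_sub_bound hε1 hp hμ hξ
  have hΔ2 := h.conv_lift_second_bound hε1 hp hμ hξ 0 1
  obtain ⟨r00, r10, r20⟩ := hp.reducedMatrix_entries 0
  obtain ⟨r01, r11, r21⟩ := hp.reducedMatrix_entries 1
  obtain ⟨r02, r12, r22⟩ := hp.reducedMatrix_entries 2
  rw [l01, l0m] at r00 r20
  rw [l00] at r10
  rw [l11, l1m] at r01 r21
  rw [l10] at r11
  rw [l21, l2m] at r02 r22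
  rw [l20] at r12
  have hnξ : ‖(ξ : ℂ)‖ ≤ ρ := by rwa [Complex.norm_real, Real.norm_eq_abs]
  have herr : C * (a ^ 2 * ρ) ≤ η / 16 * (a * ρ) := by
    calc C * (a ^ 2 * ρ) = C * a ^ 2 * ρ := by ring
      _ ≤ η / 16 * a * ρ := by gcongr
      _ = _ := by ring
  have hηaρ : η * (a * ρ) ≤ η * ρ := by
    have : a * ρ ≤ 1 * ρ := by gcongr
    rw [one_mul] at this
    gcongr
  have hηaρ0 : 0 ≤ η * (a * ρ) := by positivity
  have sub4 : ∀ x y z w : ℂ, ‖x - z‖ ≤ C * (a ^ 2 * ρ) → ‖y - w‖ ≤ C * (a ^ 2 * ρ) →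
      ‖(x - z) - (y - w)‖ ≤ η / 8 * (a * ρ) ∧ ‖(x - z) + (y - w)‖ ≤ η / 8 * (a * ρ) := by
    intro x y z w h1 h2
    have e1 := norm_sub_le (x - z) (y - w)
    have e2 := norm_add_le (x - z) (y - w)
    constructor <;> linarith
  constructor
  · -- odd-odd entry
    have e1 : W (liftOp m κ c W μ ξ (lowVec 0)) (-1)
        = -W (liftOp m κ c W (-μ) (-ξ) (lowVec 0)) 1 := by
      rw [h.conv_lift_neg_apply hp, SmallWave.reflect_lowVec_zero, map_neg, map_neg]
      rfl
    -- Reflection reverses (μ, ξ), so the convolution terms form a second difference of order a²ρ².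
    -- The zeroth-order term c - m(κ) cancels because w' solves the linearized equation.
    have e : reducedMatrix m κ c W μ ξ 0 0 - 2 * (μ * ξ - q * ξ ^ 2)
        = (dividedSymbol m κ c μ ξ 1 + dividedSymbol m κ c μ ξ (-1)
          - 2 * ((c - m κ : ℝ) : ℂ) - 2 * (μ * ξ - q * ξ ^ 2))
        - 2 * (W (liftOp m κ c W μ ξ (lowVec 0)) 1
          + W (liftOp m κ c W (-μ) (-ξ) (lowVec 0)) 1
          - 2 * W (liftOp m κ c W 0 0 (lowVec 0)) 1) := by
      rw [r00, e1, ← hodd]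
      ring
    rw [e]
    refine (norm_sub_le _ _).trans ?_
    rw [norm_mul, Complex.norm_ofNat]
    have f1 : η * a / 4 * ρ ^ 2 ≤ η / 4 * ρ ^ 2 := by
      have : η * a ≤ η * 1 := by gcongr
      rw [mul_one] at this
      gcongr
    have f2 : C * (a ^ 2 * ρ ^ 2) ≤ η / 16 * ρ ^ 2 := by
      have : C * a ^ 2 ≤ η / 16 * 1 := ha2.trans (by gcongr)
      rw [mul_one] at this
      calc _ = C * a ^ 2 * ρ ^ 2 := by ring
        _ ≤ _ := by gcongr
    have f3 : 0 ≤ η * ρ ^ 2 := by positivity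
    linarith
  · -- odd-constant entry
    have e : reducedMatrix m κ c W μ ξ 0 1
        = -(2 * ((W (liftOp m κ c W μ ξ (lowVec 1)) 1 - W (liftOp m κ c W 0 0 (lowVec 1)) 1)
          - (W (liftOp m κ c W μ ξ (lowVec 1)) (-1)
            - W (liftOp m κ c W 0 0 (lowVec 1)) (-1)))) := by
      rw [r01, p3]
      ring
    rw [e, norm_neg, norm_mul, Complex.norm_ofNat]
    have := (sub4 _ _ _ _ (hΔ 1 1) (hΔ 1 (-1))).1
    linarith
  · -- odd-even entry
    have e : reducedMatrix m κ c W μ ξ 0 2 + 2 * (μ + s * ξ)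
        = (dividedSymbol m κ c μ ξ 1 - dividedSymbol m κ c μ ξ (-1) + 2 * (μ + s * ξ))
        - 2 * ((W (liftOp m κ c W μ ξ (lowVec 2)) 1 - W (liftOp m κ c W 0 0 (lowVec 2)) 1)
          - (W (liftOp m κ c W μ ξ (lowVec 2)) (-1)
            - W (liftOp m κ c W 0 0 (lowVec 2)) (-1))) := by
      rw [r02, p4]
      ring
    rw [e]
    refine (norm_sub_le _ _).trans ?_
    rw [norm_mul, Complex.norm_ofNat]
    have := (sub4 _ _ _ _ (hΔ 2 1) (hΔ 2 (-1))).1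
    linarith
  · -- constant-odd entry
    -- The value at the origin vanishes by parity; together with the prefactor ξ this makes the
    -- entry second order.
    have e : reducedMatrix m κ c W μ ξ 1 0
        = -(2 * ξ * (W (liftOp m κ c W μ ξ (lowVec 0)) 0
          - W (liftOp m κ c W 0 0 (lowVec 0)) 0)) := by
      rw [r10, p2]
      ring
    rw [e, norm_neg, norm_mul, norm_mul, Complex.norm_ofNat]
    have f1 := (hΔ 0 0).trans herr
    calc _ ≤ 2 * ρ * (η / 16 * (a * ρ)) := by gcongr
      _ = η / 8 * ρ ^ 2 * a := by ring
      _ ≤ η / 8 * ρ ^ 2 * 1 := by gcongr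
      _ ≤ η * ρ ^ 2 := by linarith [show 0 ≤ η * ρ ^ 2 by positivity]
  · -- constant-constant entry
    have e : reducedMatrix m κ c W μ ξ 1 1 - (((m κ - m 0 : ℝ) : ℂ) * ξ - μ)
        = ξ * (((c - m κ : ℝ) : ℂ) - ((m (κ * ξ) - m 0 : ℝ) : ℂ))
          - 2 * ξ * ((W (liftOp m κ c W μ ξ (lowVec 1)) 0 - W (liftOp m κ c W 0 0 (lowVec 1)) 0)
            + (W (liftOp m κ c W 0 0 (lowVec 1)) 0 - W (lowVec 1) 0)) := by
      rw [r11, v10]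
      push_cast
      ring
    rw [e]
    have f1 := (hΔ 1 0).trans herr
    have f2 := (hbase 1 0).trans ha2
    have f3 := hcont ξ (hξ.trans hρ2)
    have f4 : ε ≤ η / 16 := (le_mul_of_one_le_left hε0.le hC1).trans hε3
    have f5 := h.speed.trans f4
    have f6 : η / 16 * (a * ρ) ≤ η / 16 := by
      have : a * ρ ≤ 1 := mul_le_one₀ ha1 hρ0 (by linarith)
      exact mul_le_of_le_one_right (by positivity) this
    have f7 : η / 16 * a ≤ η / 16 := mul_le_of_le_one_right (by positivity) ha1
    calc _ ≤ ρ * (η / 16 + η / 4) + 2 * ρ * (η / 16 + η / 16) := by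
          refine (norm_sub_le _ _).trans (add_le_add ?_ ?_)
          · rw [norm_mul]
            gcongr
            refine (norm_sub_le _ _).trans (add_le_add ?_ ?_)
            · rwa [Complex.norm_real, Real.norm_eq_abs]
            · rwa [Complex.norm_real, Real.norm_eq_abs]
          · rw [norm_mul, norm_mul, Complex.norm_ofNat]
            gcongr
            exact (norm_add_le _ _).trans (add_le_add (f1.trans f6) (f2.trans f7))
      _ ≤ η * ρ := by
          have : 0 ≤ η * ρ := by positivity
          linarith
  · -- constant-even entry
    have e : reducedMatrix m κ c W μ ξ 1 2 + 4 * a * ξ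
        = -(2 * ξ * ((W (liftOp m κ c W μ ξ (lowVec 2)) 0 - W (liftOp m κ c W 0 0 (lowVec 2)) 0)
            + (W (liftOp m κ c W 0 0 (lowVec 2)) 0 - W (lowVec 2) 0))) := by
      rw [r12, v20]
      ring
    rw [e, norm_neg, norm_mul, norm_mul, Complex.norm_ofNat]
    have f1 := (hΔ 2 0).trans herr
    have f2 := (hbase 2 0).trans ha2
    have f3 : η / 16 * (a * ρ) ≤ η / 16 * a := by
      have : a * ρ ≤ a := mul_le_of_le_one_right ha.le (by linarith)
      gcongr
    calc _ ≤ 2 * ρ * (η / 16 * a + η / 16 * a) := by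
          gcongr
          exact (norm_add_le _ _).trans (add_le_add (f1.trans f3) f2)
      _ ≤ η * (a * ρ) := by linarith
  · -- even-odd entry
    have e : reducedMatrix m κ c W μ ξ 2 0 + 2 * (μ + s * ξ)
        = (dividedSymbol m κ c μ ξ 1 - dividedSymbol m κ c μ ξ (-1) + 2 * (μ + s * ξ))
        - 2 * ((W (liftOp m κ c W μ ξ (lowVec 0)) 1 - W (liftOp m κ c W 0 0 (lowVec 0)) 1)
          + (W (liftOp m κ c W μ ξ (lowVec 0)) (-1)
            - W (liftOp m κ c W 0 0 (lowVec 0)) (-1))) := by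
      rw [r20, p1]
      ring
    rw [e]
    refine (norm_sub_le _ _).trans ?_
    rw [norm_mul, Complex.norm_ofNat]
    have := (sub4 _ _ _ _ (hΔ 0 1) (hΔ 0 (-1))).2
    linarith
  · -- even-constant entry
    have e : reducedMatrix m κ c W μ ξ 2 1 + 4 * a
        = -(2 * (((W (liftOp m κ c W μ ξ (lowVec 1)) 1 - W (liftOp m κ c W 0 0 (lowVec 1)) 1)
          + (W (liftOp m κ c W μ ξ (lowVec 1)) (-1) - W (liftOp m κ c W 0 0 (lowVec 1)) (-1)))
          + ((W (liftOp m κ c W 0 0 (lowVec 1)) 1 - W (lowVec 1) 1)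
            + (W (liftOp m κ c W 0 0 (lowVec 1)) (-1) - W (lowVec 1) (-1))))) := by
      rw [r21, v11, v1m]
      ring
    rw [e, norm_neg, norm_mul, Complex.norm_ofNat]
    have f1 := (sub4 _ _ _ _ (hΔ 1 1) (hΔ 1 (-1))).2
    have f2 := (hbase 1 1).trans ha2
    have f3 := (hbase 1 (-1)).trans ha2
    have f4 : η / 8 * (a * ρ) ≤ η / 8 * a := by
      have : a * ρ ≤ a := mul_le_of_le_one_right ha.le (by linarith)
      gcongr
    calc _ ≤ 2 * (η / 8 * a + (η / 16 * a + η / 16 * a)) := by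
          gcongr
          exact (norm_add_le _ _).trans (add_le_add (f1.trans f4)
            ((norm_add_le _ _).trans (add_le_add f2 f3)))
      _ ≤ η * a := by
          have : 0 ≤ η * a := by positivity
          linarith
  · -- even-even entry
    -- Even and odd vectors differ by twice the mode -1. Subtracting the identity for the odd vector
    -- therefore removes c - m(κ) and leaves only the coupling from -1 to 1, so the speed never has
    -- to be expanded in a.
    have e0 : W (liftOp m κ c W 0 0 (lowVec 0)) 1 - W (liftOp m κ c W 0 0 (lowVec 2)) 1
        = -(2 * W (liftOp m κ c W 0 0 (unitSeq (-1))) 1) := by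
      have e1 : lowVec 0 - lowVec 2 = -((2 : ℂ) • unitSeq (-1)) := by
        show (unitSeq 1 - unitSeq (-1)) - (unitSeq 1 + unitSeq (-1)) = _
        rw [two_smul]; abel
      rw [← sub_apply, ← map_sub, ← map_sub, e1, map_neg, map_neg, map_smul, map_smul]
      rfl
    have e : reducedMatrix m κ c W μ ξ 2 2 + 8 * (((m κ - m (κ * 2))⁻¹ : ℝ) : ℂ) * a ^ 2
        = (dividedSymbol m κ c μ ξ 1 + dividedSymbol m κ c μ ξ (-1)
          - 2 * ((c - m κ : ℝ) : ℂ) - 2 * (μ * ξ - q * ξ ^ 2))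
        + 2 * (μ * ξ - q * ξ ^ 2)
        - 2 * ((W (liftOp m κ c W μ ξ (lowVec 2)) 1 - W (liftOp m κ c W 0 0 (lowVec 2)) 1)
          + (W (liftOp m κ c W μ ξ (lowVec 2)) (-1) - W (liftOp m κ c W 0 0 (lowVec 2)) (-1)))
        - 8 * (W (liftOp m κ c W 0 0 (unitSeq (-1))) 1
          - ((a ^ 2 * (m κ - m (κ * 2))⁻¹ : ℝ) : ℂ)) := by
      rw [r22, p4, ← hodd]
      push_cast
      linear_combination 4 * e0
    rw [e]
    have f1 := (sub4 _ _ _ _ (hΔ 2 1) (hΔ 2 (-1))).2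
    have f2 : ‖2 * (μ * ξ - q * (ξ : ℂ) ^ 2)‖ ≤ 2 * (ρ * ρ + |q| * ρ ^ 2) := by
      rw [norm_mul, Complex.norm_ofNat]
      gcongr
      refine (norm_sub_le _ _).trans (add_le_add ?_ ?_)
      · rw [norm_mul]; gcongr
      · rw [norm_mul, norm_pow, Complex.norm_real, Real.norm_eq_abs]; gcongr
    have f3 : (1 + |q| + η) * ρ ≤ a ^ 2 * η / 8 := by
      have h0 : 0 < 1 + |q| + η := by positivity
      rw [le_div_iff₀ (by positivity)] at hρ7
      linarith
    have f4 : (1 + |q| + η) * ρ ^ 2 ≤ a ^ 2 * η / 8 := by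
      have h0 : 0 ≤ 1 + |q| + η := by positivity
      have : ρ ^ 2 ≤ ρ := pow_le_of_le_one hρ0 (by linarith) two_ne_zero
      exact le_trans (by gcongr) f3
    have f5 : C * (a ^ 2 * ε) ≤ η / 16 * a ^ 2 := by
      calc _ = C * ε * a ^ 2 := by ring
        _ ≤ _ := by gcongr
    have f6 : 8 * (700 / δ ^ 2 * (a ^ 2 * ε)) ≤ C * (a ^ 2 * ε) := by
      rw [← mul_assoc]
      gcongr
    have f7 : C * (a ^ 2 * ρ) ≤ C * (a ^ 2 * ε) := by gcongr
    have f8 : η * a / 4 * ρ ^ 2 ≤ η * ρ ^ 2 := by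
      have : η * a ≤ η := mul_le_of_le_one_right hη.le ha1
      have : η * a / 4 ≤ η := by linarith
      gcongr
    have g1 := norm_add_le (W (liftOp m κ c W μ ξ (lowVec 2)) 1
      - W (liftOp m κ c W 0 0 (lowVec 2)) 1) (W (liftOp m κ c W μ ξ (lowVec 2)) (-1)
        - W (liftOp m κ c W 0 0 (lowVec 2)) (-1))
    have g2 := hΔ 2 1
    have g3 := hΔ 2 (-1)
    refine (norm_sub_le _ _).trans ?_
    refine (add_le_add ((norm_sub_le _ _).trans (add_le_add (norm_add_le _ _) le_rfl))
      le_rfl).trans ?_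
    rw [norm_mul 2 (_ + _), norm_mul 8, Complex.norm_ofNat, Complex.norm_ofNat]
    have hρρ : ρ * ρ = ρ ^ 2 := by ring
    have g4 : 0 ≤ η * a ^ 2 := by positivity
    have g5 : 0 ≤ ρ ^ 2 := by positivity
    have g6 : 0 ≤ |q| * ρ ^ 2 := by positivity
    have g7 : 0 ≤ η * ρ ^ 2 := by positivity
    linarith

end

end Whitham

namespace Whitham

noncomputable section

open EllTwo

/-! ### Perturbation of determinants -/

theorem norm_mul_three_sub_le {a b c a' b' c' : ℂ} {C η : ℝ} (ha : ‖a‖ ≤ C) (hb : ‖b‖ ≤ C)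
    (hb' : ‖b'‖ ≤ C) (hc' : ‖c'‖ ≤ C)
    (hda : ‖a - a'‖ ≤ η) (hdb : ‖b - b'‖ ≤ η) (hdc : ‖c - c'‖ ≤ η) :
    ‖a * b * c - a' * b' * c'‖ ≤ 3 * C ^ 2 * η := by
  have hC : 0 ≤ C := (norm_nonneg _).trans ha
  have h0 : 0 ≤ η := (norm_nonneg _).trans hda
  have e : a * b * c - a' * b' * c'
    = a * b * (c - c') + a * (b - b') * c' + (a - a') * b' * c' := by ring
  rw [e]
  calc _ ≤ ‖a * b * (c - c')‖ + ‖a * (b - b') * c'‖ + ‖(a - a') * b' * c'‖ := norm_add₃_le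
    _ = ‖a‖ * ‖b‖ * ‖c - c'‖ + ‖a‖ * ‖b - b'‖ * ‖c'‖ + ‖a - a'‖ * ‖b'‖ * ‖c'‖ := by
        simp only [norm_mul]
    _ ≤ C * C * η + C * η * C + η * C * C := by gcongr
    _ = 3 * C ^ 2 * η := by ring

theorem norm_det_sub_le {A B : Matrix (Fin 3) (Fin 3) ℂ} {C η : ℝ}
    (hA : ∀ i j, ‖A i j‖ ≤ C) (hB : ∀ i j, ‖B i j‖ ≤ C) (h : ∀ i j, ‖A i j - B i j‖ ≤ η) :
    ‖A.det - B.det‖ ≤ 18 * C ^ 2 * η := by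
  have key : ∀ i j i' j' i'' j'', ‖A i j * A i' j' * A i'' j'' - B i j * B i' j' * B i'' j''‖
      ≤ 3 * C ^ 2 * η := fun i j i' j' i'' j'' =>
    norm_mul_three_sub_le (hA _ _) (hA _ _) (hB _ _) (hB _ _) (h _ _) (h _ _) (h _ _)
  rw [Matrix.det_fin_three, Matrix.det_fin_three]
  have e : ∀ x₁ x₂ x₃ x₄ x₅ x₆ y₁ y₂ y₃ y₄ y₅ y₆ : ℂ,
      x₁ - x₂ - x₃ + x₄ + x₅ - x₆ - (y₁ - y₂ - y₃ + y₄ + y₅ - y₆)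
      = (x₁ - y₁) - (x₂ - y₂) - (x₃ - y₃) + (x₄ - y₄) + (x₅ - y₅) - (x₆ - y₆) := by
    intros; ring
  rw [e]
  refine (norm_sub_le_of_le (norm_add_le_of_le (norm_add_le_of_le (norm_sub_le_of_le
    (norm_sub_le_of_le (key _ _ _ _ _ _) (key _ _ _ _ _ _)) (key _ _ _ _ _ _))
    (key _ _ _ _ _ _)) (key _ _ _ _ _ _)) (key _ _ _ _ _ _)).trans (le_of_eq ?_)
  ring

theorem norm_div_sub_le {b w x : ℂ} {η p C : ℝ} (hw : w ≠ 0) (h : ‖b - w * x‖ ≤ η * p)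
    (hp : p ≤ C * ‖w‖) (hη : 0 ≤ η) : ‖b / w - x‖ ≤ C * η := by
  have h0 : 0 < ‖w‖ := norm_pos_iff.mpr hw
  rw [show b / w - x = (b - w * x) / w by field_simp, norm_div, div_le_iff₀ h0]
  calc _ ≤ η * p := h
    _ ≤ η * (C * ‖w‖) := by gcongr
    _ = C * η * ‖w‖ := by ring

/-- The determinant of the rescaled model matrix. -/
def modelDet (q ν₀ σ : ℝ) (α β : ℂ) (θ : ℝ) (u : ℂ) : ℂ :=
  2 * (α * β - q * β ^ 2) * (-8 * σ * θ ^ 2 * (ν₀ * β - α) - 16 * θ ^ 2 * β)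
    - 4 * u ^ 2 * (ν₀ * β - α)

def modelMatrix (q ν₀ σ : ℝ) (α β : ℂ) (θ : ℝ) (u : ℂ) : Matrix (Fin 3) (Fin 3) ℂ :=
  !![2 * (α * β - q * β ^ 2), 0, -2 * u;
    0, ν₀ * β - α, -4 * θ * β;
    -2 * u, -4 * θ, -8 * σ * θ ^ 2]

theorem det_modelMatrix (q ν₀ σ : ℝ) (α β : ℂ) (θ : ℝ) (u : ℂ) :
    (modelMatrix q ν₀ σ α β θ u).det = modelDet q ν₀ σ α β θ u := by
  simp [modelMatrix, modelDet, Matrix.det_fin_three]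
  ring

theorem norm_modelMatrix_le {q ν₀ σ R U : ℝ} {α β : ℂ} {θ : ℝ} {u : ℂ} (hα : ‖α‖ ≤ R)
    (hβ : ‖β‖ ≤ R) (hθ : 0 ≤ θ) (hθ1 : θ ≤ 1) (hu : ‖u‖ ≤ U) (i j : Fin 3) :
    ‖modelMatrix q ν₀ σ α β θ u i j‖
      ≤ 2 * (R * R + |q| * R ^ 2) + 2 * U + (|ν₀| * R + R) + 4 * R + 4 + 8 * |σ| := by
  have hR : 0 ≤ R := (norm_nonneg _).trans hα
  have hU : 0 ≤ U := (norm_nonneg _).trans hu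
  have p1 : 0 ≤ |q| * R ^ 2 := by positivity
  have p2 : 0 ≤ R * R := by positivity
  have p3 : 0 ≤ |ν₀| * R := by positivity
  have p4 : 0 ≤ |σ| := abs_nonneg σ
  have b1 : ‖2 * (α * β - q * β ^ 2)‖ ≤ 2 * (R * R + |q| * R ^ 2) := by
    rw [norm_mul, Complex.norm_ofNat]
    gcongr
    refine norm_sub_le_of_le ?_ ?_
    · rw [norm_mul]; gcongr
    · rw [norm_mul, norm_pow, Complex.norm_real, Real.norm_eq_abs]; gcongr
  have b2 : ‖-2 * u‖ ≤ 2 * U := by rw [norm_mul, norm_neg, Complex.norm_ofNat]; gcongr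
  have b3 : ‖ν₀ * β - α‖ ≤ |ν₀| * R + R := by
    refine norm_sub_le_of_le ?_ hα
    rw [norm_mul, Complex.norm_real, Real.norm_eq_abs]; gcongr
  have b4 : ‖-4 * θ * β‖ ≤ 4 * R := by
    rw [norm_mul, norm_mul, norm_neg, Complex.norm_ofNat, Complex.norm_real, Real.norm_eq_abs,
      abs_of_nonneg hθ]
    calc 4 * θ * ‖β‖ ≤ 4 * 1 * R := by gcongr
      _ = 4 * R := by ring
  have b5 : ‖-4 * (θ : ℂ)‖ ≤ 4 := by
    rw [norm_mul, norm_neg, Complex.norm_ofNat, Complex.norm_real, Real.norm_eq_abs,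
      abs_of_nonneg hθ]
    linarith
  have b6 : ‖-8 * (σ : ℂ) * θ ^ 2‖ ≤ 8 * |σ| := by
    rw [norm_mul, norm_mul, norm_neg, Complex.norm_ofNat, norm_pow, Complex.norm_real,
      Complex.norm_real, Real.norm_eq_abs, Real.norm_eq_abs, abs_of_nonneg hθ]
    calc 8 * |σ| * θ ^ 2 ≤ 8 * |σ| * 1 := by gcongr; nlinarith
      _ = 8 * |σ| := by ring
  fin_cases i <;> fin_cases j <;> simp only [modelMatrix, Matrix.of_apply, Matrix.cons_val',
    Matrix.cons_val, Fin.zero_eta, Fin.mk_one, Fin.reduceFinMk, norm_zero] <;> linarith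

namespace NearModel

variable {s q ν₀ σ η a ρ : ℝ} {μ : ℂ} {ξ : ℝ} {B : Matrix (Fin 3) (Fin 3) ℂ}

/-- The determinant of the reduced matrix, after scaling the rows by `Z, Z, h` and the columns by
`Z, 1, h`, is close to the model determinant. -/
theorem norm_det_sub_le {R U h : ℝ} {Z α β : ℂ} (H : NearModel s q ν₀ σ η a ρ μ ξ B) (hη : 0 ≤ η)
    (hR : 1 ≤ R) (hηR : R ^ 2 * η ≤ 1) (hZ : Z ≠ 0) (hμ : μ = α * Z) (hξ : (ξ : ℂ) = β * Z)
    (hα : ‖α‖ ≤ R) (hβ : ‖β‖ ≤ R) (hρ0 : 0 ≤ ρ) (hρ : ρ ≤ R * ‖Z‖) (ha : 0 < a) (hah : a ≤ h)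
    (hu : ‖α + s * β‖ ≤ U * h) :
    ‖B.det - Z ^ 3 * h ^ 2 * modelDet q ν₀ σ α β (a / h) ((α + s * β) / h)‖
      ≤ 18 * (2 * (R * R + |q| * R ^ 2) + 2 * U + (|ν₀| * R + R) + 4 * R + 4 + 8 * |σ| + 1) ^ 2
        * (R ^ 2 * η) * (‖Z‖ ^ 3 * h ^ 2) := by
  have hh : 0 < h := ha.trans_le hah
  have hhC : (h : ℂ) ≠ 0 := by exact_mod_cast hh.ne'
  have hnh : ‖(h : ℂ)‖ = h := by rw [Complex.norm_real, Real.norm_eq_abs, abs_of_pos hh]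
  have hz0 : 0 < ‖Z‖ := norm_pos_iff.mpr hZ
  have hR2 : R ≤ R ^ 2 := by nlinarith
  have hR21 : 1 ≤ R ^ 2 := hR.trans hR2
  have hθ : 0 ≤ a / h := by positivity
  have hθ1 : a / h ≤ 1 := (div_le_one hh).mpr hah
  have hu' : ‖(α + s * β) / h‖ ≤ U := by rw [norm_div, hnh, div_le_iff₀ hh]; exact hu
  set M := modelMatrix q ν₀ σ α β (a / h) ((α + s * β) / h) with hM
  set C := 2 * (R * R + |q| * R ^ 2) + 2 * U + (|ν₀| * R + R) + 4 * R + 4 + 8 * |σ| with hC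
  have hMC : ∀ i j, ‖M i j‖ ≤ C := norm_modelMatrix_le hα hβ hθ hθ1 hu'
  let r : Fin 3 → ℂ := ![Z, Z, h]
  let t : Fin 3 → ℂ := ![Z, 1, h]
  let A : Matrix (Fin 3) (Fin 3) ℂ := Matrix.of fun i j => B i j / (r i * t j)
  have hdet : B.det = Z ^ 3 * h ^ 2 * A.det := by
    simp only [Matrix.det_fin_three, A, r, t, Matrix.of_apply, Matrix.cons_val]
    field_simp
  have hρ2 : ρ ^ 2 ≤ R ^ 2 * ‖Z‖ ^ 2 := by
    rw [← mul_pow]; gcongr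
  have hρ1 : ρ ≤ R ^ 2 * ‖Z‖ := hρ.trans (by gcongr)
  have haρ : a * ρ ≤ R ^ 2 * (‖Z‖ * h) := by
    calc a * ρ ≤ h * (R ^ 2 * ‖Z‖) := by gcongr
      _ = R ^ 2 * (‖Z‖ * h) := by ring
  have hAM : ∀ i j, ‖A i j - M i j‖ ≤ R ^ 2 * η := by
    have e00 : ‖B 0 0 / (Z * Z) - 2 * (α * β - q * β ^ 2)‖ ≤ R ^ 2 * η := by
      refine norm_div_sub_le (mul_ne_zero hZ hZ) (p := ρ ^ 2) ?_ ?_ hη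
      · convert H.tt using 2; rw [hμ, hξ]; ring
      · rw [norm_mul]; linarith [hρ2, sq ‖Z‖]
    have e01 : ‖B 0 1 / (Z * 1) - 0‖ ≤ R ^ 2 * η := by
      refine norm_div_sub_le (mul_ne_zero hZ one_ne_zero) (p := ρ) ?_ ?_ hη
      · simpa using H.tz
      · simpa using hρ1
    have e02 : ‖B 0 2 / (Z * h) - -2 * ((α + s * β) / h)‖ ≤ R ^ 2 * η := by
      refine norm_div_sub_le (mul_ne_zero hZ hhC) (p := a * ρ) ?_ ?_ hη
      · convert H.ts using 2; rw [hμ, hξ]; field_simp; ring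
      · rw [norm_mul, hnh]; exact haρ
    have e10 : ‖B 1 0 / (Z * Z) - 0‖ ≤ R ^ 2 * η := by
      refine norm_div_sub_le (mul_ne_zero hZ hZ) (p := ρ ^ 2) ?_ ?_ hη
      · simpa using H.zt
      · rw [norm_mul]; linarith [hρ2, sq ‖Z‖]
    have e11 : ‖B 1 1 / (Z * 1) - (ν₀ * β - α)‖ ≤ R ^ 2 * η := by
      refine norm_div_sub_le (mul_ne_zero hZ one_ne_zero) (p := ρ) ?_ ?_ hη
      · convert H.zz using 2; rw [hμ, hξ]; ring
      · simpa using hρ1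
    have e12 : ‖B 1 2 / (Z * h) - -4 * (a / h : ℝ) * β‖ ≤ R ^ 2 * η := by
      refine norm_div_sub_le (mul_ne_zero hZ hhC) (p := a * ρ) ?_ ?_ hη
      · convert H.zs using 2; rw [hξ]; push_cast; field_simp; ring
      · rw [norm_mul, hnh]; exact haρ
    have e20 : ‖B 2 0 / (h * Z) - -2 * ((α + s * β) / h)‖ ≤ R ^ 2 * η := by
      refine norm_div_sub_le (mul_ne_zero hhC hZ) (p := a * ρ) ?_ ?_ hη
      · convert H.st using 2; rw [hμ, hξ]; field_simp; ring
      · rw [norm_mul, hnh, mul_comm h]; exact haρ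
    have e21 : ‖B 2 1 / (h * 1) - -4 * (a / h : ℝ)‖ ≤ R ^ 2 * η := by
      refine norm_div_sub_le (mul_ne_zero hhC one_ne_zero) (p := a) ?_ ?_ hη
      · convert H.sz using 2; push_cast; field_simp; ring
      · rw [norm_mul, hnh, norm_one, mul_one]; nlinarith
    have e22 : ‖B 2 2 / (h * h) - -8 * σ * (a / h : ℝ) ^ 2‖ ≤ R ^ 2 * η := by
      refine norm_div_sub_le (mul_ne_zero hhC hhC) (p := a ^ 2) ?_ ?_ hη
      · convert H.ss using 2; push_cast; field_simp; ring
      · rw [norm_mul, hnh]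
        calc a ^ 2 ≤ h ^ 2 := by gcongr
          _ = 1 * (h * h) := by ring
          _ ≤ R ^ 2 * (h * h) := by gcongr
    intro i j
    fin_cases i <;> fin_cases j <;> assumption
  have hAC : ∀ i j, ‖A i j‖ ≤ C + 1 := fun i j => by
    have e : A i j = M i j + (A i j - M i j) := by ring
    rw [e]
    exact norm_add_le_of_le (hMC i j) ((hAM i j).trans hηR)
  have hfin := Whitham.norm_det_sub_le hAC (fun i j => (hMC i j).trans (by linarith)) hAM
  rw [hdet, ← det_modelMatrix, ← hM, ← mul_sub, norm_mul, mul_comm]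
  rw [norm_mul, norm_pow, norm_pow, hnh]
  gcongr

end NearModel

/-- A locally uniform bound on the increments of a small holomorphic function. -/
theorem norm_sub_le_of_norm_le_ball {f : ℂ → ℂ} {z₀ : ℂ} {R r C : ℝ} (hr : 0 < r)
    (hf : DifferentiableOn ℂ f (Metric.ball z₀ (R + r)))
    (hC : ∀ z ∈ Metric.ball z₀ (R + r), ‖f z‖ ≤ C) {x y : ℂ} (hx : x ∈ Metric.ball z₀ R)
    (hy : y ∈ Metric.ball z₀ R) : ‖f x - f y‖ ≤ C / r * ‖x - y‖ := by
  have hsub : Metric.ball z₀ R ⊆ Metric.ball z₀ (R + r) := Metric.ball_subset_ball (by linarith)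
  have hball : ∀ z ∈ Metric.ball z₀ R, ∀ r' < r,
      Metric.closedBall z r' ⊆ Metric.ball z₀ (R + r) := by
    intro z hz r' hr' w hw
    rw [Metric.mem_ball] at *
    rw [Metric.mem_closedBall] at hw
    linarith [dist_triangle w z z₀]
  refine Convex.norm_image_sub_le_of_norm_deriv_le (𝕜 := ℂ) (s := Metric.ball z₀ R)
    (fun z hz => (hf.differentiableAt (Metric.isOpen_ball.mem_nhds (hsub hz)))) ?_
    (convex_ball _ _) hy hx
  intro z hz
  -- Cauchy's estimate is available only on circles strictly inside the open ball; the radius then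
  -- tends to `r`.
  have key : ∀ r' ∈ Set.Ioo 0 r, ‖deriv f z‖ ≤ C / r' := by
    intro r' hr'
    refine Complex.norm_deriv_le_of_forall_mem_sphere_norm_le hr'.1 ?_ ?_
    · exact (hf.mono (hball z hz r' hr'.2)).diffContOnCl_ball subset_rfl
    · exact fun w hw => hC w (hball z hz r' hr'.2 (Metric.sphere_subset_closedBall hw))
  have hlim : Filter.Tendsto (fun r' : ℝ => C / r') (nhdsWithin r (Set.Iio r)) (nhds (C / r)) :=
    ((continuousAt_const.div continuousAt_id hr.ne').tendsto).mono_left nhdsWithin_le_nhds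
  refine ge_of_tendsto hlim ?_
  filter_upwards [Ioo_mem_nhdsLT hr] with r' hr'
  exact key r' hr'

end

end Whitham

namespace Whitham

noncomputable section

open EllTwo

/-! ### Zeros of functions close to the models -/

/-- The minimum modulus principle: if `f` had no zero, the maximum principle for 1/f would be
violated at the centre. -/
theorem exists_zero_of_norm_lt {f : ℂ → ℂ} {z₀ : ℂ} {r C : ℝ} (hr : 0 < r)
    (hf : DifferentiableOn ℂ f (Metric.closedBall z₀ r)) (h0 : ‖f z₀‖ < C)
    (hC : ∀ z ∈ Metric.sphere z₀ r, C ≤ ‖f z‖) : ∃ z ∈ Metric.closedBall z₀ r, f z = 0 := by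
  by_contra! hne
  have hC0 : 0 < C := (norm_nonneg _).trans_lt h0
  have hz₀ : z₀ ∈ Metric.closedBall z₀ r := Metric.mem_closedBall_self hr.le
  have hd : DiffContOnCl ℂ (fun z => (f z)⁻¹) (Metric.ball z₀ r) :=
    (hf.inv hne).diffContOnCl_ball subset_rfl
  have h1 : ‖(f z₀)⁻¹‖ ≤ C⁻¹ := by
    refine Complex.norm_le_of_forall_mem_frontier_norm_le (U := Metric.ball z₀ r)
      Metric.isBounded_ball hd ?_ (subset_closure (Metric.mem_ball_self hr))
    intro z hz
    rw [frontier_ball _ hr.ne'] at hz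
    rw [norm_inv]
    exact inv_anti₀ hC0 (hC z hz)
  rw [norm_inv] at h1
  exact absurd ((inv_le_inv₀ (norm_pos_iff.mpr (hne z₀ hz₀)) hC0).mp h1) (not_le.mpr h0)

/-- By Cauchy's estimate the error is e-Lipschitz. If y ≠ ȳ were both zeros, dividing by y - ȳ would
give 8|Γ||Re y| ≤ e. Then y² is almost a nonpositive real number, at distance more than K/4 from K >
0, whereas f(y) = 0 forces |y² - K| ≤ e/(4|Γ|) < K/4. -/
theorem im_eq_zero_of_quadratic {f : ℂ → ℂ} {Γ K Y e : ℝ} (hK : 0 < K)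
    (he : e < |Γ| * K) (he2 : e ≤ |Γ|)
    (hf : DifferentiableOn ℂ f (Metric.ball 0 (Y + 1)))
    (hfe : ∀ y ∈ Metric.ball (0 : ℂ) (Y + 1), ‖f y - -4 * Γ * (y ^ 2 - K)‖ ≤ e)
    {y : ℂ} (hy : ‖y‖ < Y) (h1 : f y = 0) (h2 : f (star y) = 0) : y.im = 0 := by
  by_contra him
  have hys : star y ∈ Metric.ball (0 : ℂ) Y := by simpa using hy
  have hyb : y ∈ Metric.ball (0 : ℂ) Y := by simpa using hy
  have hd := norm_sub_le_of_norm_le_ball (f := fun y => f y - -4 * Γ * (y ^ 2 - K)) one_pos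
    (hf.sub (by fun_prop)) hfe hyb hys
  have hΓ : 0 ≤ |Γ| := abs_nonneg _
  have hne : 0 < ‖y - star y‖ := by
    rw [norm_pos_iff, sub_ne_zero]
    intro h
    exact him (Complex.conj_eq_iff_im.mp h.symm)
  have hre : 8 * |Γ| * |y.re| ≤ e := by
    simp only [h1, h2] at hd
    have e1 : (0 - -4 * Γ * (y ^ 2 - K) - (0 - -4 * Γ * (star y ^ 2 - K)) : ℂ)
        = ((8 * Γ * y.re : ℝ) : ℂ) * (y - star y) := by
      have e2 : y + star y = ((2 * y.re : ℝ) : ℂ) := Complex.add_conj y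
      push_cast at e2 ⊢
      linear_combination 4 * (Γ : ℂ) * (y - star y) * e2
    rw [e1, norm_mul, Complex.norm_real, Real.norm_eq_abs, abs_mul, abs_mul, div_one] at hd
    have := le_of_mul_le_mul_right hd hne
    simpa using this
  have hv := hfe y (Metric.ball_subset_ball (by linarith) hyb)
  rw [h1, zero_sub, norm_neg, norm_mul, norm_mul, norm_neg, Complex.norm_ofNat, Complex.norm_real,
    Real.norm_eq_abs] at hv
  have hv2 : |(y ^ 2 - K).re| ≤ ‖y ^ 2 - K‖ := Complex.abs_re_le_norm _
  have e3 : (y ^ 2 - (K : ℂ)).re = y.re ^ 2 - y.im ^ 2 - K := by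
    simp [sq]
  rw [e3] at hv2
  have hv3 : 4 * |Γ| * |y.re ^ 2 - y.im ^ 2 - K| ≤ e := le_trans (by gcongr) hv
  have hv4 := neg_abs_le (y.re ^ 2 - y.im ^ 2 - K)
  have hΓ0 : 0 < |Γ| := by
    rcases hΓ.eq_or_lt with h | h
    · rw [← h] at he hre he2; nlinarith
    · exact h
  have hre1 : |y.re| ≤ 1 / 8 := by nlinarith
  have hre2 : 64 * |Γ| * y.re ^ 2 ≤ e := by
    have : |y.re| ^ 2 = y.re ^ 2 := sq_abs _
    nlinarith [abs_nonneg y.re, mul_nonneg hΓ (abs_nonneg y.re)]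
  nlinarith [sq_nonneg y.im, mul_nonneg hΓ (sq_nonneg y.im)]

/-- The disc about ik of radius k/2 misses the real axis. On its boundary |y² + k²| ≥ (k/2)(3k/2),
so the model has modulus at least 3|Γ|k², while at the centre `f` is below |Γ|k². -/
theorem exists_nonreal_zero_of_quadratic {f : ℂ → ℂ} {Γ k Y e : ℝ} (hk : 0 < k)
    (he : e < |Γ| * k ^ 2) (hY : 2 * k ≤ Y)
    (hf : DifferentiableOn ℂ f (Metric.ball 0 (Y + 1)))
    (hfe : ∀ y ∈ Metric.ball (0 : ℂ) (Y + 1), ‖f y - -4 * Γ * (y ^ 2 - (-k ^ 2 : ℝ))‖ ≤ e) :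
    ∃ y : ℂ, ‖y‖ < Y + 1 ∧ y.im ≠ 0 ∧ f y = 0 := by
  have hnI : ‖(k : ℂ) * Complex.I‖ = k := by simp [abs_of_pos hk]
  have hsub : Metric.closedBall ((k : ℂ) * Complex.I) (k / 2) ⊆ Metric.ball 0 (Y + 1) := by
    intro z hz
    rw [Metric.mem_closedBall, dist_eq_norm] at hz
    rw [mem_ball_zero_iff]
    have := norm_le_norm_add_norm_sub' z ((k : ℂ) * Complex.I)
    linarith
  obtain ⟨y, hy, h0⟩ := exists_zero_of_norm_lt (f := f) (C := |Γ| * k ^ 2)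
    (half_pos hk) (hf.mono hsub) (by
      have h := hfe _ (hsub (Metric.mem_closedBall_self (half_pos hk).le))
      have e1 : ((k : ℂ) * Complex.I) ^ 2 - ((-k ^ 2 : ℝ) : ℂ) = 0 := by
        rw [mul_pow, Complex.I_sq]; push_cast; ring
      rw [e1, mul_zero, sub_zero] at h
      exact h.trans_lt he) (by
      intro z hz
      have h := hfe _ (hsub (Metric.sphere_subset_closedBall hz))
      rw [mem_sphere_iff_norm] at hz
      have e1 : z ^ 2 - ((-k ^ 2 : ℝ) : ℂ) = (z - k * Complex.I) * (z - k * Complex.I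
          + 2 * (k * Complex.I)) := by
        push_cast; linear_combination (k : ℂ) ^ 2 * Complex.I_sq
      have h2 : 3 / 2 * k ≤ ‖z - k * Complex.I + 2 * (k * Complex.I)‖ := by
        have := norm_sub_norm_le (2 * (k * Complex.I)) (-(z - k * Complex.I))
        rw [norm_neg, hz, norm_mul, hnI, Complex.norm_ofNat, sub_neg_eq_add, add_comm] at this
        linarith
      have h3 : 3 * |Γ| * k ^ 2 ≤ ‖-4 * Γ * (z ^ 2 - ((-k ^ 2 : ℝ) : ℂ))‖ := by
        rw [e1, norm_mul, norm_mul, norm_mul, norm_neg, Complex.norm_ofNat, Complex.norm_real,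
          Real.norm_eq_abs, hz]
        calc 3 * |Γ| * k ^ 2 = 4 * |Γ| * (k / 2 * (3 / 2 * k)) := by ring
          _ ≤ _ := by gcongr
      have h4 := norm_le_norm_add_norm_sub (f z) (-4 * Γ * (z ^ 2 - ((-k ^ 2 : ℝ) : ℂ)))
      nlinarith [mul_nonneg (abs_nonneg Γ) (sq_nonneg k)])
  refine ⟨y, by simpa using hsub hy, ?_, h0⟩
  intro him
  rw [Metric.mem_closedBall, dist_eq_norm] at hy
  have := (Complex.abs_im_le_norm _).trans hy
  simp [him, abs_of_pos hk] at this
  linarith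

/-- Near its simple zero ν₀ the model has difference quotients of modulus at least 2Γ². The error
has Lipschitz constant at most 32e/|Γ|, which is smaller, so `f` takes no value twice there and a
conjugate pair of zeros must coincide. -/
theorem im_eq_zero_of_cubic {f : ℂ → ℂ} {Γ ν₀ e : ℝ} (hΓ : Γ ≠ 0) (he : e < |Γ| ^ 3 / 64)
    (hf : DifferentiableOn ℂ f (Metric.ball ν₀ (|Γ| / 32 + |Γ| / 32)))
    (hfe : ∀ x ∈ Metric.ball (ν₀ : ℂ) (|Γ| / 32 + |Γ| / 32),
      ‖f x - -4 * (x - (ν₀ - Γ : ℝ)) ^ 2 * (ν₀ - x)‖ ≤ e)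
    {x : ℂ} (hx : ‖x - ν₀‖ < |Γ| / 32) (h1 : f x = 0) (h2 : f (star x) = 0) : x.im = 0 := by
  by_contra him
  have hG : 0 < |Γ| := abs_pos.mpr hΓ
  have hxb : x ∈ Metric.ball (ν₀ : ℂ) (|Γ| / 32) := by rwa [mem_ball_iff_norm]
  have hxs' : ‖star x - ν₀‖ < |Γ| / 32 := by
    have : star x - (ν₀ : ℂ) = star (x - ν₀) := by simp
    rwa [this, norm_star]
  have hxs : star x ∈ Metric.ball (ν₀ : ℂ) (|Γ| / 32) := by rwa [mem_ball_iff_norm]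
  have hd := norm_sub_le_of_norm_le_ball
    (f := fun x => f x - -4 * (x - (ν₀ - Γ : ℝ)) ^ 2 * (ν₀ - x)) (by positivity)
    (hf.sub (by fun_prop)) hfe hxb hxs
  have hne : 0 < ‖x - star x‖ := by
    rw [norm_pos_iff, sub_ne_zero]
    intro h
    exact him (Complex.conj_eq_iff_im.mp h.symm)
  simp only [h1, h2] at hd
  set z := x - ν₀ with hz
  set z' := star x - ν₀ with hz'
  have e1 : (0 - -4 * (x - (ν₀ - Γ : ℝ)) ^ 2 * (ν₀ - x)
      - (0 - -4 * (star x - (ν₀ - Γ : ℝ)) ^ 2 * (ν₀ - star x)) : ℂ)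
      = -4 * ((Γ : ℂ) ^ 2 + (2 * Γ * (z + z') + (z * z + z * z' + z' * z'))) * (x - star x) := by
    rw [hz, hz']; push_cast; ring
  rw [e1, norm_mul, norm_mul, norm_neg, Complex.norm_ofNat] at hd
  have h3 := le_of_mul_le_mul_right hd hne
  have h4 : ‖2 * (Γ : ℂ) * (z + z') + (z * z + z * z' + z' * z')‖
      ≤ 2 * |Γ| * (|Γ| / 32 + |Γ| / 32) + (|Γ| / 32 * (|Γ| / 32) + |Γ| / 32 * (|Γ| / 32)
        + |Γ| / 32 * (|Γ| / 32)) := by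
    refine norm_add_le_of_le ?_ (norm_add_le_of_le (norm_add_le_of_le ?_ ?_) ?_)
    · rw [norm_mul, norm_mul, Complex.norm_ofNat, Complex.norm_real, Real.norm_eq_abs]
      gcongr
      exact norm_add_le_of_le hx.le hxs'.le
    all_goals rw [norm_mul]; gcongr
  have h5 := norm_sub_norm_le ((Γ : ℂ) ^ 2)
    (-(2 * (Γ : ℂ) * (z + z') + (z * z + z * z' + z' * z')))
  rw [sub_neg_eq_add, norm_neg, norm_pow, Complex.norm_real, Real.norm_eq_abs] at h5
  rw [le_div_iff₀ (by positivity)] at h3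
  have h6 : |Γ| ^ 2 / 2 ≤ ‖(Γ : ℂ) ^ 2 + (2 * Γ * (z + z') + (z * z + z * z' + z' * z'))‖ := by
    nlinarith [sq_nonneg |Γ|]
  have h7 : 4 * (|Γ| ^ 2 / 2) * (|Γ| / 32) ≤ e := le_trans (by gcongr) h3
  nlinarith

/-! ### The sign of the index decides -/

/-- The hypothesis on the determinants used in the root analysis. -/
def DetClose (s q ν₀ σ R U a e : ℝ) (ρ₀ : ℝ) (X : ℂ → ℝ → ℂ) : Prop :=
  ∀ (Z α β : ℂ) (ξ h : ℝ), Z ≠ 0 → R * ‖Z‖ ≤ ρ₀ → (ξ : ℂ) = β * Z → ‖α‖ ≤ R → ‖β‖ ≤ R → a ≤ h →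
    ‖α + s * β‖ ≤ U * h →
    ‖X (α * Z) ξ - Z ^ 3 * h ^ 2 * modelDet q ν₀ σ α β (a / h) ((α + s * β) / h)‖
      ≤ e * (‖Z‖ ^ 3 * h ^ 2)

theorem exists_detClose (s q ν₀ σ U : ℝ) {R e : ℝ} (hR : 1 ≤ R) (he : 0 < e) :
    ∃ η > 0, ∀ (η' a ρ₀ : ℝ) (B : ℂ → ℝ → Matrix (Fin 3) (Fin 3) ℂ), 0 ≤ η' → η' ≤ η → 0 < a →
      (∀ μ ξ ρ, ρ ≤ ρ₀ → |ξ| ≤ ρ → ‖μ‖ ≤ ρ → NearModel s q ν₀ σ η' a ρ μ ξ (B μ ξ)) →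
      DetClose s q ν₀ σ R U a e ρ₀ (fun μ ξ => (B μ ξ).det) := by
  set C := 18 * (2 * (R * R + |q| * R ^ 2) + 2 * U + (|ν₀| * R + R) + 4 * R + 4 + 8 * |σ| + 1) ^ 2
    with hC
  have hC0 : 0 ≤ C := by positivity
  have hR0 : 0 < R := by linarith
  refine ⟨min 1 (e / (C + 1)) / R ^ 2, by positivity, ?_⟩
  intro η' a ρ₀ B hη0 hη' ha H Z α β ξ h hZ hρ hξ hα hβ hah hu
  have hη2 : R ^ 2 * η' ≤ min 1 (e / (C + 1)) := by
    rw [le_div_iff₀ (by positivity)] at hη'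
    linarith
  have hμρ : ‖α * Z‖ ≤ R * ‖Z‖ := by rw [norm_mul]; gcongr
  have hξρ : |ξ| ≤ R * ‖Z‖ := by
    rw [← Real.norm_eq_abs, ← Complex.norm_real, hξ, norm_mul]; gcongr
  have hh : 0 < h := ha.trans_le hah
  refine ((H (α * Z) ξ _ hρ hξρ hμρ).norm_det_sub_le hη0 hR (hη2.trans (min_le_left _ _)) hZ rfl
    hξ hα hβ (by positivity) le_rfl ha hah hu).trans ?_
  rw [← hC]
  gcongr
  calc C * (R ^ 2 * η') ≤ C * (e / (C + 1)) := by
        gcongr; exact hη2.trans (min_le_right _ _)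
    _ ≤ (C + 1) * (e / (C + 1)) := by gcongr; linarith
    _ = e := by field_simp

end

end Whitham

/-! ### Estimates of the model determinant on each scale, and the location of its roots -/

namespace Whitham

noncomputable section

open EllTwo

/-- At τ = θ = 0 the determinant equals 4, and it is continuous. This rules out eigenvalues with |ξ|
much smaller than |μ|. -/
theorem exists_le_norm_modelDet (s q ν₀ σ : ℝ) :
    ∃ r > 0, r ≤ 1 ∧ ∀ (τ : ℂ) (θ : ℝ), ‖τ‖ ≤ r → |θ| ≤ r →
      2 ≤ ‖modelDet q ν₀ σ 1 τ θ (1 + s * τ)‖ := by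
  have hcont : Continuous fun p : ℂ × ℝ => ‖modelDet q ν₀ σ 1 p.1 p.2 (1 + s * p.1)‖ := by
    unfold modelDet
    fun_prop
  have h0 : (2 : ℝ) < ‖modelDet q ν₀ σ 1 (0 : ℂ × ℝ).1 (0 : ℂ × ℝ).2 (1 + s * (0 : ℂ × ℝ).1)‖ := by
    norm_num [modelDet]
  obtain ⟨r, hr, h⟩ := Metric.eventually_nhds_iff.mp (hcont.continuousAt.eventually_const_lt h0)
  refine ⟨min 1 (r / 2), by positivity, min_le_left _ _, fun τ θ hτ hθ => ?_⟩
  refine (h (y := (τ, θ)) ?_).le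
  rw [Prod.dist_eq, max_lt_iff]
  have := min_le_right 1 (r / 2)
  constructor
  · simp only [Prod.fst_zero, dist_zero_right]; linarith
  · simp only [Prod.snd_zero, dist_zero_right, Real.norm_eq_abs]; linarith

/-- A bound for the part of the model determinant that comes from the amplitude. -/
def amplitudeBound (q ν₀ σ R : ℝ) : ℝ := 2 * (R + |q|) * (8 * |σ| * (|ν₀| + R) + 16)

theorem norm_modelDet_sub_le {q ν₀ σ R : ℝ} {ν : ℂ} (hν : ‖ν‖ ≤ R) (θ : ℝ) (u : ℂ) :
    ‖modelDet q ν₀ σ ν 1 θ u - -4 * u ^ 2 * (ν₀ - ν)‖ ≤ θ ^ 2 * amplitudeBound q ν₀ σ R := by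
  have e : modelDet q ν₀ σ ν 1 θ u - -4 * u ^ 2 * (ν₀ - ν)
      = (θ : ℂ) ^ 2 * (2 * (ν - q) * (-(8 * σ * (ν₀ - ν)) - 16)) := by
    unfold modelDet; ring
  rw [e, norm_mul, norm_pow, Complex.norm_real, Real.norm_eq_abs, sq_abs, amplitudeBound, norm_mul,
    norm_mul, Complex.norm_ofNat]
  have h1 : ‖ν - q‖ ≤ R + |q| := norm_sub_le_of_le hν (by simp)
  have h2 : ‖(ν₀ : ℂ) - ν‖ ≤ |ν₀| + R := norm_sub_le_of_le (by simp) hν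
  have h3 : ‖-(8 * (σ : ℂ) * (ν₀ - ν)) - 16‖ ≤ 8 * |σ| * (|ν₀| + R) + 16 := by
    refine norm_sub_le_of_le ?_ (by simp)
    rw [norm_neg, norm_mul, norm_mul, Complex.norm_ofNat, Complex.norm_real, Real.norm_eq_abs]
    gcongr
  have hR : 0 ≤ R := (norm_nonneg _).trans hν
  gcongr

/-- The discriminant whose sign decides modulational stability. -/
def discriminant (s q ν₀ σ : ℝ) : ℝ := 4 * (q + s) * (σ + 2 / (ν₀ + s))

def innerBound (s q ν₀ σ Y : ℝ) : ℝ :=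
  Y * (2 * (8 * |σ| * (|s| + |ν₀|) + 16) + 16 * |σ| * (|s| + |q|) + 16 * |σ|) + 4 * Y ^ 3

/-- The origin of the discriminant: in the magnified variable ν = -s + ay, at scale h = a, the model
at a = 0 is exactly -4Γ(y² - K), and everything else carries a factor a. -/
theorem norm_modelDet_inner_sub_le {s q ν₀ σ Y a : ℝ} {y : ℂ} (hΓ : ν₀ + s ≠ 0) (ha : 0 ≤ a)
    (hy : ‖y‖ ≤ Y) (haY : a * Y ≤ 1) :
    ‖modelDet q ν₀ σ (a * y - s) 1 1 y
      - -4 * (ν₀ + s : ℝ) * (y ^ 2 - discriminant s q ν₀ σ)‖ ≤ a * innerBound s q ν₀ σ Y := by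
  have hY : 0 ≤ Y := (norm_nonneg _).trans hy
  have hΓ' : (ν₀ : ℂ) + s ≠ 0 := by exact_mod_cast hΓ
  have e : modelDet q ν₀ σ (a * y - s) 1 1 y
      - -4 * (ν₀ + s : ℝ) * (y ^ 2 - discriminant s q ν₀ σ)
      = a * (y * (2 * (8 * σ * (-s - ν₀) - 16) + 16 * σ * (-s - q) + 16 * σ * (a * y))
        + 4 * y ^ 3) := by
    simp only [modelDet, discriminant]
    push_cast
    field_simp
    ring
  have hay : ‖(a : ℂ) * y‖ ≤ 1 := by
    rw [norm_mul, Complex.norm_real, Real.norm_eq_abs, abs_of_nonneg ha]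
    exact le_trans (by gcongr) haY
  have hn : ∀ x : ℝ, ‖(x : ℂ)‖ ≤ |x| := fun x => by simp
  have hn' : ∀ x y : ℝ, ‖-(x : ℂ) - y‖ ≤ |x| + |y| := fun x y =>
    norm_sub_le_of_le (by simp) (by simp)
  rw [e, norm_mul, Complex.norm_real, Real.norm_eq_abs, abs_of_nonneg ha, innerBound]
  gcongr
  refine norm_add_le_of_le ?_ ?_
  · rw [norm_mul]
    gcongr
    refine norm_add_le_of_le (norm_add_le_of_le ?_ ?_) ?_
    · rw [norm_mul, Complex.norm_ofNat]
      gcongr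
      refine norm_sub_le_of_le ?_ (by simp)
      rw [norm_mul, norm_mul, Complex.norm_ofNat]
      gcongr
      exacts [hn _, hn' _ _]
    · rw [norm_mul, norm_mul, Complex.norm_ofNat]
      gcongr
      exacts [hn _, hn' _ _]
    · rw [norm_mul, norm_mul, Complex.norm_ofNat]
      calc 16 * ‖(σ : ℂ)‖ * ‖(a : ℂ) * y‖ ≤ 16 * |σ| * 1 := by gcongr; exact hn _
        _ = 16 * |σ| := mul_one _
  · rw [norm_mul, norm_pow, Complex.norm_ofNat]
    gcongr

namespace DetClose

variable {s q ν₀ σ R U a e ρ₀ : ℝ} {X : ℂ → ℝ → ℂ}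

/-- Scaling by Z = μ and h = 1: the range |ξ| ≤ r|μ|, where ν = μ/ξ would be large or undefined. -/
theorem ne_zero_of_abs_le (H : DetClose s q ν₀ σ R U a e ρ₀ X) {r : ℝ} (hr1 : r ≤ 1)
    (hr : ∀ (τ : ℂ) (θ : ℝ), ‖τ‖ ≤ r → |θ| ≤ r → 2 ≤ ‖modelDet q ν₀ σ 1 τ θ (1 + s * τ)‖)
    (hR : 1 ≤ R) (hU : 1 + |s| ≤ U) (ha : 0 < a) (har : a ≤ r) (he : e ≤ 1) {μ : ℂ} {ξ : ℝ}
    (hμ : μ ≠ 0) (hμR : R * ‖μ‖ ≤ ρ₀) (hξ : |ξ| ≤ r * ‖μ‖) : X μ ξ ≠ 0 := by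
  intro h0
  have hμ0 : 0 < ‖μ‖ := norm_pos_iff.mpr hμ
  have hτ : ‖(ξ : ℂ) / μ‖ ≤ r := by
    rw [norm_div, Complex.norm_real, Real.norm_eq_abs, div_le_iff₀ hμ0]; exact hξ
  have hsτ : ‖1 + s * ((ξ : ℂ) / μ)‖ ≤ U * 1 := by
    rw [mul_one]
    refine le_trans (norm_add_le_of_le (norm_one.le) ?_) hU
    rw [norm_mul, Complex.norm_real, Real.norm_eq_abs]
    exact mul_le_of_le_one_right (abs_nonneg _) (hτ.trans hr1)
  have h := H μ 1 (ξ / μ) ξ 1 hμ hμR (by field_simp) (by simpa using hR)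
    (hτ.trans (hr1.trans hR)) (har.trans hr1) hsτ
  have h2 := hr (ξ / μ) a hτ (by rwa [abs_of_pos ha])
  rw [one_mul, h0, zero_sub, norm_neg] at h
  simp only [Complex.ofReal_one, div_one, one_pow, mul_one, norm_mul, norm_pow] at h
  have h3 : 0 < ‖μ‖ ^ 3 := by positivity
  nlinarith

/-- Scaling by Z = ξ and h = 1: the range of ν away from the double root. -/
theorem cubic (H : DetClose s q ν₀ σ R U a e ρ₀ X) (hR : 1 ≤ R) (hU : R + |s| ≤ U)
    (ha1 : a ≤ 1) {ξ : ℝ} (hξ : ξ ≠ 0) (hξR : R * |ξ| ≤ ρ₀) {ν : ℂ} (hν : ‖ν‖ ≤ R) :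
    ‖X (ν * ξ) ξ / ξ ^ 3 - -4 * (ν - (-s : ℝ)) ^ 2 * (ν₀ - ν)‖
      ≤ e + a ^ 2 * amplitudeBound q ν₀ σ R := by
  have hξ' : (ξ : ℂ) ≠ 0 := by exact_mod_cast hξ
  have hn : ‖(ξ : ℂ)‖ = |ξ| := by simp
  have hξ0 : 0 < |ξ| := abs_pos.mpr hξ
  have h := H ξ ν 1 ξ 1 hξ' (by rwa [hn]) (by ring) hν (by simpa using hR) ha1 (by
    rw [mul_one, mul_one]
    exact (norm_add_le_of_le hν (by simp)).trans hU)
  simp only [Complex.ofReal_one, div_one, one_pow, mul_one, hn] at h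
  have h2 := norm_modelDet_sub_le (q := q) (ν₀ := ν₀) (σ := σ) hν a (ν + s)
  have e1 : X (ν * ξ) ξ / ξ ^ 3 - modelDet q ν₀ σ ν 1 a (ν + s)
      = (X (ν * ξ) ξ - ξ ^ 3 * modelDet q ν₀ σ ν 1 a (ν + s)) / ξ ^ 3 := by field_simp
  have h3 : ‖X (ν * ξ) ξ / ξ ^ 3 - modelDet q ν₀ σ ν 1 a (ν + s)‖ ≤ e := by
    rw [e1, norm_div, norm_pow, hn, div_le_iff₀ (by positivity)]
    exact h
  rw [show ν - ((-s : ℝ) : ℂ) = ν + s by push_cast; ring]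
  exact (norm_sub_le_norm_sub_add_norm_sub _ _ _).trans (add_le_add h3 h2)

/-- Scaling by Z = ξ and h = a: the range |ν+s| = O(a), where the double root splits. -/
theorem quadratic (H : DetClose s q ν₀ σ R U a e ρ₀ X) {Y : ℝ} (hR : 1 + |s| ≤ R) (hU : Y ≤ U)
    (hΓ : ν₀ + s ≠ 0) (ha : 0 < a) (haY : a * Y ≤ 1) {ξ : ℝ} (hξ : ξ ≠ 0) (hξR : R * |ξ| ≤ ρ₀)
    {y : ℂ} (hy : ‖y‖ ≤ Y) :
    ‖X ((a * y - s) * ξ) ξ / (ξ ^ 3 * a ^ 2)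
        - -4 * (ν₀ + s : ℝ) * (y ^ 2 - discriminant s q ν₀ σ)‖
      ≤ e + a * innerBound s q ν₀ σ Y := by
  have hξ' : (ξ : ℂ) ≠ 0 := by exact_mod_cast hξ
  have ha' : (a : ℂ) ≠ 0 := by exact_mod_cast ha.ne'
  have hn : ‖(ξ : ℂ)‖ = |ξ| := by simp
  have hna : ‖(a : ℂ)‖ = a := by simp [abs_of_pos ha]
  have hξ0 : 0 < |ξ| := abs_pos.mpr hξ
  have hay : ‖(a : ℂ) * y‖ ≤ 1 := by
    rw [norm_mul, hna]
    exact le_trans (by gcongr) haY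
  have e0 : (a * y - s : ℂ) + s * 1 = a * y := by ring
  have h := H ξ (a * y - s) 1 ξ a hξ' (by rwa [hn]) (by ring)
    ((norm_sub_le_of_le hay (by simp)).trans hR) (by
      rw [norm_one]; linarith [abs_nonneg s]) le_rfl (by
    rw [e0, norm_mul, hna, mul_comm]
    gcongr
    exact hy.trans hU)
  rw [e0, div_self ha.ne', mul_div_cancel_left₀ _ ha', hn] at h
  have h2 := norm_modelDet_inner_sub_le (q := q) (σ := σ) hΓ ha.le hy haY
  have e1 : X ((a * y - s) * ξ) ξ / (ξ ^ 3 * a ^ 2) - modelDet q ν₀ σ (a * y - s) 1 1 y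
      = (X ((a * y - s) * ξ) ξ - ξ ^ 3 * a ^ 2 * modelDet q ν₀ σ (a * y - s) 1 1 y)
        / (ξ ^ 3 * a ^ 2) := by field_simp
  have h3 : ‖X ((a * y - s) * ξ) ξ / (ξ ^ 3 * a ^ 2) - modelDet q ν₀ σ (a * y - s) 1 1 y‖ ≤ e := by
    rw [e1, norm_div, norm_mul, norm_pow, norm_pow, hn, hna, div_le_iff₀ (by positivity)]
    exact h
  exact (norm_sub_le_norm_sub_add_norm_sub _ _ _).trans (add_le_add h3 h2)

/-- Scaling by h = |ν+s| makes the u-variable of modulus 1. The u² term is then at least 2|Γ|, while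
the amplitude term is at most |Γ|/Y ≤ |Γ| since a/h ≤ 1/Y, so together with e < |Γ| they cannot
cancel. -/
theorem ne_zero_of_intermediate (H : DetClose s q ν₀ σ R U a e ρ₀ X) {Y : ℝ} (hR : 1 ≤ R)
    (hU : 1 ≤ U) (hΓ : ν₀ + s ≠ 0) (ha : 0 < a) (hY : 1 ≤ Y)
    (hYb : amplitudeBound q ν₀ σ R ≤ |ν₀ + s| * Y) (he : e < |ν₀ + s|) {ξ : ℝ} (hξ : ξ ≠ 0)
    (hξR : R * |ξ| ≤ ρ₀) {ν : ℂ} (hν : ‖ν‖ ≤ R) (h1 : a * Y ≤ ‖ν + s‖)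
    (h2 : ‖ν + s‖ ≤ |ν₀ + s| / 2) : X (ν * ξ) ξ ≠ 0 := by
  intro h0
  have hξ' : (ξ : ℂ) ≠ 0 := by exact_mod_cast hξ
  have hn : ‖(ξ : ℂ)‖ = |ξ| := by simp
  have hξ0 : 0 < |ξ| := abs_pos.mpr hξ
  set h := ‖ν + s‖ with hh
  have hah : a ≤ h := le_trans (by nlinarith) h1
  have hh0 : 0 < h := ha.trans_le hah
  have hnh : ‖(h : ℂ)‖ = h := by simp [abs_of_pos hh0]
  have hu : ‖(ν + s * 1) / h‖ = 1 := by
    rw [norm_div, hnh, mul_one, ← hh, div_self hh0.ne']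
  have H' := H ξ ν 1 ξ h hξ' (by rwa [hn]) (by ring) hν (by simpa using hR) hah (by
    rw [mul_one, ← hh]; nlinarith)
  rw [h0, zero_sub, norm_neg, norm_mul, norm_mul, norm_pow, norm_pow, hn, hnh, mul_comm] at H'
  have H2 := le_of_mul_le_mul_right H' (by positivity)
  have H3 := norm_modelDet_sub_le (q := q) (ν₀ := ν₀) (σ := σ) hν (a / h) ((ν + s * 1) / h)
  have H4 : |ν₀ + s| / 2 ≤ ‖(ν₀ : ℂ) - ν‖ := by
    have := norm_sub_norm_le ((ν₀ + s : ℝ) : ℂ) (ν + s)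
    rw [← hh, Complex.norm_real, Real.norm_eq_abs] at this
    rw [show (ν₀ : ℂ) - ν = ((ν₀ + s : ℝ) : ℂ) - (ν + s) by push_cast; ring]
    linarith
  have H5 : 2 * |ν₀ + s| ≤ ‖-4 * ((ν + s * 1) / h) ^ 2 * (ν₀ - ν)‖ := by
    rw [norm_mul, norm_mul, norm_neg, norm_pow, hu, Complex.norm_ofNat]
    linarith
  have H6 : (a / h) ^ 2 * amplitudeBound q ν₀ σ R ≤ |ν₀ + s| := by
    have hq : a / h ≤ 1 / Y := by
      rw [div_le_div_iff₀ hh0 (by linarith)]; linarith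
    have hq0 : 0 ≤ a / h := by positivity
    have hΓ0 : 0 < |ν₀ + s| := abs_pos.mpr hΓ
    have hP0 : 0 ≤ amplitudeBound q ν₀ σ R := by unfold amplitudeBound; positivity
    calc (a / h) ^ 2 * amplitudeBound q ν₀ σ R ≤ (1 / Y) ^ 2 * (|ν₀ + s| * Y) := by
          gcongr
      _ = |ν₀ + s| / Y := by field_simp
      _ ≤ |ν₀ + s| := div_le_self hΓ0.le hY
  have H7 := norm_le_norm_add_norm_sub
    (modelDet q ν₀ σ ν 1 (a / h) ((ν + s * 1) / h)) (-4 * ((ν + s * 1) / h) ^ 2 * (ν₀ - ν))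
  linarith

end DetClose

set_option maxHeartbeats 1000000 in
/-- **Root analysis.** The sign of the discriminant decides whether there are nonreal zeros. -/
theorem exists_root_dichotomy {s q ν₀ σ : ℝ} (hΓ : ν₀ + s ≠ 0)
    (hK : discriminant s q ν₀ σ ≠ 0) :
    ∃ R U e a₀ : ℝ, 1 ≤ R ∧ 0 < e ∧ 0 < a₀ ∧ ∀ (a ρ₀ : ℝ) (X : ℂ → ℝ → ℂ), 0 < a → a ≤ a₀ →
      0 < ρ₀ → DetClose s q ν₀ σ R U a e ρ₀ X →
      (∀ μ ξ, ‖μ‖ ≤ ρ₀ → |ξ| ≤ ρ₀ → DifferentiableAt ℂ (fun z => X z ξ) μ) →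
      (discriminant s q ν₀ σ < 0 → ∀ δ > 0, ∃ ξ : ℝ, ∃ μ : ℂ, |ξ| < δ ∧ ‖μ‖ < δ ∧
        |ξ| ≤ ρ₀ ∧ ‖μ‖ ≤ ρ₀ ∧ μ.im ≠ 0 ∧ X μ ξ = 0) ∧
      (0 < discriminant s q ν₀ σ →
        (∀ μ ξ, ‖μ‖ ≤ ρ₀ → |ξ| ≤ ρ₀ → X μ ξ = 0 → X (star μ) ξ = 0) →
        ∃ δ > 0, δ ≤ ρ₀ ∧ ∀ (ξ : ℝ) (μ : ℂ), |ξ| < δ → ‖μ‖ < δ → X μ ξ = 0 → μ.im = 0) := by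
  obtain ⟨r, hr0, hr1, hr⟩ := exists_le_norm_modelDet s q ν₀ σ
  set Γ := ν₀ + s with hΓdef
  set K := discriminant s q ν₀ σ with hKdef
  have hG : 0 < |Γ| := abs_pos.mpr hΓ
  have hKabs : 0 < |K| := abs_pos.mpr hK
  -- `R` bounds |ν| in all ranges that occur: |ν| ≤ 1/r, the disc around -s and the disc around ν₀.
  set R := 1 / r + |s| + |ν₀| + |Γ| + 2 with hRdef
  have hrinv : 0 < 1 / r := by positivity
  have hs := abs_nonneg s
  have hν₀ := abs_nonneg ν₀
  have hR1 : 1 ≤ R := by linarith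
  have hR0 : 0 < R := by linarith
  set P := amplitudeBound q ν₀ σ R with hPdef
  have hP : 0 < P := by
    rw [hPdef, amplitudeBound]
    have := abs_nonneg q
    have := abs_nonneg σ
    positivity
  -- The first term leaves room for the disc around i√|K|; the second makes the u² term dominate as
  -- soon as |ν+s| ≥ aY.
  set Y := 2 * √|K| + P / |Γ| + 1 with hYdef
  have hsq : 0 < √|K| := Real.sqrt_pos.mpr hKabs
  have hPG : 0 < P / |Γ| := by positivity
  have hY1 : 1 ≤ Y := by linarith
  have hYb : P ≤ |Γ| * Y := by
    calc P = |Γ| * (P / |Γ|) := by field_simp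
      _ ≤ |Γ| * Y := by gcongr; linarith
  set I := innerBound s q ν₀ σ (Y + 1) with hIdef
  have hI : 0 < I := by
    rw [hIdef, innerBound]
    have := abs_nonneg q
    have := abs_nonneg σ
    positivity
  -- The total error allowed in each range; one half is granted to `DetClose`, the other to the
  -- remainders in the model controlled by a.
  set e₁ := min 1 (min (|Γ| ^ 3 / 128) (min (|Γ| * |K| / 2) (|Γ| / 2))) with he₁
  have he₁0 : 0 < e₁ := by positivity
  have e1 : e₁ ≤ 1 := min_le_left _ _
  have e2 : e₁ ≤ |Γ| ^ 3 / 128 := (min_le_right _ _).trans (min_le_left _ _)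
  have e3 : e₁ ≤ |Γ| * |K| / 2 :=
    (min_le_right _ _).trans ((min_le_right _ _).trans (min_le_left _ _))
  have e4 : e₁ ≤ |Γ| / 2 :=
    (min_le_right _ _).trans ((min_le_right _ _).trans (min_le_right _ _))
  have e2' : e₁ < |Γ| ^ 3 / 64 := by have := pow_pos hG 3; linarith
  have e3' : e₁ < |Γ| * |K| := by have := mul_pos hG hKabs; linarith
  refine ⟨R, R + |s| + Y + 1, e₁ / 2, min r (min (e₁ / 2 / P) (min (e₁ / 2 / I) (1 / (Y + 1)))),
    hR1, by positivity, by positivity, ?_⟩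
  intro a ρ₀ X ha haa hρ₀ H hX
  have a1 : a ≤ r := haa.trans (min_le_left _ _)
  have a2 : a * P ≤ e₁ / 2 := by
    rw [← le_div_iff₀ hP]; exact haa.trans ((min_le_right _ _).trans (min_le_left _ _))
  have a3 : a * I ≤ e₁ / 2 := by
    rw [← le_div_iff₀ hI]
    exact haa.trans ((min_le_right _ _).trans ((min_le_right _ _).trans (min_le_left _ _)))
  have a4 : a * (Y + 1) ≤ 1 := by
    rw [← le_div_iff₀ (by linarith)]
    exact haa.trans ((min_le_right _ _).trans ((min_le_right _ _).trans (min_le_right _ _)))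
  have a5 : a ≤ 1 := a1.trans hr1
  have a7 : a ^ 2 ≤ a := by nlinarith
  have a6 : a ^ 2 * P ≤ e₁ / 2 := le_trans (by gcongr) a2
  have ρdiv : ∀ {ξ : ℝ}, |ξ| < ρ₀ / R → R * |ξ| ≤ ρ₀ := fun {ξ} h => by
    rw [lt_div_iff₀ hR0] at h; linarith
  have ρle : ∀ {x : ℝ}, R * |x| ≤ ρ₀ → |x| ≤ ρ₀ := fun {x} h =>
    (le_mul_of_one_le_left (abs_nonneg x) hR1).trans h
  have hXd : ∀ {ξ : ℝ} {f : ℂ → ℂ} {ν : ℂ}, R * |ξ| ≤ ρ₀ → ‖f ν‖ ≤ R → DifferentiableAt ℂ f ν →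
      DifferentiableAt ℂ (fun z => X (f z * ξ) ξ) ν := by
    intro ξ f ν hξ hν hf
    have h1 : ‖f ν * ξ‖ ≤ ρ₀ := by
      rw [norm_mul, Complex.norm_real, Real.norm_eq_abs]
      exact le_trans (by gcongr) hξ
    exact (hX _ ξ h1 (ρle hξ)).comp (f := fun z => f z * ξ) ν (hf.mul_const _)
  have hmul : ∀ {y : ℂ}, ‖y‖ ≤ Y + 1 → ‖(a : ℂ) * y - s‖ ≤ R := by
    intro y hy
    have h1 : ‖(a : ℂ) * y‖ ≤ 1 := by
      rw [norm_mul, Complex.norm_real, Real.norm_eq_abs, abs_of_pos ha]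
      exact le_trans (by gcongr) a4
    have h2 : ‖(a : ℂ) * y - s‖ ≤ 1 + |s| := norm_sub_le_of_le h1 (by simp)
    linarith
  have hquad : ∀ {ξ : ℝ}, ξ ≠ 0 → R * |ξ| ≤ ρ₀ →
      DifferentiableOn ℂ (fun y => X ((a * y - s) * ξ) ξ / (ξ ^ 3 * a ^ 2))
        (Metric.ball 0 (Y + 1)) ∧
      ∀ y ∈ Metric.ball (0 : ℂ) (Y + 1), ‖X ((a * y - s) * ξ) ξ / (ξ ^ 3 * a ^ 2)
        - -4 * Γ * (y ^ 2 - K)‖ ≤ e₁ := by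
    intro ξ hξ hξR
    refine ⟨fun y hy => ?_, fun y hy => ?_⟩
    · rw [mem_ball_zero_iff] at hy
      exact ((hXd hξR (f := fun y => a * y - s) (hmul hy.le)
        (by fun_prop)).div_const _).differentiableWithinAt
    · rw [mem_ball_zero_iff] at hy
      refine (H.quadratic (Y := Y + 1) (by linarith) (by linarith) hΓ ha a4 hξ hξR hy.le).trans ?_
      linarith
  constructor
  · intro hKneg δ hδ
    set ξ := min (δ / (2 * R)) (ρ₀ / (2 * R)) with hξdef
    have hξ0 : 0 < ξ := by positivity
    have hξδ : R * ξ ≤ δ / 2 := by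
      calc R * ξ ≤ R * (δ / (2 * R)) := by gcongr; exact min_le_left _ _
        _ = δ / 2 := by field_simp
    have hξρ : R * ξ ≤ ρ₀ / 2 := by
      calc R * ξ ≤ R * (ρ₀ / (2 * R)) := by gcongr; exact min_le_right _ _
        _ = ρ₀ / 2 := by field_simp
    have habs : |ξ| = ξ := abs_of_pos hξ0
    have hξR : R * |ξ| ≤ ρ₀ := by rw [habs]; linarith
    obtain ⟨hd, hc⟩ := hquad hξ0.ne' hξR
    have hk2 : √|K| ^ 2 = |K| := Real.sq_sqrt hKabs.le
    have hKk : K = -√|K| ^ 2 := by rw [hk2, abs_of_neg hKneg]; ring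
    obtain ⟨y, hyY, him, hy0⟩ := exists_nonreal_zero_of_quadratic (Y := Y) (Γ := Γ) hsq
      (by rwa [hk2]) (by linarith) hd (by rw [← hKk]; exact hc)
    have hνn := hmul hyY.le
    have hμn : ‖((a : ℂ) * y - s) * ξ‖ ≤ R * ξ := by
      rw [norm_mul, Complex.norm_real, Real.norm_eq_abs, habs]; gcongr
    refine ⟨ξ, (a * y - s) * ξ, ?_, ?_, ρle hξR, ?_, ?_, ?_⟩
    · rw [habs]
      have := le_mul_of_one_le_left hξ0.le hR1
      linarith
    · linarith
    · linarith
    · simp [ha.ne', hξ0.ne', him]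
    · rw [div_eq_zero_iff] at hy0
      refine hy0.resolve_right ?_
      have : (ξ : ℂ) ≠ 0 := by exact_mod_cast hξ0.ne'
      have : (a : ℂ) ≠ 0 := by exact_mod_cast ha.ne'
      positivity
  · intro hKpos hconj
    have hKa : |K| = K := abs_of_pos hKpos
    refine ⟨ρ₀ / R, by positivity, div_le_self hρ₀.le hR1, ?_⟩
    intro ξ μ hξ hμ h0
    have hξR := ρdiv hξ
    have hμR : R * ‖μ‖ ≤ ρ₀ := by rw [lt_div_iff₀ hR0] at hμ; linarith
    -- If |ξ| is small against |μ| there is no zero except possibly μ = 0; otherwise ν = μ/ξ is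
    -- bounded by 1/r.
    rcases le_or_gt |ξ| (r * ‖μ‖) with hle | hlt
    · rcases eq_or_ne μ 0 with rfl | hμ0
      · simp
      · exact absurd h0 (H.ne_zero_of_abs_le hr1 hr hR1 (by linarith) ha a1 (by linarith) hμ0
          hμR hle)
    have hξ0 : ξ ≠ 0 := by
      rintro rfl
      rw [abs_zero] at hlt
      exact absurd hlt (not_lt.mpr (by positivity))
    have hξ' : (ξ : ℂ) ≠ 0 := by exact_mod_cast hξ0
    have hξpos : 0 < |ξ| := abs_pos.mpr hξ0
    obtain ⟨ν, rfl⟩ : ∃ ν : ℂ, μ = ν * ξ := ⟨μ / ξ, by field_simp⟩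
    have hν : ‖ν‖ ≤ 1 / r := by
      rw [norm_mul, Complex.norm_real, Real.norm_eq_abs, ← mul_assoc] at hlt
      rw [le_div_iff₀ hr0]
      by_contra! hcon
      have h1 := mul_lt_mul_of_pos_right hcon hξpos
      linarith [mul_comm r ‖ν‖]
    have hνR : ‖ν‖ ≤ R := by linarith
    have h0' : X (star ν * ξ) ξ = 0 := by
      have := hconj (ν * ξ) ξ ((hμ.le).trans (div_le_self hρ₀.le hR1)) (ρle hξR) h0
      simpa [mul_comm] using this
    suffices hν_im : ν.im = 0 by simp [hν_im]
    -- Three ranges follow: ν away from -s, which forces ν close to ν₀; the intermediate range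
    -- without zeros; and |ν+s| < aY, where the quadratic model applies.
    rcases lt_or_ge (|Γ| / 2) ‖ν + s‖ with hfar | hnear
    · have hcub : ∀ {x : ℂ}, ‖x‖ ≤ R →
          ‖X (x * ξ) ξ / ξ ^ 3 - -4 * (x - (ν₀ - Γ : ℝ)) ^ 2 * (ν₀ - x)‖ ≤ e₁ := by
        intro x hx
        have hns : ν₀ - Γ = -s := by rw [hΓdef]; ring
        rw [hns]
        refine (H.cubic hR1 (by linarith) a5 hξ0 hξR hx).trans ?_
        linarith
      have hsum : ∀ {x : ℂ}, x ∈ Metric.ball (ν₀ : ℂ) (|Γ| / 32 + |Γ| / 32) → ‖x‖ ≤ R := by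
        intro x hx
        rw [mem_ball_iff_norm] at hx
        have := norm_le_norm_add_norm_sub' x (ν₀ : ℂ)
        rw [Complex.norm_real, Real.norm_eq_abs] at this
        linarith
      -- Otherwise the cubic would have modulus at least |Γ|³/32, more than the error e₁ ≤ |Γ|³/128.
      have hclose : ‖ν - ν₀‖ < |Γ| / 32 := by
        by_contra! hcon
        have h1 := hcub hνR
        rw [h0, zero_div, zero_sub, norm_neg, norm_mul, norm_mul, norm_neg, Complex.norm_ofNat,
          norm_pow, norm_sub_rev (ν₀ : ℂ),
          show ν - ((ν₀ - Γ : ℝ) : ℂ) = ν + s by rw [hΓdef]; push_cast; ring] at h1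
        have h2 : 4 * (|Γ| / 2) ^ 2 * (|Γ| / 32) ≤ e₁ := le_trans (by gcongr) h1
        have := pow_pos hG 3
        have e5 : 4 * (|Γ| / 2) ^ 2 * (|Γ| / 32) = |Γ| ^ 3 / 32 := by ring
        linarith
      refine im_eq_zero_of_cubic (f := fun x => X (x * ξ) ξ / ξ ^ 3) hΓ e2' ?_
        (fun x hx => hcub (hsum hx)) hclose (by rw [h0, zero_div]) (by rw [h0', zero_div])
      intro x hx
      exact ((hXd hξR (f := fun x => x) (hsum hx)
        (by fun_prop)).div_const _).differentiableWithinAt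
    · rcases le_or_gt (a * Y) ‖ν + s‖ with hmid | hin
      · exact absurd h0 (H.ne_zero_of_intermediate hR1 (by linarith) hΓ ha hY1 hYb (by linarith)
          hξ0 hξR hνR hmid hnear)
      · have ha' : (a : ℂ) ≠ 0 := by exact_mod_cast ha.ne'
        obtain ⟨y, rfl⟩ : ∃ y : ℂ, ν = a * y - s := ⟨(ν + s) / a, by field_simp; ring⟩
        obtain ⟨hd, hc⟩ := hquad hξ0 hξR
        have hyY : ‖y‖ < Y := by
          rw [sub_add_cancel, norm_mul, Complex.norm_real, Real.norm_eq_abs, abs_of_pos ha] at hin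
          exact lt_of_mul_lt_mul_left hin ha.le
        have hstar : star ((a : ℂ) * y - s) = a * star y - s := by simp
        have := im_eq_zero_of_quadratic hKpos (by rwa [← hKa]) (by linarith) hd hc hyY
          (by rw [h0, zero_div]) (by rw [← hstar, h0', zero_div])
        simp [this]

end

end Whitham

/-! ### Analyticity, conjugation symmetry and the dichotomy for Fourier coefficients -/

namespace Whitham

noncomputable section

open EllTwo

variable {m : ℝ → ℝ} {κ δ L s q c : ℝ} {W : EllTwo →L[ℂ] EllTwo} {μ : ℂ} {ξ : ℝ}

namespace Perturbative

theorem differentiableAt_liftOp (h : Perturbative m κ δ L s q c W μ ξ) :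
    DifferentiableAt ℂ (fun z => liftOp m κ c W z ξ) μ := by
  have h1 : DifferentiableAt ℂ (fun z => 1 - highOp m κ c W z ξ) μ := by
    unfold highOp
    fun_prop
  exact DifferentiableAt.inverse h1 h.isUnit

theorem differentiableAt_dividedRow (n : ℤ) :
    DifferentiableAt ℂ (fun z => dividedRow m κ c W z ξ n) μ := by
  unfold dividedRow
  fun_prop

theorem differentiableAt_lowRow (i : Fin 3) :
    DifferentiableAt ℂ (fun z => lowRow m κ c W z ξ i) μ := by
  fin_cases i
  · exact (differentiableAt_dividedRow 1).sub (differentiableAt_dividedRow (-1))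
  · change DifferentiableAt ℂ (fun z => zeroRow m κ c W z ξ) μ
    unfold zeroRow
    fun_prop
  · exact (differentiableAt_dividedRow 1).add (differentiableAt_dividedRow (-1))

theorem differentiableAt_det (h : Perturbative m κ δ L s q c W μ ξ) :
    DifferentiableAt ℂ (fun z => (reducedMatrix m κ c W z ξ).det) μ := by
  have h1 : ∀ i j, DifferentiableAt ℂ (fun z => reducedMatrix m κ c W z ξ i j) μ := fun i j =>
    (differentiableAt_lowRow i).clm_apply
      (h.differentiableAt_liftOp.clm_apply (differentiableAt_const (lowVec j)))
  simp only [Matrix.det_fin_three]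
  fun_prop

end Perturbative

/-- Because the coefficients of the normalized wave are real, conjugation maps solutions for μ to
solutions for its conjugate at the same ξ. This supplies the conjugate pairs used in the root
analysis. -/
theorem spectralCoeff_star {v : EllTwo} (hW : IsConv W v) (hv : ∀ n, star (v n) = v n) (φ : EllTwo) (n : ℤ) :
    spectralCoeff m κ c W (star μ) ξ (star φ) n = star (spectralCoeff m κ c W μ ξ φ n) := by
  have h1 : W (star φ) n = star (W φ n) := by rw [hW.apply_star hv]; rfl
  have h2 : (star φ) n = star (φ n) := rfl
  simp only [spectralCoeff, h1, h2]
  simp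

namespace RegularSymbol

/-- The spectral problem near the origin for small waves, in terms of Fourier coefficients. -/
theorem exists_spectral_dichotomy (hm : RegularSymbol m κ δ L s q) (hΓ : m κ - m 0 + s ≠ 0)
    (hK : discriminant s q (m κ - m 0) (m κ - m (κ * 2))⁻¹ ≠ 0) :
    ∃ ε > 0, ∀ (c a : ℝ) (v : EllTwo) (W : EllTwo →L[ℂ] EllTwo), SmallWave m κ c ε a v W →
      (discriminant s q (m κ - m 0) (m κ - m (κ * 2))⁻¹ < 0 → ∀ δ' > 0, ∃ (ξ : ℝ) (μ : ℂ),
        |ξ| < δ' ∧ ‖μ‖ < δ' ∧ μ.im ≠ 0 ∧ ∃ φ ≠ 0, ∀ n, spectralCoeff m κ c W μ ξ φ n = 0) ∧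
      (0 < discriminant s q (m κ - m 0) (m κ - m (κ * 2))⁻¹ → ∃ δ' > 0, ∀ (ξ : ℝ) (μ : ℂ),
        |ξ| < δ' → ‖μ‖ < δ' → μ.im ≠ 0 →
        (∀ φ, (∀ n, spectralCoeff m κ c W μ ξ φ n = 0) → φ = 0) ∧
        ∃ R : EllTwo →L[ℂ] EllTwo, ∀ g n, spectralCoeff m κ c W μ ξ (R g) n = g n) := by
  obtain ⟨R, U, e, a₀, hR, he, ha₀, hroot⟩ := exists_root_dichotomy hΓ hK
  obtain ⟨η, hη, hclose⟩ := exists_detClose s q (m κ - m 0) (m κ - m (κ * 2))⁻¹ U hR he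
  -- The same parameter bounds both the model error and the amplitude, hence the minimum with `a₀`.
  obtain ⟨ε, hε, hnear⟩ := hm.exists_nearModel (η := min η a₀) (by positivity)
  refine ⟨ε, hε, fun c a v W hw => ?_⟩
  obtain ⟨haη, ρ₀, hρ₀, hmodel⟩ := hnear c a v W hw
  have hP : ∀ (μ : ℂ) (ξ : ℝ), ‖μ‖ ≤ ρ₀ → |ξ| ≤ ρ₀ → Perturbative m κ δ L s q c W μ ξ :=
    fun μ ξ hμ hξ => (hmodel μ ξ ρ₀ le_rfl hξ hμ).1
  have hD := hclose (min η a₀) a ρ₀ (fun μ ξ => reducedMatrix m κ c W μ ξ) (by positivity)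
    (min_le_left _ _) hw.pos (fun μ ξ ρ h1 h2 h3 => (hmodel μ ξ ρ h1 h2 h3).2)
  obtain ⟨hneg, hpos⟩ := hroot a ρ₀ _ hw.pos (haη.trans (min_le_right _ _)) hρ₀ hD
    (fun μ ξ hμ hξ => (hP μ ξ hμ hξ).differentiableAt_det)
  refine ⟨fun hK δ' hδ' => ?_, fun hK => ?_⟩
  · obtain ⟨ξ, μ, h1, h2, h3, h4, h5, h6⟩ := hneg hK δ' hδ'
    exact ⟨ξ, μ, h1, h2, h5, (hP μ ξ h4 h3).det_reducedMatrix_eq_zero_iff.mp h6⟩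
  · obtain ⟨δ', hδ', hle, himp⟩ := hpos hK (fun μ ξ hμ hξ h0 => by
      obtain ⟨φ, hφ, hs⟩ := (hP μ ξ hμ hξ).det_reducedMatrix_eq_zero_iff.mp h0
      refine (hP (star μ) ξ (by rwa [norm_star]) hξ).det_reducedMatrix_eq_zero_iff.mpr
        ⟨star φ, star_ne_zero.mpr hφ, fun n => ?_⟩
      rw [spectralCoeff_star hw.conv hw.real, hs, star_zero])
    refine ⟨δ', hδ', fun ξ μ hξ hμ him => ?_⟩
    have hp := hP μ ξ (hμ.le.trans hle) (hξ.le.trans hle)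
    have hdet : (reducedMatrix m κ c W μ ξ).det ≠ 0 := fun h0 => him (himp ξ μ hξ hμ h0)
    refine ⟨fun φ hφ => ?_, hp.exists_solution_operator hdet⟩
    by_contra hne
    exact hdet (hp.det_reducedMatrix_eq_zero_iff.mpr ⟨φ, hne, hφ⟩)

end RegularSymbol

end

end Whitham

namespace Whitham

noncomputable section

open EllTwo

/-! ### Normalization of the wave -/

/-- The Fourier coefficients `v` of a traveling wave with speed `c`. -/
structure WaveSequence (m : ℝ → ℝ) (κ c : ℝ) (v : EllTwo) (W : EllTwo →L[ℂ] EllTwo) : Prop where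
  conv : IsConv W v
  star_apply : ∀ n, star (v n) = v (-n)
  equation : ∀ n : ℤ, n ≠ 0 → ((c - m (κ * n) : ℝ) : ℂ) * v n = W v n
  derivative : Memℓp (fun n : ℤ => (n : ℂ) * v n) 2

/-- The phase shift `φ n ↦ u ^ n φ n`. -/
def phaseShift (u : ℂ) : EllTwo →L[ℂ] EllTwo := diagOp fun n => u ^ n

theorem norm_zpow_le_one {u : ℂ} (hu : ‖u‖ = 1) (n : ℤ) : ‖u ^ n‖ ≤ 1 := by
  rw [norm_zpow, hu, one_zpow]

theorem phaseShift_apply {u : ℂ} (hu : ‖u‖ = 1) (φ : EllTwo) (n : ℤ) :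
    phaseShift u φ n = u ^ n * φ n := diagOp_apply (norm_zpow_le_one hu) φ n

theorem norm_phaseShift_le {u : ℂ} (hu : ‖u‖ = 1) : ‖phaseShift u‖ ≤ 1 :=
  norm_diagOp_le (norm_zpow_le_one hu)

theorem ne_zero_of_norm_eq_one {u : ℂ} (hu : ‖u‖ = 1) : u ≠ 0 := by
  rintro rfl; simp at hu

theorem phaseShift_inv_apply {u : ℂ} (hu : ‖u‖ = 1) (φ : EllTwo) (n : ℤ) :
    phaseShift u⁻¹ φ n = (u ^ n)⁻¹ * φ n := by
  rw [phaseShift_apply (by simp [hu]), inv_zpow]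

theorem phaseShift_phaseShift_inv {u : ℂ} (hu : ‖u‖ = 1) (φ : EllTwo) :
    phaseShift u (phaseShift u⁻¹ φ) = φ := by
  ext n
  rw [phaseShift_apply hu, phaseShift_inv_apply hu]
  have := zpow_ne_zero n (ne_zero_of_norm_eq_one hu)
  field_simp

theorem phaseShift_inv_phaseShift {u : ℂ} (hu : ‖u‖ = 1) (φ : EllTwo) :
    phaseShift u⁻¹ (phaseShift u φ) = φ := by
  ext n
  rw [phaseShift_inv_apply hu, phaseShift_apply hu]
  have := zpow_ne_zero n (ne_zero_of_norm_eq_one hu)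
  field_simp

/-- The coefficients after a phase shift and after subtraction of the mean. -/
def normalizedSeq (u : ℂ) (v : EllTwo) : EllTwo := phaseShift u v - v 0 • unitSeq 0

def normalizedConv (u : ℂ) (v : EllTwo) (W : EllTwo →L[ℂ] EllTwo) : EllTwo →L[ℂ] EllTwo :=
  (phaseShift u).comp (W.comp (phaseShift u⁻¹)) - v 0 • ContinuousLinearMap.id ℂ EllTwo

theorem normalizedSeq_apply {u : ℂ} (hu : ‖u‖ = 1) (v : EllTwo) (n : ℤ) :
    normalizedSeq u v n = if n = 0 then 0 else u ^ n * v n := by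
  have e : normalizedSeq u v n = phaseShift u v n - v 0 * unitSeq 0 n := rfl
  rw [e, phaseShift_apply hu, unitSeq_apply]
  split_ifs with h
  · rw [h]; simp
  · ring

theorem normalizedConv_apply {u : ℂ} (hu : ‖u‖ = 1) (v : EllTwo) (W : EllTwo →L[ℂ] EllTwo)
    (φ : EllTwo) (n : ℤ) :
    normalizedConv u v W φ n = u ^ n * W (phaseShift u⁻¹ φ) n - v 0 * φ n := by
  have e : normalizedConv u v W φ n
      = phaseShift u (W (phaseShift u⁻¹ φ)) n - v 0 * φ n := rfl
  rw [e, phaseShift_apply hu]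

theorem norm_normalizedConv_le {u : ℂ} (hu : ‖u‖ = 1) {v : EllTwo} {W : EllTwo →L[ℂ] EllTwo}
    (hW : IsConv W v) : ‖normalizedConv u v W‖ ≤ 2 * ‖W‖ := by
  have hu' : ‖u⁻¹‖ = 1 := by simp [hu]
  have h1 : ‖(phaseShift u).comp (W.comp (phaseShift u⁻¹))‖ ≤ ‖W‖ := by
    calc _ ≤ ‖phaseShift u‖ * (‖W‖ * ‖phaseShift u⁻¹‖) :=
          (ContinuousLinearMap.opNorm_comp_le _ _).trans (by
            gcongr; exact ContinuousLinearMap.opNorm_comp_le _ _)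
      _ ≤ 1 * (‖W‖ * 1) := by
          gcongr
          exacts [norm_phaseShift_le hu, norm_phaseShift_le hu']
      _ = ‖W‖ := by ring
  have h2 : ‖v 0 • ContinuousLinearMap.id ℂ EllTwo‖ ≤ ‖W‖ := by
    rw [norm_smul]
    calc ‖v 0‖ * ‖ContinuousLinearMap.id ℂ EllTwo‖ ≤ ‖v 0‖ * 1 := by
          gcongr; exact ContinuousLinearMap.norm_id_le
      _ ≤ ‖W‖ := by rw [mul_one]; exact (norm_apply_le v 0).trans hW.norm_le_norm
  exact (norm_sub_le _ _).trans (by linarith)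

/-- A mean v₀ in the wave acts on φ as multiplication by 2v₀, which is the same as lowering the
speed; the translation only multiplies the n-th equation by uⁿ. -/
theorem spectralCoeff_normalized {m : ℝ → ℝ} {κ c : ℝ} {v : EllTwo} {W : EllTwo →L[ℂ] EllTwo}
    {u : ℂ} (hu : ‖u‖ = 1) (hv : star (v 0) = v 0) (μ : ℂ) (ξ : ℝ) (φ : EllTwo) (n : ℤ) :
    spectralCoeff m κ (c - 2 * (v 0).re) (normalizedConv u v W) μ ξ (phaseShift u φ) n
      = u ^ n * spectralCoeff m κ c W μ ξ φ n := by
  have hre : ((v 0).re : ℂ) = v 0 := Complex.conj_eq_iff_re.mp hv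
  rw [spectralCoeff, spectralCoeff, normalizedConv_apply hu, phaseShift_inv_phaseShift hu,
    phaseShift_apply hu]
  push_cast
  rw [hre]
  ring

namespace WaveSequence

variable {m : ℝ → ℝ} {κ δ L s q c : ℝ} {v : EllTwo} {W : EllTwo →L[ℂ] EllTwo}

theorem isConv_normalized (h : IsConv W v) {u : ℂ} (hu : ‖u‖ = 1) :
    IsConv (normalizedConv u v W) (normalizedSeq u v) := by
  intro φ n
  rw [normalizedConv_apply hu]
  have hu0 := ne_zero_of_norm_eq_one hu
  have h1 := (h (phaseShift u⁻¹ φ) n).mul_left (u ^ n)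
  have h2 : HasSum (fun j => v 0 * unitSeq 0 (n - j) * φ j) (v 0 * φ n) := by
    have := hasSum_single (f := fun j => v 0 * unitSeq 0 (n - j) * φ j) n (fun j hj => by
      rw [unitSeq_apply, if_neg (by omega), mul_zero, zero_mul])
    simpa [unitSeq_apply] using this
  refine (h1.sub h2).congr_fun fun j => ?_
  have e : normalizedSeq u v (n - j) = phaseShift u v (n - j) - v 0 * unitSeq 0 (n - j) := rfl
  rw [e, phaseShift_apply hu, phaseShift_inv_apply hu, zpow_sub₀ hu0]
  have := zpow_ne_zero j hu0
  field_simp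

/-- Away from n = 0, removing the mean changes v∗v by -2v₀v, which the new speed c - 2v₀
compensates. -/
theorem normalized (h : WaveSequence m κ c v W) {u : ℂ} (hu : ‖u‖ = 1) :
    WaveSequence m κ (c - 2 * (v 0).re) (normalizedSeq u v) (normalizedConv u v W) where
  conv := isConv_normalized h.conv hu
  star_apply n := by
    rw [normalizedSeq_apply hu, normalizedSeq_apply hu]
    rcases eq_or_ne n 0 with rfl | hn
    · simp
    · rw [if_neg hn, if_neg (neg_ne_zero.mpr hn), star_mul', h.star_apply, star_zpow₀, zpow_neg,
        ← inv_zpow]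
      congr 2
      exact (Complex.inv_eq_conj hu).symm
  equation n hn := by
    have hre : ((v 0).re : ℂ) = v 0 := Complex.conj_eq_iff_re.mp (by
      simpa using h.star_apply 0)
    have e : phaseShift u⁻¹ (normalizedSeq u v) = v - v 0 • unitSeq 0 := by
      rw [normalizedSeq, map_sub, phaseShift_inv_phaseShift hu, map_smul]
      congr 2
      ext j
      rw [phaseShift_inv_apply hu, unitSeq_apply]
      split_ifs with hj
      · rw [hj]; simp
      · simp
    have e2 : W (v - v 0 • unitSeq 0) n = W v n - v 0 * W (unitSeq 0) n := by
      rw [map_sub, map_smul]; rfl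
    rw [normalizedConv_apply hu, e, e2, h.conv.apply_unitSeq_apply, sub_zero, ← h.equation n hn,
      normalizedSeq_apply hu, if_neg hn]
    push_cast
    rw [hre]
    ring
  derivative := by
    have h0 := memℓp_iff.mp h.derivative
    refine memℓp_iff.mpr (h0.congr fun n => ?_)
    rw [normalizedSeq_apply hu]
    rcases eq_or_ne n 0 with rfl | hn
    · simp
    · rw [if_neg hn, norm_mul, norm_mul, norm_mul, norm_zpow, hu, one_zpow, one_mul]

theorem norm_le_of_high {d x : EllTwo} (hδ : 0 < δ) (hgap : ∀ n : ℤ, 2 ≤ |n| → δ ≤ |m (κ * n) - m κ|)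
    (hc : |c - m κ| ≤ δ / 2) (h0 : ∀ n : ℤ, ¬ 2 ≤ |n| → d n = 0)
    (h : ∀ n : ℤ, 2 ≤ |n| → ((c - m (κ * n) : ℝ) : ℂ) * d n = x n) : ‖d‖ ≤ 2 / δ * ‖x‖ := by
  refine norm_le_of_forall (by positivity) fun n => ?_
  by_cases hn : 2 ≤ |n|
  · have h1 := hgap n hn
    have h2 : δ / 2 ≤ |c - m (κ * n)| := by
      have h3 := abs_sub_le (m (κ * n)) c (m κ)
      rw [abs_sub_comm (m (κ * n)) c] at h3
      linarith
    rw [← h n hn, norm_mul, Complex.norm_real, Real.norm_eq_abs]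
    calc ‖d n‖ = 2 / δ * (δ / 2 * ‖d n‖) := by field_simp
      _ ≤ _ := by gcongr
  · rw [h0 n hn, norm_zero]; positivity

/-- With no low modes left, the wave equation is a contraction: ‖v‖ ≤ ‖v‖/8. -/
theorem eq_zero_of_apply_one (hm : RegularSymbol m κ δ L s q) (h : WaveSequence m κ c v W)
    (hW : ‖W‖ ≤ δ / 16) (hc : |c - m κ| ≤ δ / 2) (h0 : v 0 = 0) (h1 : v 1 = 0) : v = 0 := by
  have hδ := hm.gap_pos
  have hm1 : v (-1) = 0 := by rw [← h.star_apply, h1, star_zero]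
  have hb := norm_le_of_high (d := v) (x := W v) hδ hm.gap hc (fun n hn => by
    rcases int_cases_abs_lt_two hn with rfl | rfl | rfl <;> assumption)
    (fun n hn => h.equation n (by rintro rfl; norm_num at hn))
  have h2 : 2 / δ * ‖W v‖ ≤ 1 / 8 * ‖v‖ := by
    calc 2 / δ * ‖W v‖ ≤ 2 / δ * (δ / 16 * ‖v‖) := by
          gcongr; exact W.le_of_opNorm_le hW v
      _ = 1 / 8 * ‖v‖ := by field_simp; ring
  rw [← norm_eq_zero]
  linarith [norm_nonneg v]

/-- The difference d of the wave and its reflection has no low modes, since v₁ is real, and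
satisfies a linear equation with small coefficients. Hence ‖d‖ ≤ ‖d‖/4 and d = 0. -/
theorem even_of_star_apply_one (hm : RegularSymbol m κ δ L s q) (h : WaveSequence m κ c v W)
    (hW : ‖W‖ ≤ δ / 16) (hc : |c - m κ| ≤ δ / 2) (h1 : star (v 1) = v 1) (n : ℤ) :
    v (-n) = v n := by
  have hδ := hm.gap_pos
  let J : EllTwo →L[ℂ] EllTwo := LinearMap.mkContinuous
    { toFun := reflect
      map_add' := fun _ _ => rfl
      map_smul' := fun _ _ => rfl } 1 (fun x => by
        rw [one_mul]; exact (norm_reflect x).le)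
  have hJ : ∀ x n, J x n = x (-n) := fun _ _ => rfl
  have hJn : ∀ x, ‖J x‖ = ‖x‖ := norm_reflect
  let V : EllTwo →L[ℂ] EllTwo := J.comp (W.comp J)
  have hV : IsConv V (J v) := fun φ n => by
    refine ((Equiv.neg ℤ).hasSum_iff.2 (h.conv (J φ) (-n))).congr_fun fun j => ?_
    simp only [Function.comp, Equiv.neg_apply, hJ, neg_neg]
    rw [show -n - -j = -(n - j) by ring]
  have hVn : ∀ x, ‖V x‖ ≤ δ / 16 * ‖x‖ := fun x => by
    calc ‖V x‖ = ‖W (J x)‖ := hJn _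
      _ ≤ δ / 16 * ‖J x‖ := W.le_of_opNorm_le hW _
      _ = δ / 16 * ‖x‖ := by rw [hJn]
  set d := v - J v with hd
  have hdn : ∀ n, d n = v n - v (-n) := fun _ => rfl
  -- This is w² - ŵ² = (w + ŵ)(w - ŵ) for the reflected wave ŵ; the mixed terms cancel because
  -- convolution commutes.
  have hx : W v - V (J v) = W d + V d := by
    rw [hd, map_sub, map_sub, h.conv.comm hV]
    abel
  have hb := norm_le_of_high (d := d) (x := W d + V d) hδ hm.gap hc (fun n hn => by
    rcases int_cases_abs_lt_two hn with rfl | rfl | rfl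
    · rw [hdn, ← h.star_apply, h1, sub_self]
    · rw [hdn, neg_zero, sub_self]
    · rw [hdn, neg_neg, ← h.star_apply, h1, sub_self])
    (fun n hn => by
      have hn0 : n ≠ 0 := by rintro rfl; norm_num at hn
      have e1 : (W v - V (J v)) n = W v n - W (J (J v)) (-n) := rfl
      have e2 : J (J v) = v := by ext j; rw [hJ, hJ, neg_neg]
      have e3 := h.equation (-n) (neg_ne_zero.mpr hn0)
      have e4 : m (κ * ((-n : ℤ) : ℝ)) = m (κ * n) := by
        rw [Int.cast_neg, mul_neg, hm.even]
      rw [e4] at e3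
      rw [← hx, e1, e2, ← h.equation n hn0, ← e3, hdn, mul_sub])
  have h2 : 2 / δ * ‖W d + V d‖ ≤ 1 / 4 * ‖d‖ := by
    calc 2 / δ * ‖W d + V d‖ ≤ 2 / δ * (δ / 16 * ‖d‖ + δ / 16 * ‖d‖) := by
          gcongr; exact norm_add_le_of_le (W.le_of_opNorm_le hW d) (hVn d)
      _ = 1 / 4 * ‖d‖ := by field_simp; ring
  have hd0 : d = 0 := by
    rw [← norm_eq_zero]
    linarith [norm_nonneg d]
  have := hdn n
  rw [hd0] at this
  exact (sub_eq_zero.mp this.symm).symm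

/-- A small nonconstant wave is, after a phase shift and subtraction of its mean, even and real
with a positive fundamental mode. -/
theorem exists_smallWave (hm : RegularSymbol m κ δ L s q) (h : WaveSequence m κ c v W) {ε : ℝ}
    (hε : ε ≤ δ / 32) (hW : ‖W‖ ≤ ε) (hc : |c - m κ| ≤ ε) (hne : ∃ n : ℤ, n ≠ 0 ∧ v n ≠ 0) :
    ∃ u : ℂ, ‖u‖ = 1 ∧ ∃ a : ℝ,
      SmallWave m κ (c - 2 * (v 0).re) (3 * ε) a (normalizedSeq u v) (normalizedConv u v W) := by
  have hδ := hm.gap_pos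
  -- The factor 3 is ε from the speed and 2ε from the mean.
  have hc' : |c - 2 * (v 0).re - m κ| ≤ 3 * ε := by
    have h1 : |(v 0).re| ≤ ε :=
      (Complex.abs_re_le_norm _).trans ((norm_apply_le v 0).trans (h.conv.norm_le_norm.trans hW))
    rw [abs_le] at hc h1 ⊢
    constructor <;> linarith [hc.1, hc.2, h1.1, h1.2]
  have hWn : ∀ {u : ℂ}, ‖u‖ = 1 → ‖normalizedConv u v W‖ ≤ 2 * ε := fun hu =>
    (norm_normalizedConv_le hu h.conv).trans (by linarith)
  have hz : ∀ {u : ℂ}, ‖u‖ = 1 → normalizedSeq u v 0 = 0 := fun hu => by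
    rw [normalizedSeq_apply hu, if_pos rfl]
  have ho : ∀ {u : ℂ}, ‖u‖ = 1 → normalizedSeq u v 1 = u * v 1 := fun hu => by
    rw [normalizedSeq_apply hu, if_neg one_ne_zero, zpow_one]
  -- If the fundamental mode vanished, all nonconstant modes would vanish by contraction.
  have hv1 : v 1 ≠ 0 := by
    intro h0
    obtain ⟨n, hn, hvn⟩ := hne
    have := (h.normalized norm_one).eq_zero_of_apply_one hm ((hWn norm_one).trans (by linarith))
      (hc'.trans (by linarith)) (hz norm_one) (by rw [ho norm_one, h0, mul_zero])
    have h2 := normalizedSeq_apply norm_one v n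
    rw [this, if_neg hn, one_zpow, one_mul] at h2
    exact hvn h2.symm
  have hn1 : 0 < ‖v 1‖ := norm_pos_iff.mpr hv1
  have hn1' : (‖v 1‖ : ℂ) ≠ 0 := by exact_mod_cast hn1.ne'
  set u : ℂ := ‖v 1‖ / v 1 with hudef
  have hu : ‖u‖ = 1 := by rw [hudef, norm_div]; simp [hn1.ne']
  have hamp : normalizedSeq u v 1 = (‖v 1‖ : ℂ) := by
    rw [ho hu, hudef, div_mul_cancel₀ _ hv1]
  have hN := h.normalized hu
  have heven := hN.even_of_star_apply_one hm ((hWn hu).trans (by linarith))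
    (hc'.trans (by linarith)) (by rw [hamp]; simp)
  exact ⟨u, hu, ‖v 1‖,
    { conv := hN.conv
      real := fun n => by rw [hN.star_apply, heven]
      even := heven
      mean := hz hu
      amplitude := hamp
      pos := hn1
      norm_le := (hWn hu).trans (by linarith [(norm_nonneg _).trans hW])
      speed := hc'
      equation := hN.equation
      derivative := hN.derivative }⟩

end WaveSequence

end

end Whitham

namespace Whitham

noncomputable section

open EllTwo

/-! ### Fourier coefficients of traveling waves -/

/-- The Fourier isomorphism. -/
def fourierEquiv : L2per ≃ₗᵢ[ℂ] EllTwo := fourierBasis.repr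

theorem fourierEquiv_apply (φ : L2per) (n : ℤ) : fourierEquiv φ n = fourierCoeff φ n :=
  fourierBasis_repr φ n

/-- The complexification of a real function on the circle. -/
def complexify (w : C(AddCircle (2 * π), ℝ)) : C(AddCircle (2 * π), ℂ) :=
  ⟨fun x => (w x : ℂ), by fun_prop⟩

/-- The Fourier coefficients of a continuous function, as a continuous linear map. -/
def coefL : C(AddCircle (2 * π), ℂ) →L[ℂ] EllTwo :=
  fourierEquiv.toLinearIsometry.toContinuousLinearMap.comp
    (ContinuousMap.toLp 2 haarAddCircle ℂ)

theorem coefL_apply (f : C(AddCircle (2 * π), ℂ)) (n : ℤ) : coefL f n = fourierCoeff f n := by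
  have : coefL f n = fourierEquiv (ContinuousMap.toLp 2 haarAddCircle ℂ f) n := rfl
  rw [this, fourierEquiv_apply]
  exact integral_congr_ae ((ContinuousMap.coeFn_toLp (p := 2) (𝕜 := ℂ) haarAddCircle f).mono fun x hx => by
    simp only [hx])

def waveSeq (w : C(AddCircle (2 * π), ℝ)) : EllTwo := coefL (complexify w)

theorem waveSeq_apply (w : C(AddCircle (2 * π), ℝ)) (n : ℤ) :
    waveSeq w n = fourierCoeff (fun x => (w x : ℂ)) n := coefL_apply _ n

def waveConv (w : C(AddCircle (2 * π), ℝ)) : EllTwo →L[ℂ] EllTwo :=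
  fourierEquiv.toLinearIsometry.toContinuousLinearMap.comp
    ((mulOp w).comp
      fourierEquiv.symm.toLinearIsometry.toContinuousLinearMap)

theorem waveConv_repr (w : C(AddCircle (2 * π), ℝ)) (φ : L2per) :
    waveConv w (fourierEquiv φ) = fourierEquiv (mulOp w φ) := by
  have : waveConv w (fourierEquiv φ)
      = fourierEquiv (mulOp w (fourierEquiv.symm (fourierEquiv φ))) := rfl
  rw [this, LinearIsometryEquiv.symm_apply_apply]

theorem norm_waveConv_le (w : C(AddCircle (2 * π), ℝ)) : ‖waveConv w‖ ≤ ‖w‖ := by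
  refine ContinuousLinearMap.opNorm_le_bound _ (norm_nonneg _) fun x => ?_
  obtain ⟨φ, rfl⟩ := fourierEquiv.surjective x
  rw [waveConv_repr, LinearIsometryEquiv.norm_map, LinearIsometryEquiv.norm_map]
  refine Lp.norm_le_mul_norm_of_ae_le_mul ((coeFn_mulOp w φ).mono fun x hx => ?_)
  rw [hx, norm_mul, Complex.norm_real]
  gcongr
  exact w.norm_coe_le_norm x

theorem fourierCoeff_mulOp_fourierLp (w : C(AddCircle (2 * π), ℝ)) (j n : ℤ) :
    fourierCoeff (mulOp w (fourierLp 2 j)) n = waveSeq w (n - j) := by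
  rw [waveSeq_apply]
  refine integral_congr_ae ?_
  filter_upwards [coeFn_mulOp w (fourierLp 2 j), coeFn_fourierLp 2 j] with x h1 h2
  rw [h1, h2, show -(n - j) = -n + j by ring, fourier_add, smul_eq_mul, smul_eq_mul]
  ring

theorem isConv_waveConv (w : C(AddCircle (2 * π), ℝ)) : IsConv (waveConv w) (waveSeq w) := by
  intro x n
  obtain ⟨φ, rfl⟩ := fourierEquiv.surjective x
  have h1 := ((fourierBasis (T := 2 * π)).hasSum_repr φ).mapL
    ((evalAt n).comp ((waveConv w).comp
      fourierEquiv.toLinearIsometry.toContinuousLinearMap))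
  refine h1.congr_fun fun j => ?_
  have e : ∀ ψ : L2per, ((evalAt n).comp ((waveConv w).comp
      fourierEquiv.toLinearIsometry.toContinuousLinearMap)) ψ
      = fourierCoeff (mulOp w ψ) n := fun ψ => by
    rw [← fourierEquiv_apply, ← waveConv_repr]; rfl
  rw [map_smul, e, coe_fourierBasis, fourierCoeff_mulOp_fourierLp, smul_eq_mul, mul_comm]
  rfl

theorem star_waveSeq (w : C(AddCircle (2 * π), ℝ)) (n : ℤ) :
    star (waveSeq w n) = waveSeq w (-n) := by
  rw [waveSeq_apply, waveSeq_apply, fourierCoeff, fourierCoeff]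
  change (starRingEnd ℂ) _ = _
  rw [← integral_conj]
  congr 1
  ext x
  rw [smul_eq_mul, smul_eq_mul, map_mul, Complex.conj_ofReal, neg_neg, ← fourier_neg, neg_neg]

theorem coefL_fourier_apply (j n : ℤ) : coefL (fourier j) n = unitSeq j n := by
  have : coefL (fourier j) = fourierEquiv (fourierLp 2 j) := rfl
  rw [this, ← coe_fourierBasis, fourierEquiv, HilbertBasis.repr_self]
  rfl

theorem coefL_mul (w : C(AddCircle (2 * π), ℝ)) :
    coefL (complexify w * complexify w) = waveConv w (waveSeq w) := by
  have h : ContinuousMap.toLp 2 haarAddCircle ℂ (complexify w * complexify w)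
      = mulOp w (ContinuousMap.toLp 2 haarAddCircle ℂ (complexify w)) := by
    apply Lp.ext
    filter_upwards [coeFn_mulOp w (ContinuousMap.toLp 2 haarAddCircle ℂ (complexify w)),
      ContinuousMap.coeFn_toLp (p := 2) (𝕜 := ℂ) haarAddCircle (complexify w),
      ContinuousMap.coeFn_toLp (p := 2) (𝕜 := ℂ) haarAddCircle (complexify w * complexify w)]
      with x h1 h2 h3
    rw [h1, h2, h3]
    rfl
  have e1 : coefL (complexify w * complexify w)
      = fourierEquiv (ContinuousMap.toLp 2 haarAddCircle ℂ (complexify w * complexify w)) :=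
    rfl
  rw [e1, h, ← waveConv_repr]
  rfl

/-- A pointwise convergent Fourier series of a continuous function has its Fourier coefficients. -/
theorem fourierCoeff_eq_of_hasSum {a : ℤ → ℂ} {f : C(AddCircle (2 * π), ℂ)}
    (h : ∀ z, HasSum (fun n : ℤ => a n * fourier n z) (f z)) (n : ℤ) : coefL f n = a n := by
  -- At z = 0 every exponential equals 1, so convergence at this single point already gives absolute
  -- summability and hence uniform convergence.
  have ha : Summable fun n => ‖a n‖ := by
    have := (h 0).summable.norm
    simpa using this
  have hs : Summable fun n : ℤ => a n • (fourier n : C(AddCircle (2 * π), ℂ)) := by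
    refine Summable.of_norm (ha.congr fun n => ?_)
    rw [norm_smul, fourier_norm, mul_one]
  obtain ⟨F, hF⟩ := hs
  have hFf : F = f := by
    ext z
    have h1 := hF.mapL (ContinuousMap.evalCLM ℂ z)
    exact h1.unique (h z)
  have h2 := hF.mapL ((evalAt n).comp coefL)
  rw [hFf] at h2
  refine h2.unique ?_
  have h3 := hasSum_single (f := fun j => ((evalAt n).comp coefL)
    (a j • (fourier j : C(AddCircle (2 * π), ℂ)))) n (fun j hj => by
      rw [map_smul, ContinuousLinearMap.comp_apply, evalAt_apply, coefL_fourier_apply,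
        unitSeq_apply, if_neg hj.symm, smul_zero])
  simpa [coefL_fourier_apply, unitSeq_apply] using h3

/-- The constant B contributes only to the zeroth Fourier coefficient. -/
theorem IsTravelingWave.coefficient_equation {m : ℝ → ℝ} {κ c : ℝ} {w : C(AddCircle (2 * π), ℝ)}
    (h : IsTravelingWave m κ c w) {n : ℤ} (hn : n ≠ 0) :
    ((c - m (κ * n) : ℝ) : ℂ) * waveSeq w n = waveConv w (waveSeq w) n := by
  obtain ⟨B, hB⟩ := h.equation
  let f : C(AddCircle (2 * π), ℂ) := (c : ℂ) • complexify w - complexify w * complexify w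
    + (B : ℂ) • (fourier 0 : C(AddCircle (2 * π), ℂ))
  have hf := fourierCoeff_eq_of_hasSum (f := f)
    (a := fun n => (m (κ * n) : ℂ) * fourierCoeff (fun x => (w x : ℂ)) n) (fun z => by
      convert hB z using 1
      simp [f, complexify, sq]) n
  have e : coefL f n = c * waveSeq w n - waveConv w (waveSeq w) n + B * unitSeq 0 n := by
    rw [← coefL_mul, ← coefL_fourier_apply]
    simp only [f, map_add, map_sub, map_smul]
    rfl
  rw [e, unitSeq_apply, if_neg hn, ← waveSeq_apply] at hf
  push_cast
  linear_combination hf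

/-! ### Spectrum and Fourier coefficients -/

theorem spectralCoeff_sub {m : ℝ → ℝ} {κ c : ℝ} {W : EllTwo →L[ℂ] EllTwo} {μ : ℂ} {ξ : ℝ}
    (φ ψ : EllTwo) (n : ℤ) : spectralCoeff m κ c W μ ξ (φ - ψ) n
      = spectralCoeff m κ c W μ ξ φ n - spectralCoeff m κ c W μ ξ ψ n := by
  simp only [spectralCoeff, map_sub, EllTwo.sub_apply]
  ring

/-- The dictionary λ = iμ between the two forms of the spectral problem; Re λ ≠ 0 corresponds to Im
μ ≠ 0. -/
theorem mul_sub_blochCoeff {m : ℝ → ℝ} {κ c : ℝ} {w : C(AddCircle (2 * π), ℝ)} {μ : ℂ} {ξ : ℝ}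
    (φ : L2per) (n : ℤ) : Complex.I * μ * fourierEquiv φ n - blochCoeff m κ c w ξ φ n
      = -Complex.I * spectralCoeff m κ c (waveConv w) μ ξ (fourierEquiv φ) n := by
  rw [blochCoeff, spectralCoeff, waveConv_repr, fourierEquiv_apply, fourierEquiv_apply]
  ring

theorem fourierEquiv_blochOp {m : ℝ → ℝ} {κ c : ℝ} {w : C(AddCircle (2 * π), ℝ)} {ξ : ℝ}
    (φ : (blochOp m κ c w ξ).domain) (n : ℤ) :
    fourierEquiv (blochOp m κ c w ξ φ) n = blochCoeff m κ c w ξ φ n := by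
  have : blochOp m κ c w ξ φ = fourierEquiv.symm ⟨blochCoeff m κ c w ξ φ, φ.2⟩ := rfl
  rw [this, LinearIsometryEquiv.apply_symm_apply]

theorem mem_unboundedSpectrum_blochOp {m : ℝ → ℝ} {κ c : ℝ} {w : C(AddCircle (2 * π), ℝ)} {μ : ℂ}
    {ξ : ℝ} {x : EllTwo} (hx : x ≠ 0) (h : ∀ n, spectralCoeff m κ c (waveConv w) μ ξ x n = 0) :
    Complex.I * μ ∈ unboundedSpectrum (blochOp m κ c w ξ) := by
  rintro ⟨R, -, hR⟩
  obtain ⟨φ, rfl⟩ := fourierEquiv.surjective x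
  have hb : ∀ n, blochCoeff m κ c w ξ φ n = Complex.I * μ * fourierEquiv φ n := fun n => by
    have := mul_sub_blochCoeff (m := m) (κ := κ) (c := c) (w := w) (μ := μ) (ξ := ξ) φ n
    rw [h, mul_zero, sub_eq_zero] at this
    exact this.symm
  have hmem : φ ∈ (blochOp m κ c w ξ).domain := by
    change Memℓp (blochCoeff m κ c w ξ φ) 2
    rw [funext hb]
    exact (lp.memℓp (fourierEquiv φ)).const_smul (Complex.I * μ)
  have h0 : (Complex.I * μ) • φ - blochOp m κ c w ξ ⟨φ, hmem⟩ = 0 := by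
    apply fourierEquiv.injective
    ext n
    rw [map_sub, EllTwo.sub_apply, fourierEquiv_blochOp, hb, map_smul, EllTwo.smul_apply, sub_self,
      map_zero]
    rfl
  have h1 := hR ⟨φ, hmem⟩
  rw [h0, map_zero] at h1
  exact hx (by rw [show φ = 0 from h1.symm, map_zero])

theorem notMem_unboundedSpectrum_blochOp {m : ℝ → ℝ} {κ c : ℝ} {w : C(AddCircle (2 * π), ℝ)}
    {μ : ℂ} {ξ : ℝ} (hinj : ∀ x, (∀ n, spectralCoeff m κ c (waveConv w) μ ξ x n = 0) → x = 0)
    (hsol : ∃ R : EllTwo →L[ℂ] EllTwo, ∀ g n,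
      spectralCoeff m κ c (waveConv w) μ ξ (R g) n = g n) :
    Complex.I * μ ∉ unboundedSpectrum (blochOp m κ c w ξ) := by
  obtain ⟨R, hR⟩ := hsol
  refine not_not.mpr ?_
  let S : L2per →L[ℂ] L2per := fourierEquiv.symm.toLinearIsometry.toContinuousLinearMap.comp
    ((Complex.I • R).comp fourierEquiv.toLinearIsometry.toContinuousLinearMap)
  have hS : ∀ f, fourierEquiv (S f) = R (Complex.I • fourierEquiv f) := fun f => by
    have : S f = fourierEquiv.symm (Complex.I • R (fourierEquiv f)) := rfl
    rw [this, LinearIsometryEquiv.apply_symm_apply, map_smul]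
  have hb : ∀ f n, Complex.I * μ * fourierEquiv (S f) n - blochCoeff m κ c w ξ (S f) n
      = fourierEquiv f n := fun f n => by
    rw [mul_sub_blochCoeff, hS, hR, EllTwo.smul_apply, ← mul_assoc, neg_mul, Complex.I_mul_I,
      neg_neg, one_mul]
  refine ⟨S, fun f => ?_, fun φ => ?_⟩
  · have hmem : S f ∈ (blochOp m κ c w ξ).domain := by
      change Memℓp (blochCoeff m κ c w ξ (S f)) 2
      -- The resolvent equation expresses the image of S f through S f and f, both square-summable;
      -- so S f lies in the maximal domain.
      have e : blochCoeff m κ c w ξ (S f)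
          = ((Complex.I * μ) • fourierEquiv (S f) - fourierEquiv f : EllTwo) := by
        ext n
        rw [EllTwo.sub_apply, EllTwo.smul_apply]
        linear_combination -hb f n
      rw [e]
      exact lp.memℓp _
    refine ⟨hmem, fourierEquiv.injective ?_⟩
    ext n
    rw [map_sub, EllTwo.sub_apply, fourierEquiv_blochOp, map_smul, EllTwo.smul_apply, hb]
  · set f := (Complex.I * μ) • (φ : L2per) - blochOp m κ c w ξ φ with hf
    apply fourierEquiv.injective
    rw [← sub_eq_zero]
    refine hinj _ fun n => ?_
    have h1 := hb f n
    have h2 : fourierEquiv f n = Complex.I * μ * fourierEquiv (φ : L2per) n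
        - blochCoeff m κ c w ξ φ n := by
      rw [hf, map_sub, EllTwo.sub_apply, fourierEquiv_blochOp, map_smul, EllTwo.smul_apply]
    rw [h2, mul_sub_blochCoeff, mul_sub_blochCoeff] at h1
    rw [spectralCoeff_sub, sub_eq_zero]
    exact mul_left_cancel₀ (neg_ne_zero.mpr Complex.I_ne_zero) h1

end

end Whitham

/-! ### Fourier coefficients of derivatives and of nonconstant waves -/

namespace Whitham

noncomputable section

open EllTwo

/-- Integration by parts over one period; the boundary terms cancel by periodicity. -/
theorem fourierCoeff_lift_deriv {f f' : ℝ → ℂ} (hf : Function.Periodic f (2 * π))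
    (hf' : Function.Periodic f' (2 * π)) (hd : ∀ x, HasDerivAt f (f' x) x) (hc : Continuous f')
    (n : ℤ) : fourierCoeff (hf'.lift : AddCircle (2 * π) → ℂ) n
      = Complex.I * n * fourierCoeff (hf.lift : AddCircle (2 * π) → ℂ) n := by
  set e : ℝ → ℂ := fun x => Complex.exp (-(Complex.I * n * x)) with he
  have hexp : ∀ x : ℝ, fourier (-n) (x : AddCircle (2 * π)) = e x := fun x => by
    rw [fourier_coe_apply]
    simp only [he]
    congr 1
    push_cast
    have : (π : ℂ) ≠ 0 := by exact_mod_cast Real.pi_ne_zero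
    field_simp
  have hed : ∀ x, HasDerivAt e (-(Complex.I * n) * e x) x := fun x => by
    have h1 : HasDerivAt (fun x : ℝ => -(Complex.I * n * (x : ℂ))) (-(Complex.I * n)) x := by
      simpa using ((hasDerivAt_id x).ofReal_comp.const_mul (Complex.I * n)).fun_neg
    rw [mul_comm]
    exact h1.cexp
  have hec : Continuous e := by fun_prop
  have hper : e (2 * π) = e 0 := by
    rw [← hexp, ← hexp, AddCircle.coe_period]
    rfl
  have key := intervalIntegral.integral_mul_deriv_eq_deriv_mul (a := 0) (b := 2 * π)
    (fun x _ => hed x) (fun x _ => hd x)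
    ((continuous_const.mul hec).intervalIntegrable _ _) (hc.intervalIntegrable _ _)
  have hf0 : f (2 * π) = f 0 := by simpa using hf 0
  rw [hf0, hper, sub_self, zero_sub] at key
  rw [fourierCoeff_eq_intervalIntegral _ n 0, fourierCoeff_eq_intervalIntegral _ n 0]
  simp only [zero_add, Function.Periodic.lift_coe, hexp, smul_eq_mul]
  rw [key, mul_smul_comm, ← intervalIntegral.integral_const_mul]
  simp only [neg_mul, intervalIntegral.integral_neg, neg_neg, mul_assoc]

theorem periodic_of_hasDerivAt {f f' : ℝ → ℂ} {T : ℝ} (hf : Function.Periodic f T)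
    (hd : ∀ x, HasDerivAt f (f' x) x) : Function.Periodic f' T := fun x => by
  have h1 : HasDerivAt (fun y => f (y + T)) (f' (x + T)) x := (hd (x + T)).comp_add_const x T
  rw [show (fun y => f (y + T)) = f from funext hf] at h1
  exact h1.unique (hd x)

theorem memℓp_mul_fourierCoeff {w : C(AddCircle (2 * π), ℝ)}
    (h : ContDiff ℝ ∞ (fun z : ℝ => w (z : AddCircle (2 * π)))) :
    Memℓp (fun n : ℤ => (n : ℂ) * fourierCoeff (fun x => (w x : ℂ)) n) 2 := by
  set g : ℝ → ℝ := fun z => w (z : AddCircle (2 * π)) with hg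
  have hdiff : Differentiable ℝ g := h.differentiable (by simp)
  have hcont : Continuous (deriv g) := h.continuous_deriv (by simp)
  set f : ℝ → ℂ := fun z => (g z : ℂ) with hfdef
  set f' : ℝ → ℂ := fun z => ((deriv g z : ℝ) : ℂ) with hf'def
  have hd : ∀ x, HasDerivAt f (f' x) x := fun x => (hdiff x).hasDerivAt.ofReal_comp
  have hf : Function.Periodic f (2 * π) := fun x => by
    simp only [hfdef, hg, AddCircle.coe_add_period]
  have hf' := periodic_of_hasDerivAt hf hd
  have hc : Continuous f' := Complex.continuous_ofReal.comp hcont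
  have hlift : (hf.lift : AddCircle (2 * π) → ℂ) = fun x => (w x : ℂ) := by
    ext x
    induction x using QuotientAddGroup.induction_on with
    | H z => rfl
  have hclift : Continuous (hf'.lift : AddCircle (2 * π) → ℂ) :=
    continuous_coinduced_dom.mpr hc
  have hmem := lp.memℓp (coefL ⟨hf'.lift, hclift⟩)
  refine memℓp_iff.mpr ((memℓp_iff.mp hmem).congr fun n => ?_)
  rw [coefL_apply]
  change ‖fourierCoeff (hf'.lift : AddCircle (2 * π) → ℂ) n‖ ^ 2 = _
  rw [fourierCoeff_lift_deriv hf hf' hd hc, hlift, mul_assoc, norm_mul, Complex.norm_I, one_mul]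

theorem IsTravelingWave.waveSequence {m : ℝ → ℝ} {κ c : ℝ} {w : C(AddCircle (2 * π), ℝ)}
    (h : IsTravelingWave m κ c w) : WaveSequence m κ c (waveSeq w) (waveConv w) where
  conv := isConv_waveConv w
  star_apply := star_waveSeq w
  equation _ hn := h.coefficient_equation hn
  derivative := by
    simp only [waveSeq_apply]
    exact memℓp_mul_fourierCoeff h.smooth

/-- If only the zeroth coefficient survives, the Fourier series is trivially summable and represents
the function pointwise. -/
theorem exists_waveSeq_ne_zero {w : C(AddCircle (2 * π), ℝ)} (h : ¬ ∃ r : ℝ, ∀ z, w z = r) :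
    ∃ n : ℤ, n ≠ 0 ∧ waveSeq w n ≠ 0 := by
  by_contra! h0
  refine h ⟨(waveSeq w 0).re, fun z => ?_⟩
  have hs := hasSum_single (f := fun n : ℤ => fourierCoeff (complexify w) n) 0
    (fun n hn => by rw [← coefL_apply]; exact h0 n hn)
  have h1 := has_pointwise_sum_fourier_series_of_summable hs.summable z
  have h2 := hasSum_single (f := fun n : ℤ => fourierCoeff (complexify w) n • fourier n z) 0
    (fun n hn => by rw [← coefL_apply, show coefL (complexify w) n = 0 from h0 n hn, zero_smul])
  have h3 := h1.unique h2
  rw [fourier_zero, smul_eq_mul, mul_one, ← coefL_apply] at h3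
  exact congrArg Complex.re h3

/-! ### Modulational stability and instability -/

/-- With Γ = (zm)' - m(0) and D = m(z) - m(2z), one has s + q = z(zm)''/2 and σ + 2/Γ = Δ_BF/(DΓ),
which gives the factor 2z/Γ². A nonzero index forces Γ ≠ 0 and also D ≠ 0, because division by zero
yields 0. -/
theorem discriminant_eq_mul_indexMI {g d T z : ℝ} (hg : 0 < g) (hd : 0 < d) (hT : 0 < T)
    (hz : 0 < z) (hI : indexMI (phaseSpeed g d T) z ≠ 0) :
    ∃ r > 0, phaseSpeed g d T z - phaseSpeed g d T 0 + z * phaseSpeedDeriv g d T z ≠ 0 ∧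
      discriminant (z * phaseSpeedDeriv g d T z) (z ^ 2 * phaseSpeedDeriv₂ g d T z / 2)
        (phaseSpeed g d T z - phaseSpeed g d T 0)
        (phaseSpeed g d T z - phaseSpeed g d T (z * 2))⁻¹
      = r * indexMI (phaseSpeed g d T) z := by
  unfold indexMI indexBF at hI ⊢
  rw [deriv_mul_phaseSpeed hg hd hT hz, iteratedDeriv_mul_phaseSpeed hg hd hT hz,
    mul_comm 2 z] at hI ⊢
  rw [← add_sub_right_comm]
  set Γ := phaseSpeed g d T z + z * phaseSpeedDeriv g d T z - phaseSpeed g d T 0 with hΓ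
  set D := phaseSpeed g d T z - phaseSpeed g d T (z * 2) with hD
  have hΓ0 : Γ ≠ 0 := by
    intro h
    rw [h] at hI
    simp at hI
  have hD0 : D ≠ 0 := by
    intro h
    rw [h] at hI
    simp at hI
  have e : phaseSpeed g d T z - phaseSpeed g d T 0 + z * phaseSpeedDeriv g d T z = Γ := by
    rw [hΓ]; ring
  refine ⟨2 * z / Γ ^ 2, by positivity, hΓ0, ?_⟩
  rw [discriminant, e]
  field_simp
  ring

/-- The sign of the discriminant decides between modulational stability and instability. -/
theorem RegularSymbol.exists_modulational_dichotomy {m : ℝ → ℝ} {κ δ L s q : ℝ}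
    (hm : RegularSymbol m κ δ L s q) (hΓ : m κ - m 0 + s ≠ 0)
    (hK : discriminant s q (m κ - m 0) (m κ - m (κ * 2))⁻¹ ≠ 0) :
    ∃ ε > 0, ∀ (c : ℝ) (w : C(AddCircle (2 * π), ℝ)), IsTravelingWave m κ c w →
      (¬ ∃ r : ℝ, ∀ z, w z = r) → ‖w‖ < ε → |c - m κ| < ε →
      (discriminant s q (m κ - m 0) (m κ - m (κ * 2))⁻¹ < 0 → ModulationallyUnstable m κ c w) ∧
      (0 < discriminant s q (m κ - m 0) (m κ - m (κ * 2))⁻¹ → ModulationallyStable m κ c w) := by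
  have hδ := hm.gap_pos
  obtain ⟨ε, hε, hmain⟩ := hm.exists_spectral_dichotomy hΓ hK
  -- Normalization of the wave triples the smallness parameter and requires it to be at most δ/32.
  refine ⟨min (ε / 3) (δ / 32), by positivity, fun c w hw hne hwε hcε => ?_⟩
  obtain ⟨u, hu, a, hs⟩ := hw.waveSequence.exists_smallWave hm (min_le_right (ε / 3) (δ / 32))
    ((norm_waveConv_le w).trans hwε.le) hcε.le (exists_waveSeq_ne_zero hne)
  have hs' : SmallWave m κ (c - 2 * (waveSeq w 0).re) ε a (normalizedSeq u (waveSeq w))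
      (normalizedConv u (waveSeq w) (waveConv w)) := by
    have h3 : 3 * min (ε / 3) (δ / 32) ≤ ε := by linarith [min_le_left (ε / 3) (δ / 32)]
    exact { hs with norm_le := hs.norm_le.trans h3, speed := hs.speed.trans h3 }
  obtain ⟨hneg, hpos⟩ := hmain _ _ _ _ hs'
  have hv0 : star (waveSeq w 0) = waveSeq w 0 := by simpa using star_waveSeq w 0
  have hnorm : ∀ (μ : ℂ) (ξ : ℝ) (x : EllTwo) (n : ℤ), spectralCoeff m κ
      (c - 2 * (waveSeq w 0).re) (normalizedConv u (waveSeq w) (waveConv w)) μ ξ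
        (phaseShift u x) n = u ^ n * spectralCoeff m κ c (waveConv w) μ ξ x n :=
    spectralCoeff_normalized hu hv0
  have hun : ∀ n : ℤ, u ^ n ≠ 0 := fun n => zpow_ne_zero n (ne_zero_of_norm_eq_one hu)
  refine ⟨fun hd ε' hε' => ?_, fun hd => ?_⟩
  · obtain ⟨ξ, μ, hξ, hμ, him, φ, hφ, h0⟩ := hneg hd ε' hε'
    refine ⟨ξ, hξ, Complex.I * μ, mem_unboundedSpectrum_blochOp (x := phaseShift u⁻¹ φ) ?_ ?_,
      by simpa using hμ, by simpa using him⟩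
    · intro h
      rw [← phaseShift_phaseShift_inv hu φ, h, map_zero] at hφ
      exact hφ rfl
    · intro n
      have h := h0 n
      rw [← phaseShift_phaseShift_inv hu φ, hnorm] at h
      exact (mul_eq_zero.mp h).resolve_left (hun n)
  · obtain ⟨δ', hδ', h⟩ := hpos hd
    refine ⟨δ', hδ', fun ξ hξ lam hlam hlamn => ?_⟩
    by_contra hre
    -- Here μ = -iλ, so a nonzero real part of λ is a nonzero imaginary part of μ. The solution
    -- operator is then conjugated back by the phase shift.
    obtain ⟨hinj, R, hR⟩ := h ξ (-Complex.I * lam) hξ (by simpa using hlamn) (by simpa using hre)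
    have hlam' : lam = Complex.I * (-Complex.I * lam) := by
      rw [← mul_assoc, mul_neg, Complex.I_mul_I, neg_neg, one_mul]
    rw [hlam'] at hlam
    refine notMem_unboundedSpectrum_blochOp (fun x hx => ?_)
      ⟨(phaseShift u⁻¹).comp (R.comp (phaseShift u)), fun g n => ?_⟩ hlam
    · have h1 := hinj (phaseShift u x) fun n => by rw [hnorm, hx, mul_zero]
      rw [← phaseShift_inv_phaseShift hu x, h1, map_zero]
    · have h1 := hR (phaseShift u g) n
      rw [← phaseShift_phaseShift_inv hu (R (phaseShift u g)), hnorm, phaseShift_apply hu] at h1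
      exact mul_left_cancel₀ (hun n) h1

end

end Whitham

theorem theorem3p1 (g d T : ℝ) (hg : 0 < g) (hd : 0 < d) (hT : 0 < T)
    (hT3 : T / (g * d ^ 2) ≠ 1 / 3) (k : ℝ) (hk : k ∈ Whitham.admissible g d T) :
    ∃ ε > 0, ∀ (c : ℝ) (w : C(AddCircle (2 * Real.pi), ℝ)),
      Whitham.IsTravelingWave (Whitham.phaseSpeed g d T) (k * d) c w →
      (¬ ∃ r : ℝ, ∀ z, w z = r) →
      ‖w‖ < ε → |c - Whitham.phaseSpeed g d T (k * d)| < ε →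
      (Whitham.indexMI (Whitham.phaseSpeed g d T) (k * d) < 0 →
        Whitham.ModulationallyUnstable (Whitham.phaseSpeed g d T) (k * d) c w) ∧
      (0 < Whitham.indexMI (Whitham.phaseSpeed g d T) (k * d) →
        Whitham.ModulationallyStable (Whitham.phaseSpeed g d T) (k * d) c w) := by
  obtain ⟨δ, L, hm⟩ := Whitham.exists_regularSymbol_phaseSpeed hg hd hT hT3 hk
  have hz : 0 < k * d := mul_pos hk.1 hd
  -- For a vanishing index both implications are vacuous and any ε serves; otherwise the index has
  -- the sign of the discriminant.
  by_cases hI : Whitham.indexMI (Whitham.phaseSpeed g d T) (k * d) = 0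
  · exact ⟨1, one_pos, fun c w _ _ _ _ =>
      ⟨fun h => absurd hI h.ne, fun h => absurd hI h.ne'⟩⟩
  obtain ⟨r, hr, hΓ, hK⟩ := Whitham.discriminant_eq_mul_indexMI hg hd hT hz hI
  obtain ⟨ε, hε, hmain⟩ := hm.exists_modulational_dichotomy hΓ
    (by rw [hK]; exact mul_ne_zero hr.ne' hI)
  rw [hK] at hmain
  refine ⟨ε, hε, fun c w hw hne hwε hcε => ?_⟩
  obtain ⟨h1, h2⟩ := hmain c w hw hne hwε hcε
  exact ⟨fun h => h1 (mul_neg_of_pos_of_neg hr h), fun h => h2 (mul_pos hr h)⟩
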